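/- Let $X$ be a connected (Hausdorff, second countable) $C^\infty$ Riemannian manifold without boundary, of finite dimension $d\ge 1$, with Riemannian gradient $\nabla^X$ and Riemannian volume measure $m$. Let $\rho:X\to[0,\infty)$ be Borel measurable and locally $m$-integrable, and put $\sigma=\rho\cdot m$. *Configurations.* Let $\Gamma_X$ be the set of all locally finite subsets $\gamma$ of $X$, identified with the measures $\sum_{x\in\gamma}\varepsilon_x$; write $N_B(\gamma)=\gamma(B)$ for the number of points of $\gamma$ in $B$, $\gamma_\Lambda=\gamma\cap\Lambda$, and $\langle f,\gamma\rangle=\sum_{x\in\gamma}f(x)$. Let $\mathcal B(\Gamma_X)$ be the $\sigma$-algebra generated by the maps $N_\Lambda$, $\Lambda\subset X$ open and relatively compact, and for Borel $A\subset X$ let $\mathcal B_A(\Gamma_X)$ be generated by the maps $N_B$, $B\subset A$ Borel and relatively compact. Let $\pi_\sigma$ be the Poisson measure on $\Gamma_X$ with intensity $\sigma$, that is, the probability measure whose image under $\gamma\mapsto\gamma_\Lambda$, for each relatively compact open $\Lambda$, is $e^{-\sigma(\Lambda)}\sum_{n\ge0}\frac1{n!}\sigma_{\Lambda,n}$, where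 $\sigma_{\Lambda,n}$ is the image of $\sigma^{\otimes n}$ on $\{(x_1,\dots,x_n)\in\Lambda^n: x_i\ne x_j \text{ for } i\neq j\}$ under $(x_1,\dots,x_n)\mapsto\{x_1,\dots,x_n\}$. *Gibbs measures.* Let $\Phi:\Gamma_X\to\mathbb R\cup\{+\infty\}$ be a potential: $\Phi(\gamma)=0$ if $\gamma$ is infinite, $\Phi(\emptyset)=0$, and $\gamma\mapsto\Phi(\gamma_\Lambda)$ is $\mathcal B_\Lambda(\Gamma_X)$-measurable for every relatively compact Borel set $\Lambda$. For relatively compact Borel $\Lambda$ let $$E_\Lambda(\gamma)=\sum_{\gamma'\subset\gamma,\ \gamma'(\Lambda)>0}\Phi(\gamma')$$ if this sum converges absolutely, and $E_\Lambda(\gamma)=+\infty$ otherwise. For relatively compact open $\Lambda$ put $Z_\Lambda(\gamma)=\int e^{-E_\Lambda(\gamma_{X\setminus\Lambda}+\gamma'_\Lambda)}\,\pi_\sigma(d\gamma')$ and $$\Pi_\Lambda(\gamma,\Delta)=1_{\{Z_\Lambda<\infty\}}(\gamma)\,Z_\Lambda(\gamma)^{-1}\int 1_\Delta(\gamma_{X\setminus\Lambda}+\gamma'_\Lambda)\,e^{-E_\Lambda(\gamma_{X\setminus\Lambda}+\gamma'_\Lambda)}\,\pi_\sigma(d\gamma').$$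 Let $\mu$ be a grand canonical Gibbs measure, i.e. a probability measure on $(\Gamma_X,\mathcal B(\Gamma_X))$ with $\int\Pi_\Lambda(\gamma,\Delta)\,\mu(d\gamma)=\mu(\Delta)$ for all relatively compact open $\Lambda$ and all $\Delta\in\mathcal B(\Gamma_X)$, and suppose that $\mu$ has Radon mean: $\int\gamma(K)\,\mu(d\gamma)<\infty$ for all compact $K\subset X$. *The form.* Let $\mathcal FC_b^\infty$ be the set of all functions $F=g(\langle f_1,\cdot\rangle,\dots,\langle f_N,\cdot\rangle)$ on $\Gamma_X$ with $g\in C_b^\infty(\mathbb R^N)$ (all derivatives bounded) and $f_1,\dots,f_N\in C_0^\infty(X)$ (compact support). Put $\nabla^\Gamma F(\gamma)=\sum_i\partial_ig(\langle f_1,\gamma\rangle,\dots,\langle f_N,\gamma\rangle)\nabla^Xf_i$, which at the points of $\gamma$ does not depend on the representation of $F$, and $$\mathcal E_\mu^\Gamma(F,G)=\int_{\Gamma_X}\sum_{x\in\gamma}\langle\nabla^\Gamma F(\gamma)(x),\nabla^\Gamma G(\gamma)(x)\rangle_{T_xX}\,\mu(d\gamma).$$ *The condition.* For $\gamma\in\Gamma_X$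 let $\rho_\gamma(x)=e^{-E_{\{x\}}(\gamma\cup\{x\})}\rho(x)$, $x\in X$. With the convention $1/0=+\infty$, suppose that one of the following holds. (a) For $\mu$-a.e. $\gamma$: $\rho_\gamma=0$ $m$-a.e. on the complement of the set of those $x\in X$ that have an open neighbourhood $U$ with $\int_U\rho_\gamma^{-1}\,dm<\infty$. (b) $X=\mathbb R^d$ with the Euclidean metric, and for $\mu$-a.e. $\gamma$ the function $r=\rho_\gamma$ satisfies, for each $1\le i\le d$: for Lebesgue-a.e. $y\in\mathbb R^{d-1}$ such that $r_y^{(i)}(s):=r(y_1,\dots,y_{i-1},s,y_i,\dots,y_{d-1})$ has $\int_{\mathbb R}r^{(i)}_y(s)\,ds>0$, one has $r_y^{(i)}=0$ a.e. on the complement of the set of those $t\in\mathbb R$ for which $\int_{t-\varepsilon}^{t+\varepsilon}\frac{ds}{r_y^{(i)}(s)}<\infty$ for some $\varepsilon>0$. Then $\mathcal E^\Gamma_\mu$ is well defined on the set of $\mu$-classes of $\mathcal FC_b^\infty$ (the integrals exist, and $\nabla^\Gamma F=\nabla^\Gamma G$ in $L^2(X\to TX;\gamma)$ for $\mu$-a.e.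 $\gamma$ whenever $F=G$ $\mu$-a.e.), and it is closable on $L^2(\Gamma_X;\mu)$: if $F_n\in\mathcal FC_b^\infty$, $\mathcal E_\mu^\Gamma(F_n-F_m,F_n-F_m)\to0$ as $n,m\to\infty$ and $\|F_n\|_{L^2(\Gamma_X;\mu)}\to0$, then $\mathcal E_\mu^\Gamma(F_n,F_n)\to0$. -/

import Mathlib

open MeasureTheory Set Filter Topology Bundle
open scoped Manifold ContDiff ENNReal NNReal

noncomputable section

namespace ConfigSpace

/-- The Euclidean space `ℝ^d`. -/
abbrev Euc (d : ℕ) : Type := EuclideanSpace ℝ (Fin d)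

/-! ### Riemannian gradient and Riemannian volume -/

section Manifold

variable (d : ℕ) {X : Type*} [TopologicalSpace X] [ChartedSpace (Euc d) X]
  [RiemannianBundle (fun x : X => TangentSpace (𝓡 d) x)]

instance instFiniteDimensionalTangentSpace (x : X) :
    FiniteDimensional ℝ (TangentSpace (𝓡 d) x) :=
  inferInstanceAs (FiniteDimensional ℝ (Euc d))

/-- The Riemannian gradient: the vector in `T_x X` representing the differential of `f` at `x`
with respect to the Riemannian metric. -/
def riemGrad (f : X → ℝ) (x : X) : TangentSpace (𝓡 d) x :=
  haveI : CompleteSpace (TangentSpace (𝓡 d) x) := FiniteDimensional.complete ℝ _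
  (InnerProductSpace.toDual ℝ (TangentSpace (𝓡 d) x)).symm (mfderiv (𝓡 d) 𝓘(ℝ, ℝ) f x)

theorem inner_riemGrad (f : X → ℝ) (x : X) (v : TangentSpace (𝓡 d) x) :
    inner ℝ (riemGrad d f x) v = mfderiv (𝓡 d) 𝓘(ℝ, ℝ) f x v := by
  have : CompleteSpace (TangentSpace (𝓡 d) x) := FiniteDimensional.complete ℝ _
  exact InnerProductSpace.toDual_symm_apply

/-- The matrix `(g_{ij}(y))` of the Riemannian metric in the chart `e` at the coordinate
point `y`. -/
def chartGram (e : OpenPartialHomeomorph X (Euc d)) (y : Euc d) : Matrix (Fin d) (Fin d) ℝ :=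
  Matrix.gram (E := TangentSpace (𝓡 d) (e.symm y)) ℝ fun i =>
    mfderiv (𝓡 d) (𝓡 d) e.symm y (EuclideanSpace.single i (1 : ℝ))

/-- The measure `√(det g_{ij}) dy` of the chart `e`, carried over to (the domain of `e` in) `X`. -/
def chartVolume [MeasurableSpace X] (e : OpenPartialHomeomorph X (Euc d)) : Measure X :=
  ((volume.restrict e.target).withDensity
    fun y => ENNReal.ofReal (Real.sqrt (chartGram d e y).det)).map e.symm

/-- The Riemannian volume measure `m`: the measures `chartVolume` of the charts of the atlas agree
on overlaps of chart domains, and `m` is obtained by gluing them, i.e. it is the least measure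
dominating all of them. That its restriction to each chart domain is the chart volume
is proved in `riemannianVolume_restrict_chart_source`. -/
def riemannianVolume (X : Type*) [TopologicalSpace X] [ChartedSpace (Euc d) X]
    [RiemannianBundle (fun x : X => TangentSpace (𝓡 d) x)] [MeasurableSpace X] : Measure X :=
  ⨆ x : X, chartVolume d (chartAt (Euc d) x)

section VolumeLemmas

set_option linter.unusedSectionVars false

variable {d}

theorem det_gram_of_eq_sum {V : Type*} [NormedAddCommGroup V] [InnerProductSpace ℝ V]
    (w w' : Fin d → V) (M : Matrix (Fin d) (Fin d) ℝ) (h : ∀ i, w' i = ∑ k, M k i • w k) :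
    (Matrix.gram ℝ w').det = M.det ^ 2 * (Matrix.gram ℝ w).det := by
  have key : Matrix.gram ℝ w' = M.transpose * Matrix.gram ℝ w * M := by
    ext i j
    simp only [Matrix.gram_apply, Matrix.mul_apply, Matrix.transpose_apply]
    rw [h, h, sum_inner]
    simp only [inner_sum, inner_smul_left, inner_smul_right, Finset.sum_mul]
    rw [Finset.sum_comm]
    refine Finset.sum_congr rfl fun k _ => Finset.sum_congr rfl fun l _ => ?_
    simp
    ring
  rw [key, Matrix.det_mul, Matrix.det_mul, Matrix.det_transpose]
  ring

theorem det_tangentGram_comp {p q : X} (hpq : p = q) (L L' D : Euc d →L[ℝ] Euc d)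
    (h : L' = L.comp D) :
    (Matrix.gram (E := TangentSpace (𝓡 d) q) ℝ fun i => L' (EuclideanSpace.single i 1)).det =
      D.det ^ 2 *
        (Matrix.gram (E := TangentSpace (𝓡 d) p) ℝ fun i =>
          L (EuclideanSpace.single i 1)).det := by
  subst hpq
  set M : Matrix (Fin d) (Fin d) ℝ :=
    LinearMap.toMatrix (EuclideanSpace.basisFun (Fin d) ℝ).toBasis
      (EuclideanSpace.basisFun (Fin d) ℝ).toBasis (D : Euc d →ₗ[ℝ] Euc d) with hM
  have hD : ∀ i, D (EuclideanSpace.single i (1 : ℝ)) =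
      ∑ k, M k i • EuclideanSpace.single k (1 : ℝ) := by
    intro i
    have := ((EuclideanSpace.basisFun (Fin d) ℝ).toBasis.sum_repr
      (D (EuclideanSpace.single i (1 : ℝ)))).symm
    simpa [hM, LinearMap.toMatrix_apply] using this
  have hdet : D.det = M.det := by
    rw [hM, LinearMap.det_toMatrix]
  rw [hdet]
  refine det_gram_of_eq_sum (V := TangentSpace (𝓡 d) p) _ _ M fun i => ?_
  have h1 : L' (EuclideanSpace.single i 1) =
      ∑ k, M k i • L (EuclideanSpace.single k (1 : ℝ)) := by
    rw [h, ContinuousLinearMap.comp_apply, hD, map_sum]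
    simp only [map_smul]
  exact h1

variable [IsManifold (𝓡 d) ∞ X]

theorem transition_facts {e e' : OpenPartialHomeomorph X (Euc d)} (he : e ∈ atlas (Euc d) X)
    (he' : e' ∈ atlas (Euc d) X) {y : Euc d} (hy : y ∈ e.target) (hy' : e.symm y ∈ e'.source) :
    HasFDerivAt (e' ∘ e.symm) (fderiv ℝ (e' ∘ e.symm) y) y ∧
      (chartGram d e y).det =
        (fderiv ℝ (e' ∘ e.symm) y).det ^ 2 * (chartGram d e' (e' (e.symm y))).det := by
  have hm := IsManifold.subset_maximalAtlas (I := 𝓡 d) (n := ∞) he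
  have hm' := IsManifold.subset_maximalAtlas (I := 𝓡 d) (n := ∞) he'
  have h1 : MDifferentiableAt (𝓡 d) (𝓡 d) e.symm y :=
    ((contMDiffOn_symm_of_mem_maximalAtlas hm).contMDiffAt
      (e.open_target.mem_nhds hy)).mdifferentiableAt (by simp)
  have h2 : MDifferentiableAt (𝓡 d) (𝓡 d) e' (e.symm y) :=
    ((contMDiffOn_of_mem_maximalAtlas hm').contMDiffAt
      (e'.open_source.mem_nhds hy')).mdifferentiableAt (by simp)
  have h3 : MDifferentiableAt (𝓡 d) (𝓡 d) e'.symm ((e' ∘ e.symm) y) :=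
    ((contMDiffOn_symm_of_mem_maximalAtlas hm').contMDiffAt
      (e'.open_target.mem_nhds (e'.map_source hy'))).mdifferentiableAt (by simp)
  have h4 : MDifferentiableAt (𝓡 d) (𝓡 d) (e' ∘ e.symm) y := h2.comp y h1
  have h5 : e.symm =ᶠ[𝓝 y] e'.symm ∘ (e' ∘ e.symm) := by
    have hopen : IsOpen (e.target ∩ e.symm ⁻¹' e'.source) :=
      e.isOpen_inter_preimage_symm e'.open_source
    filter_upwards [hopen.mem_nhds ⟨hy, hy'⟩] with z hz
    exact (e'.left_inv hz.2).symm
  refine ⟨(mdifferentiableAt_iff_differentiableAt.1 h4).hasFDerivAt, ?_⟩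
  have h6 : (mfderiv (𝓡 d) (𝓡 d) e.symm y : Euc d →L[ℝ] Euc d) =
      ContinuousLinearMap.comp
        (mfderiv (𝓡 d) (𝓡 d) e'.symm ((e' ∘ e.symm) y) : Euc d →L[ℝ] Euc d)
        (fderiv ℝ (e' ∘ e.symm) y) := by
    rw [← mfderiv_eq_fderiv]
    have := mfderiv_comp y h3 h4
    rw [← h5.mfderiv_eq] at this
    exact this
  have h7 : e'.symm ((e' ∘ e.symm) y) = e.symm y := e'.left_inv hy'
  exact det_tangentGram_comp h7 _ _ _ h6

variable [MeasurableSpace X] [BorelSpace X]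

theorem chartVolume_apply (e : OpenPartialHomeomorph X (Euc d)) {A : Set X}
    (hA : MeasurableSet A) :
    chartVolume d e A = ∫⁻ y in e.symm ⁻¹' A ∩ e.target,
      ENNReal.ofReal (Real.sqrt (chartGram d e y).det) := by
  have h1 : AEMeasurable e.symm (volume.restrict e.target) :=
    e.continuousOn_symm.aemeasurable e.open_target.measurableSet
  rw [chartVolume, Measure.map_apply_of_aemeasurable
    (h1.mono_ac (withDensity_absolutelyContinuous _ _)) hA, withDensity_apply',
    Measure.restrict_restrict' e.open_target.measurableSet]

theorem measurableSet_chart_preimage (e : OpenPartialHomeomorph X (Euc d)) {A : Set X}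
    (hA : MeasurableSet A) : MeasurableSet (e.symm ⁻¹' A ∩ e.target) := by
  have h : Measurable (e.target.domRestrict e.symm) :=
    (continuousOn_iff_continuous_domRestrict.1 e.continuousOn_symm).measurable
  have := e.open_target.measurableSet.subtype_image (h hA)
  convert this using 1
  ext y
  simp [and_comm, Set.domRestrict]

theorem chartVolume_compat {e e' : OpenPartialHomeomorph X (Euc d)} (he : e ∈ atlas (Euc d) X)
    (he' : e' ∈ atlas (Euc d) X) {A : Set X} (hA : MeasurableSet A) (h : A ⊆ e.source)
    (h' : A ⊆ e'.source) : chartVolume d e A = chartVolume d e' A := by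
  rw [chartVolume_apply e hA, chartVolume_apply e' hA]
  have himg : e'.symm ⁻¹' A ∩ e'.target = (e' ∘ e.symm) '' (e.symm ⁻¹' A ∩ e.target) := by
    ext z
    constructor
    · rintro ⟨hz, hzt⟩
      refine ⟨e (e'.symm z), ⟨?_, e.map_source (h hz)⟩, ?_⟩
      · change e.symm (e (e'.symm z)) ∈ A
        rw [e.left_inv (h hz)]; exact hz
      · change e' (e.symm (e (e'.symm z))) = z
        rw [e.left_inv (h hz), e'.right_inv hzt]
    · rintro ⟨y, ⟨hy, hyt⟩, rfl⟩
      refine ⟨?_, e'.map_source (h' hy)⟩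
      change e'.symm (e' (e.symm y)) ∈ A
      rw [e'.left_inv (h' hy)]; exact hy
  have hinj : InjOn (e' ∘ e.symm) (e.symm ⁻¹' A ∩ e.target) := by
    rintro y ⟨hy, hyt⟩ z ⟨hz, hzt⟩ hyz
    exact e.symm.injOn hyt hzt (e'.injOn (h' hy) (h' hz) hyz)
  rw [himg, lintegral_image_eq_lintegral_abs_det_fderiv_mul volume
    (measurableSet_chart_preimage e hA)
    (fun y hy => (transition_facts he he' hy.2 (h' hy.1)).1.hasFDerivWithinAt) hinj]
  refine setLIntegral_congr_fun (measurableSet_chart_preimage e hA) fun y hy => ?_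
  change _ = _ * ENNReal.ofReal (Real.sqrt (chartGram d e' (e' (e.symm y))).det)
  rw [(transition_facts he he' hy.2 (h' hy.1)).2, Real.sqrt_mul (sq_nonneg _),
    Real.sqrt_sq_eq_abs, ENNReal.ofReal_mul (abs_nonneg _)]

theorem chartVolume_compl_source (e : OpenPartialHomeomorph X (Euc d)) :
    chartVolume d e e.sourceᶜ = 0 := by
  rw [chartVolume_apply e e.open_source.measurableSet.compl]
  have : e.symm ⁻¹' e.sourceᶜ ∩ e.target = ∅ := by
    ext y
    simp only [mem_inter_iff, mem_preimage, mem_compl_iff, mem_empty_iff_false, iff_false, not_and]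
    exact fun hy hyt => hy (e.map_target hyt)
  rw [this]; simp

/-- On every chart domain, the Riemannian volume is `√(det g_{ij}) dy`. -/
theorem riemannianVolume_restrict_chart_source [SecondCountableTopology X] (x : X) :
    (riemannianVolume d X).restrict (chartAt (Euc d) x).source =
      chartVolume d (chartAt (Euc d) x) := by
  have : Nonempty X := ⟨x⟩
  obtain ⟨s, hsc, hs⟩ := TopologicalSpace.countable_cover_nhds
    (f := fun z : X => (chartAt (Euc d) z).source) fun z => chart_source_mem_nhds (Euc d) z
  have hsne : s.Nonempty := by
    by_contra hne
    rw [not_nonempty_iff_eq_empty] at hne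
    have : x ∈ ⋃ z ∈ s, (chartAt (Euc d) z).source := hs ▸ mem_univ x
    simp [hne] at this
  obtain ⟨u, rfl⟩ := hsc.exists_eq_range hsne
  set U : ℕ → Set X := fun k => (chartAt (Euc d) (u k)).source with hU
  have hUm : ∀ k, MeasurableSet (U k) := fun k => (chartAt (Euc d) (u k)).open_source.measurableSet
  have hUu : ⋃ k, disjointed U k = univ := by
    rw [iUnion_disjointed]; simpa [hU] using hs
  have hDm : ∀ k, MeasurableSet (disjointed U k) := fun k => MeasurableSet.disjointed hUm k
  set m : Measure X := Measure.sum fun k =>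
    (chartVolume d (chartAt (Euc d) (u k))).restrict (disjointed U k) with hm
  have hat : ∀ z : X, chartAt (Euc d) z ∈ atlas (Euc d) X := fun z => chart_mem_atlas _ z
  have key : ∀ z : X, ∀ A : Set X, MeasurableSet A →
      chartVolume d (chartAt (Euc d) z) A = m (A ∩ (chartAt (Euc d) z).source) := by
    intro z A hA
    have hSm := (chartAt (Euc d) z).open_source.measurableSet
    have e1 : chartVolume d (chartAt (Euc d) z) A =
        chartVolume d (chartAt (Euc d) z) (A ∩ (chartAt (Euc d) z).source) :=
      (measure_inter_conull (chartVolume_compl_source _)).symm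
    rw [e1, hm, Measure.sum_apply _ (hA.inter hSm)]
    have e2 : chartVolume d (chartAt (Euc d) z) (A ∩ (chartAt (Euc d) z).source) =
        ∑' k, chartVolume d (chartAt (Euc d) z)
          (A ∩ (chartAt (Euc d) z).source ∩ disjointed U k) := by
      rw [← measure_iUnion _ fun k => (hA.inter hSm).inter (hDm k), ← inter_iUnion, hUu, inter_univ]
      exact fun i j hij => ((disjoint_disjointed U hij).mono inter_subset_right inter_subset_right)
    rw [e2]
    refine tsum_congr fun k => ?_
    rw [Measure.restrict_apply (hA.inter hSm)]
    exact chartVolume_compat (hat z) (hat (u k)) ((hA.inter hSm).inter (hDm k))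
      (inter_subset_left.trans inter_subset_right)
      (inter_subset_right.trans (disjointed_subset U k))
  have hle : riemannianVolume d X ≤ m := by
    refine iSup_le fun z => Measure.le_iff.2 fun A hA => ?_
    rw [key z A hA]
    exact measure_mono inter_subset_left
  have hge : chartVolume d (chartAt (Euc d) x) ≤ riemannianVolume d X :=
    le_iSup (fun z : X => chartVolume d (chartAt (Euc d) z)) x
  have hSm := (chartAt (Euc d) x).open_source.measurableSet
  refine le_antisymm (Measure.le_iff.2 fun A hA => ?_) (Measure.le_iff.2 fun A hA => ?_)
  · rw [Measure.restrict_apply hA, key x A hA]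
    exact hle _
  · rw [Measure.restrict_apply hA, ← measure_inter_conull (chartVolume_compl_source _)]
    exact hge _

end VolumeLemmas

end Manifold

/-! ### Configuration space -/

/-- A configuration in `X`: a locally finite subset of `X`. -/
@[ext]
structure Config (X : Type*) [TopologicalSpace X] where
  /-- The underlying set of points. -/
  carrier : Set X
  locallyFinite : ∀ K : Set X, IsCompact K → (carrier ∩ K).Finite

namespace Config

variable {X : Type*} [TopologicalSpace X]

/-- The configuration given by a finite set. -/
def ofFinite (s : Set X) (hs : s.Finite) : Config X :=
  ⟨s, fun _ _ => hs.subset inter_subset_left⟩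

/-- The empty configuration. -/
def empty : Config X := ofFinite ∅ finite_empty

/-- `γ_Λ = γ ∩ Λ`. -/
def restr (γ : Config X) (Λ : Set X) : Config X :=
  ⟨γ.carrier ∩ Λ, fun K hK =>
    (γ.locallyFinite K hK).subset (inter_subset_inter_left K inter_subset_left)⟩

/-- The union of two configurations (the sum of the measures, if they are disjoint). -/
def union (γ η : Config X) : Config X :=
  ⟨γ.carrier ∪ η.carrier, fun K hK => by
    rw [union_inter_distrib_right]
    exact (γ.locallyFinite K hK).union (η.locallyFinite K hK)⟩

/-- `γ ∪ {x}`, written `γ + ε_x` when configurations are viewed as measures. -/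
def addPoint (γ : Config X) (x : X) : Config X :=
  γ.union (ofFinite {x} (finite_singleton x))

/-- `N_B(γ) = γ(B)`, the number of points of `γ` in `B`. -/
def count (γ : Config X) (B : Set X) : ℕ∞ := (γ.carrier ∩ B).encard

/-- `⟨f, γ⟩ = ∑_{x ∈ γ} f x` (for `f` with compact support, a finite sum). -/
def pairing (f : X → ℝ) (γ : Config X) : ℝ := ∑ᶠ x ∈ γ.carrier, f x

/-- The `σ`-algebra `B(Γ_X)`, generated by the counting maps `N_Λ` of the relatively compact
open sets `Λ`. -/
instance instMeasurableSpace : MeasurableSpace (Config X) :=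
  ⨆ (Λ : Set X) (_ : IsOpen Λ ∧ IsCompact (closure Λ)),
    MeasurableSpace.comap (fun γ : Config X => γ.count Λ) inferInstance

/-- The `σ`-algebra `B_A(Γ_X)` of events in `A`, generated by the counting maps `N_B` of the
relatively compact Borel sets `B ⊆ A`. -/
@[reducible] def localMeasurableSpace [MeasurableSpace X] (A : Set X) : MeasurableSpace (Config X) :=
  ⨆ (B : Set X) (_ : MeasurableSet B ∧ IsCompact (closure B) ∧ B ⊆ A),
    MeasurableSpace.comap (fun γ : Config X => γ.count B) inferInstance

end Config

/-! ### Poisson measure -/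

section Gibbs

variable {X : Type*} [TopologicalSpace X] [MeasurableSpace X]

/-- `σ_{Λ,n}`: the image of the product measure `σ^{⊗n}` on
`{(x_1, …, x_n) ∈ Λ^n | x_i ≠ x_j for i ≠ j}` under `(x_1, …, x_n) ↦ {x_1, …, x_n}`. -/
def nPointMeasure (σ : Measure X) (Λ : Set X) (n : ℕ) : Measure (Config X) :=
  ((Measure.pi fun _ : Fin n => σ.restrict Λ).restrict {x | Function.Injective x}).map
    fun x => Config.ofFinite (range x) (finite_range x)

/-- `P` is the Poisson measure with intensity `σ`: a probability measure whose image under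
`γ ↦ γ_Λ` is `e^{-σ(Λ)} ∑_n σ_{Λ,n} / n!`, for every relatively compact open `Λ`. -/
def IsPoissonMeasure (σ : Measure X) (P : Measure (Config X)) : Prop :=
  IsProbabilityMeasure P ∧
    ∀ Λ : Set X, IsOpen Λ → IsCompact (closure Λ) →
      P.map (fun γ => γ.restr Λ) =
        ENNReal.ofReal (Real.exp (-(σ Λ).toReal)) •
          Measure.sum fun n : ℕ => (n.factorial : ℝ≥0∞)⁻¹ • nPointMeasure σ Λ n

open Classical in
/-- The Poisson measure `π_σ` with intensity `σ`, the unique measure with the property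
`IsPoissonMeasure`. (It exists for every Radon measure `σ` without atoms. Where no such measure
exists, the value is the zero measure.) -/
def poissonMeasure (σ : Measure X) : Measure (Config X) :=
  if h : ∃ P, IsPoissonMeasure σ P then h.choose else 0

/-! ### Potentials and grand canonical Gibbs measures -/

/-- A potential `Φ : Γ_X → ℝ ∪ {+∞}`. -/
structure IsPotential (Φ : Config X → EReal) : Prop where
  ne_bot : ∀ γ, Φ γ ≠ ⊥
  eq_zero_of_infinite : ∀ γ : Config X, γ.carrier.Infinite → Φ γ = 0
  empty : Φ Config.empty = 0
  measurable : ∀ Λ : Set X, MeasurableSet Λ → IsCompact (closure Λ) →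
    Measurable[Config.localMeasurableSpace Λ] fun γ => Φ (γ.restr Λ)

open Classical in
/-- The conditional energy `E_Λ^Φ(γ)`: the sum of `Φ(γ')` over all `γ' ⊆ γ` with `γ'(Λ) > 0` if
this sum converges absolutely, and `+∞` otherwise. -/
def condEnergy (Φ : Config X → EReal) (Λ : Set X) (γ : Config X) : EReal :=
  if ∑' γ' : {γ' : Config X // γ'.carrier ⊆ γ.carrier ∧ (γ'.carrier ∩ Λ).Nonempty},
      (Φ γ').abs < ⊤ then
    ((∑' γ' : {γ' : Config X // γ'.carrier ⊆ γ.carrier ∧ (γ'.carrier ∩ Λ).Nonempty},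
      (Φ γ').toReal : ℝ) : EReal)
  else ⊤

/-- `exp(-E_Λ^Φ(γ))`, with `exp(-∞) = 0`. -/
def boltzmann (Φ : Config X → EReal) (Λ : Set X) (γ : Config X) : ℝ≥0∞ :=
  EReal.exp (-condEnergy Φ Λ γ)

/-- The partition function `Z_Λ^{σ,Φ}(γ)`. -/
def partitionFn (σ : Measure X) (Φ : Config X → EReal) (Λ : Set X) (γ : Config X) : ℝ≥0∞ :=
  ∫⁻ η, boltzmann Φ Λ ((γ.restr Λᶜ).union (η.restr Λ)) ∂(poissonMeasure σ)

open Classical in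
/-- The Gibbs kernel `Π_Λ^{σ,Φ}(γ, Δ)`. -/
def gibbsKernel (σ : Measure X) (Φ : Config X → EReal) (Λ : Set X) (γ : Config X)
    (Δ : Set (Config X)) : ℝ≥0∞ :=
  if partitionFn σ Φ Λ γ < ⊤ then
    (partitionFn σ Φ Λ γ)⁻¹ *
      ∫⁻ η, Δ.indicator 1 ((γ.restr Λᶜ).union (η.restr Λ)) *
        boltzmann Φ Λ ((γ.restr Λᶜ).union (η.restr Λ)) ∂(poissonMeasure σ)
  else 0

/-- `μ ∈ G_gc(σ, Φ)`: `μ` is a grand canonical Gibbs measure, i.e. a probability measure on `Γ_X`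
with `μ Π_Λ^{σ,Φ} = μ` for all relatively compact open `Λ`. -/
structure IsGrandCanonicalGibbs (σ : Measure X) (Φ : Config X → EReal)
    (μ : Measure (Config X)) : Prop where
  isProbabilityMeasure : IsProbabilityMeasure μ
  dlr : ∀ Λ : Set X, IsOpen Λ → IsCompact (closure Λ) → ∀ Δ : Set (Config X), MeasurableSet Δ →
    ∫⁻ γ, gibbsKernel σ Φ Λ γ Δ ∂μ = μ Δ

/-- `μ` has Radon mean: `∫ γ(K) μ(dγ) < ⊤` for all compact `K`. -/
def HasRadonMean (μ : Measure (Config X)) : Prop :=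
  ∀ K : Set X, IsCompact K → ∫⁻ γ, (γ.count K : ℝ≥0∞) ∂μ < ⊤

/-- `ρ_γ(x) = exp(-E_{x}^Φ(γ + ε_x)) ρ(x)`. -/
def rhoGamma (Φ : Config X → EReal) (ρ : X → ℝ≥0) (γ : Config X) (x : X) : ℝ≥0∞ :=
  boltzmann Φ {x} (γ.addPoint x) * ρ x

/-- The local `1/ρ₁`-integrability condition: `ρ₁ = 0` `m`-a.e. off the set of those `x` for which
`1/ρ₁` (with `1/0 = ∞`) is `m`-integrable over some open neighbourhood of `x`. -/
def LocalInvIntegrable (m : Measure X) (ρ₁ : X → ℝ≥0∞) : Prop :=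
  ∀ᵐ x ∂m, x ∉ {x | ∃ U : Set X, IsOpen U ∧ x ∈ U ∧ ∫⁻ y in U, (ρ₁ y)⁻¹ ∂m < ⊤} → ρ₁ x = 0

end Gibbs

/-! ### The condition on coordinate lines in `ℝ^d` -/

/-- `ρ_y^{(i)}(s) = ρ(y_1, …, y_{i-1}, s, y_i, …, y_{d-1})`, for `d = n + 1`. -/
def lineSection {n : ℕ} (ρ₁ : Euc (n + 1) → ℝ≥0∞) (i : Fin (n + 1)) (y : Fin n → ℝ) (s : ℝ) :
    ℝ≥0∞ :=
  ρ₁ (WithLp.toLp 2 (i.insertNth (α := fun _ => ℝ) s y))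

/-- `R(r)`: the set of those `t` for which `1/r` (with `1/0 = ∞`) is integrable over some interval
`(t - ε, t + ε)`. -/
def regularSet (r : ℝ → ℝ≥0∞) : Set ℝ :=
  {t | ∃ ε : ℝ, 0 < ε ∧ ∫⁻ s in Ioo (t - ε) (t + ε), (r s)⁻¹ < ⊤}

/-- The local `1/ρ₁`-integrability condition along almost every line parallel to a coordinate
axis of `ℝ^{n+1}`. -/
def LineInvIntegrable {n : ℕ} (ρ₁ : Euc (n + 1) → ℝ≥0∞) : Prop :=
  ∀ i : Fin (n + 1), ∀ᵐ y : Fin n → ℝ, 0 < ∫⁻ s, lineSection ρ₁ i y s →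
    ∀ᵐ s : ℝ, s ∉ regularSet (lineSection ρ₁ i y) → lineSection ρ₁ i y s = 0

/-! ### Cylinder functions, gradient and the pre-Dirichlet form on `Γ_X` -/

section Dirichlet

variable (d : ℕ) {X : Type*} [TopologicalSpace X] [ChartedSpace (Euc d) X]

/-- A representation `g(⟨f_1, ·⟩, …, ⟨f_N, ·⟩)` of a finitely based smooth function, with
`g ∈ C_b^∞(ℝ^N)` (all derivatives are bounded) and `f_1, …, f_N ∈ C_0^∞(X)`. -/
structure CylinderRep (X : Type*) [TopologicalSpace X] [ChartedSpace (Euc d) X] where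
  /-- The number of test functions. -/
  N : ℕ
  /-- The outer function. -/
  g : (Fin N → ℝ) → ℝ
  /-- The test functions. -/
  f : Fin N → X → ℝ
  contDiff_g : ContDiff ℝ ∞ g
  bounded_g : ∀ k : ℕ, ∃ C : ℝ, ∀ v, ‖iteratedFDeriv ℝ k g v‖ ≤ C
  contMDiff_f : ∀ i, ContMDiff (𝓡 d) 𝓘(ℝ, ℝ) ∞ (f i)
  hasCompactSupport_f : ∀ i, HasCompactSupport (f i)

variable {d}

/-- The function `γ ↦ g(⟨f_1, γ⟩, …, ⟨f_N, γ⟩)`. -/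
def CylinderRep.toFun (c : CylinderRep d X) (γ : Config X) : ℝ :=
  c.g fun i => Config.pairing (c.f i) γ

variable (d)

/-- `F ∈ FC_b^∞(D, Γ_X)`. -/
def IsCylinder (F : Config X → ℝ) : Prop := ∃ c : CylinderRep d X, c.toFun = F

variable {d}
variable [RiemannianBundle (fun x : X => TangentSpace (𝓡 d) x)]

/-- `∑_i ∂_i g(⟨f_1, γ⟩, …, ⟨f_N, γ⟩) ∇^X f_i(x)`. -/
def CylinderRep.grad (c : CylinderRep d X) (γ : Config X) (x : X) : TangentSpace (𝓡 d) x :=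
  ∑ i, fderiv ℝ c.g (fun j => Config.pairing (c.f j) γ) (Pi.single i 1) • riemGrad d (c.f i) x

variable (d)

open Classical in
/-- The gradient `∇^Γ F (γ)` of `F ∈ FC_b^∞`, a vector field on `X`. At the points of `γ` it does
not depend on the representation of `F`, see `gradGamma_toFun`. -/
def gradGamma (F : Config X → ℝ) (γ : Config X) (x : X) : TangentSpace (𝓡 d) x :=
  if h : IsCylinder d F then h.choose.grad γ x else 0

/-- The inner product of `T_γ Γ_X = L²(X → TX; γ)`, i.e. `∑_{x ∈ γ} ⟨V(x), W(x)⟩_{TX}`. -/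
def tangentInner (γ : Config X) (V W : ∀ x : X, TangentSpace (𝓡 d) x) : ℝ :=
  ∑ᶠ x ∈ γ.carrier, inner ℝ (V x) (W x)

variable [MeasurableSpace X]

/-- The pre-Dirichlet form `E_μ^Γ(F, G) = ∫ ⟨∇^Γ F, ∇^Γ G⟩_{TΓ_X} dμ`. -/
def dirichletForm (μ : Measure (Config X)) (F G : Config X → ℝ) : ℝ :=
  ∫ γ, tangentInner d γ (gradGamma d F γ) (gradGamma d G γ) ∂μ

/-- The pre-Dirichlet form is well defined on (the `μ`-classes of) `FC_b^∞`: the integrals exist,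
and `∇^Γ F = ∇^Γ G` `μ`-a.e. whenever `F = G` `μ`-a.e. -/
def IsWellDefinedForm (μ : Measure (Config X)) : Prop :=
  (∀ F G : Config X → ℝ, IsCylinder d F → IsCylinder d G →
    Integrable (fun γ => tangentInner d γ (gradGamma d F γ) (gradGamma d G γ)) μ) ∧
  ∀ F G : Config X → ℝ, IsCylinder d F → IsCylinder d G → F =ᵐ[μ] G →
    ∀ᵐ γ ∂μ, ∀ x ∈ γ.carrier, gradGamma d F γ x = gradGamma d G γ x

/-- The pre-Dirichlet form is closable on `L²(Γ_X; μ)`. -/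
def IsClosableForm (μ : Measure (Config X)) : Prop :=
  ∀ F : ℕ → Config X → ℝ, (∀ n, IsCylinder d (F n)) →
    Tendsto (fun p : ℕ × ℕ => dirichletForm d μ (F p.1 - F p.2) (F p.1 - F p.2)) atTop (𝓝 0) →
    Tendsto (fun n => eLpNorm (F n) 2 μ) atTop (𝓝 0) →
    Tendsto (fun n => dirichletForm d μ (F n) (F n)) atTop (𝓝 0)

end Dirichlet

section GradientLemmas

variable {d : ℕ} {X : Type*} [TopologicalSpace X] [ChartedSpace (Euc d) X] [T2Space X]

theorem pairing_move [LocallyCompactSpace X] {f : X → ℝ} (hf : HasCompactSupport f) (γ : Config X) {x : X}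
    (hx : x ∈ γ.carrier) : ∀ᶠ y in 𝓝 x,
      Config.pairing f ((γ.restr {x}ᶜ).addPoint y) = Config.pairing f γ - f x + f y := by
  have hfin : ∀ s : Set X, s ⊆ γ.carrier → (s ∩ Function.support f).Finite := fun s hs =>
    (γ.locallyFinite _ hf).subset (inter_subset_inter hs (subset_tsupport f))
  obtain ⟨K, hK, hKx⟩ := exists_compact_mem_nhds x
  have hT : (γ.carrier ∩ K ∩ {x}ᶜ).Finite := (γ.locallyFinite K hK).subset inter_subset_left
  have hTx : (γ.carrier ∩ K ∩ {x}ᶜ)ᶜ ∈ 𝓝 x := hT.isClosed.isOpen_compl.mem_nhds (by simp)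
  filter_upwards [hKx, hTx] with y hyK hyT
  have hy : y ∉ γ.carrier ∩ {x}ᶜ := fun h => hyT ⟨⟨h.1, hyK⟩, h.2⟩
  have e1 : ((γ.restr {x}ᶜ).addPoint y).carrier = insert y (γ.carrier ∩ {x}ᶜ) := by
    simp only [Config.addPoint, Config.union, Config.restr, Config.ofFinite, union_singleton]
  have e2 : γ.carrier = insert x (γ.carrier ∩ {x}ᶜ) := by
    ext z
    by_cases hz : z = x
    · simp [hz, hx]
    · simp [hz]
  have h1 : Config.pairing f ((γ.restr {x}ᶜ).addPoint y) =
      f y + ∑ᶠ z ∈ γ.carrier ∩ {x}ᶜ, f z := by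
    rw [Config.pairing, e1]
    exact finsum_mem_insert' f hy (hfin _ inter_subset_left)
  have h2 : Config.pairing f γ = f x + ∑ᶠ z ∈ γ.carrier ∩ {x}ᶜ, f z := by
    rw [Config.pairing]
    conv_lhs => rw [e2]
    exact finsum_mem_insert' f (by simp) (hfin _ inter_subset_left)
  rw [h1, h2]
  ring

variable [RiemannianBundle (fun x : X => TangentSpace (𝓡 d) x)]

/-- At a point `x` of `γ`, the gradient `∇^Γ F(γ)` is the Riemannian gradient at `x` of the function
`y ↦ F((γ ∖ {x}) ∪ {y})` obtained by moving the point `x`. -/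
theorem CylinderRep.grad_eq_riemGrad (c : CylinderRep d X) (γ : Config X) {x : X}
    (hx : x ∈ γ.carrier) :
    c.grad γ x = riemGrad d (fun y => c.toFun ((γ.restr {x}ᶜ).addPoint y)) x := by
  have : LocallyCompactSpace X := ChartedSpace.locallyCompactSpace (Euc d) X
  set b : Fin c.N → ℝ := fun i => Config.pairing (c.f i) γ with hb
  have hev : (fun y => c.toFun ((γ.restr {x}ᶜ).addPoint y)) =ᶠ[𝓝 x]
      fun y => c.g fun i => b i - c.f i x + c.f i y := by
    have : ∀ᶠ y in 𝓝 x, ∀ i, Config.pairing (c.f i) ((γ.restr {x}ᶜ).addPoint y) =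
        b i - c.f i x + c.f i y :=
      eventually_all.2 fun i => pairing_move (c.hasCompactSupport_f i) γ hx
    filter_upwards [this] with y hy
    exact congrArg c.g (funext hy)
  have hfi : ∀ i, HasMFDerivAt (𝓡 d) 𝓘(ℝ, ℝ) (c.f i) x (mfderiv (𝓡 d) 𝓘(ℝ, ℝ) (c.f i) x) :=
    fun i => ((c.contMDiff_f i).contMDiffAt.mdifferentiableAt (by simp)).hasMFDerivAt
  have hpi : HasMFDerivAt (𝓡 d) 𝓘(ℝ, Fin c.N → ℝ) (fun y i => b i - c.f i x + c.f i y) x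
      (ContinuousLinearMap.pi fun i =>
        (mfderiv (𝓡 d) 𝓘(ℝ, ℝ) (c.f i) x : Euc d →L[ℝ] ℝ) : Euc d →L[ℝ] (Fin c.N → ℝ)) := by
    refine ⟨continuousAt_pi.2 fun i => continuousAt_const.add (hfi i).1, ?_⟩
    refine hasFDerivWithinAt_pi.2 fun i => ?_
    exact (hfi i).2.const_add (b i - c.f i x)
  have hg : HasFDerivAt c.g (fderiv ℝ c.g b) b :=
    (c.contDiff_g.differentiable (by simp)).differentiableAt.hasFDerivAt
  have hbx : (fun i => b i - c.f i x + c.f i x) = b := by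
    ext i; ring
  have hcomp : HasMFDerivAt (𝓡 d) 𝓘(ℝ, ℝ) (fun y => c.g fun i => b i - c.f i x + c.f i y) x
      ((fderiv ℝ c.g b).comp (ContinuousLinearMap.pi fun i =>
        (mfderiv (𝓡 d) 𝓘(ℝ, ℝ) (c.f i) x : Euc d →L[ℝ] ℝ)) : Euc d →L[ℝ] ℝ) := by
    refine HasMFDerivAt.comp (g := c.g) x ?_ hpi
    rw [hbx]
    exact hg.hasMFDerivAt
  refine ext_inner_right ℝ fun v => ?_
  rw [inner_riemGrad, hev.mfderiv_eq, hcomp.mfderiv, CylinderRep.grad, sum_inner]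
  simp only [inner_smul_left, inner_riemGrad]
  set w : Fin c.N → ℝ := fun i => mfderiv (𝓡 d) 𝓘(ℝ, ℝ) (c.f i) x v with hw
  have hw' : w = ∑ i, w i • (Pi.single i 1 : Fin c.N → ℝ) := by
    ext j; simp [Finset.sum_apply, Pi.single_apply]
  change _ = fderiv ℝ c.g b w
  conv_rhs => rw [hw', map_sum]
  refine Finset.sum_congr rfl fun i _ => ?_
  rw [map_smul, smul_eq_mul, mul_comm]
  rfl

theorem gradGamma_toFun (c : CylinderRep d X) (γ : Config X) {x : X} (hx : x ∈ γ.carrier) :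
    gradGamma d c.toFun γ x = c.grad γ x := by
  have h : IsCylinder d c.toFun := ⟨c, rfl⟩
  rw [gradGamma, dif_pos h, h.choose.grad_eq_riemGrad γ hx, c.grad_eq_riemGrad γ hx,
    h.choose_spec]

end GradientLemmas

end ConfigSpace

end

open ConfigSpace

/-!
Closability is transferred from the base space to the configuration space by disintegrating the
Gibbs measure `μ` with respect to one point of the configuration.

*Disintegration.* Mecke's identity for the Poisson measure (`IsPoissonMeasure.lintegral_mecke`) and
the Dobrushin-Lanford-Ruelle equations (`IsGrandCanonicalGibbs.lintegral_dlr`) give the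
Georgii-Nguyen-Zessin identity (`IsGrandCanonicalGibbs.lintegral_gnz`): the expectation under `μ` of
`∑_{x ∈ γ ∩ Λ} h (γ, x)` is that of `∫_Λ h (γ ∪ {x}, x) ρ_γ(x) m(dx)`. The reason is that adding a
point `x ∈ Λ` multiplies the Boltzmann factor of the window `Λ` by that of `{x}`
(`boltzmann_addPoint`). Measurability of all the quantities involved comes from a measurable
enumeration of the points of a configuration (`PointEnumeration`).

*One point.* For a cylinder function `F` and `x ∉ γ`, both `F (γ ∪ {x})` and its gradient at `x` are
the value and the Riemannian gradient at `x` of a smooth function on `X` (`CylinderRep.shift`).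
Hence, if cylinder functions tend to zero in `L²(μ)` and their gradients are Cauchy, both
geometrically fast, then for almost every `γ` the same is true of smooth functions on `X`, locally
in `L²(ρ_γ m)`. If the gradient on `X` is closable with respect to `ρ_γ m` (`GradClosable`), the
gradients therefore tend to zero `ρ_γ m`-almost everywhere, and by the identity once more they do so
at all points of almost every configuration (`IsGrandCanonicalGibbs.ae_tendsto_norm_grad`).
Fatou's lemma turns this into closability of the form, and the constant sequence `F - G` shows that
the form is well defined on classes.

*The base space.* Where `1 / ρ₁` is integrable, convergence in `L²(ρ₁ m)` implies convergence in
`L¹`, so that the limit of the derivatives is a weak derivative of zero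
(`ae_tendsto_fderiv_zero`). In charts, respectively along coordinate lines, this yields
`gradClosable_of_localInvIntegrable` and `gradClosable_of_lineInvIntegrable`.
-/

namespace ConfigSpace

/-! ### Directional derivatives and local integrability of the inverse density -/

theorem le_sq_mul_add_inv (a s : ℝ≥0∞) : a ≤ a ^ 2 * s + s⁻¹ := by
  rcases le_or_gt 1 (a * s) with h | h
  · calc a = a * 1 := (mul_one a).symm
      _ ≤ a * (a * s) := by gcongr
      _ = a ^ 2 * s := by ring
      _ ≤ _ := le_self_add
  · refine le_add_left ?_
    rw [ENNReal.le_inv_iff_mul_le]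
    exact h.le

/-- Weighted `L²`-norms that decrease geometrically give summable `L¹`-norms, as soon as the inverse
of the weight is integrable. -/
theorem tsum_lintegral_enorm_ne_top {α : Type*} [MeasurableSpace α] {ν : Measure α}
    {r : α → ℝ≥0∞} (hr : Measurable r) (hrν : ∫⁻ y, (r y)⁻¹ ∂ν ≠ ⊤) {f : ℕ → α → ℝ≥0∞}
    (hf : ∑' k : ℕ, 2 ^ k * ∫⁻ y, f k y ^ 2 * r y ∂ν ≠ ⊤) :
    ∑' k : ℕ, ∫⁻ y, f k y ∂ν ≠ ⊤ := by
  -- `le_sq_mul_add_inv` with `s = 2 ^ k * r y` balances the two error terms.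
  have h1 : ∀ k : ℕ, ∫⁻ y, f k y ∂ν ≤
      2 ^ k * ∫⁻ y, f k y ^ 2 * r y ∂ν + 2⁻¹ ^ k * ∫⁻ y, (r y)⁻¹ ∂ν := by
    intro k
    calc ∫⁻ y, f k y ∂ν
        ≤ ∫⁻ y, 2 ^ k * (f k y ^ 2 * r y) + 2⁻¹ ^ k * (r y)⁻¹ ∂ν := by
          refine lintegral_mono fun y => (le_sq_mul_add_inv (f k y) (2 ^ k * r y)).trans_eq ?_
          rw [ENNReal.mul_inv (by simp) (by simp), ENNReal.inv_pow]
          ring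
      _ = _ := by
          rw [lintegral_add_right (fun y => 2 ^ k * (f k y ^ 2 * r y))
            (g := fun y => 2⁻¹ ^ k * (r y)⁻¹) (hr.inv.const_mul _),
            lintegral_const_mul' _ _ (by simp), lintegral_const_mul' _ _ (by simp)]
  refine ne_top_of_le_ne_top ?_ (ENNReal.tsum_le_tsum h1)
  rw [ENNReal.tsum_add, ENNReal.tsum_mul_right, ENNReal.tsum_geometric]
  refine ENNReal.add_ne_top.2 ⟨hf, ENNReal.mul_ne_top ?_ hrν⟩
  rw [ENNReal.one_sub_inv_two]
  simp

/-- The core of closability: if `1 / r` is integrable on the open set `U`, and functions `u k` tend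
to zero geometrically fast in `L²(U; r)` while their derivatives in direction `w` are Cauchy
geometrically fast, then these derivatives tend to zero almost everywhere on `U`. All convergence
takes place in `L¹(U)` as well, so the limit of the derivatives is the weak derivative of `0`. -/
theorem ae_tendsto_fderiv_zero {E : Type*} [NormedAddCommGroup E] [NormedSpace ℝ E]
    [FiniteDimensional ℝ E] [MeasurableSpace E] [BorelSpace E] {ν : Measure E}
    [ν.IsAddHaarMeasure] {U : Set E} (hU : IsOpen U) {r : E → ℝ≥0∞} (hr : Measurable r)
    (hrU : ∫⁻ y in U, (r y)⁻¹ ∂ν ≠ ⊤) {u : ℕ → E → ℝ} (hu : ∀ k, ContDiffOn ℝ 1 (u k) U) (w : E)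
    (h0 : ∑' k : ℕ, 2 ^ k * ∫⁻ y in U, ‖u k y‖ₑ ^ 2 * r y ∂ν ≠ ⊤)
    (h1 : ∑' k : ℕ, 2 ^ k *
      ∫⁻ y in U, ‖fderiv ℝ (u (k + 1)) y w - fderiv ℝ (u k) y w‖ₑ ^ 2 * r y ∂ν ≠ ⊤) :
    ∀ᵐ y ∂ν, y ∈ U → Tendsto (fun k => fderiv ℝ (u k) y w) atTop (𝓝 0) := by
  have hd : ∀ k, ContinuousOn (fun y => fderiv ℝ (u k) y w) U := fun k =>
    ((hu k).continuousOn_fderiv_of_isOpen hU le_rfl).clm_apply continuousOn_const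
  have hdm : ∀ k, AEStronglyMeasurable (fun y => fderiv ℝ (u k) y w) (ν.restrict U) := fun k =>
    (hd k).aestronglyMeasurable hU.measurableSet
  have hum : ∀ k, AEStronglyMeasurable (u k) (ν.restrict U) := fun k =>
    (hu k).continuousOn.aestronglyMeasurable hU.measurableSet
  set g : ℕ → E → ℝ := fun k y => fderiv ℝ (u (k + 1)) y w - fderiv ℝ (u k) y w with hg
  have hgm : ∀ k, AEStronglyMeasurable (g k) (ν.restrict U) := fun k => (hdm _).sub (hdm _)
  have s0 := tsum_lintegral_enorm_ne_top hr hrU (f := fun k y => ‖u k y‖ₑ) h0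
  have s1 := tsum_lintegral_enorm_ne_top hr hrU (f := fun k y => ‖g k y‖ₑ) h1
  have s1' : ∫⁻ y in U, ∑' k, ‖g k y‖ₑ ∂ν ≠ ⊤ := by
    rwa [lintegral_tsum fun k => (hgm k).enorm]
  have hsum : ∀ᵐ y ∂ν.restrict U, Summable fun k => ‖g k y‖ := by
    filter_upwards [ae_lt_top' (AEMeasurable.tsum fun k => (hgm k).enorm) s1'] with y hy
    have : ∑' k, ((‖g k y‖₊ : ℝ≥0) : ℝ≥0∞) ≠ ⊤ := hy.ne
    exact (NNReal.summable_coe.2 (ENNReal.tsum_coe_ne_top_iff_summable.1 this))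
  -- The candidate `v` for the limit of the derivatives is the sum of the telescoping series.
  set v : E → ℝ := fun y => fderiv ℝ (u 0) y w + ∑' k, g k y with hv
  have hpart : ∀ y n, fderiv ℝ (u n) y w = fderiv ℝ (u 0) y w + ∑ k ∈ Finset.range n, g k y := by
    intro y n
    simp only [hg]
    rw [Finset.sum_range_sub (fun k => fderiv ℝ (u k) y w)]
    ring
  have hlim : ∀ᵐ y ∂ν.restrict U, Tendsto (fun k => fderiv ℝ (u k) y w) atTop (𝓝 (v y)) := by
    filter_upwards [hsum] with y hy
    refine Tendsto.congr (fun n => (hpart y n).symm) ?_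
    exact (Summable.of_norm hy).hasSum.tendsto_sum_nat.const_add _
  have hBint : Integrable (fun y => ∑' k, ‖g k y‖) (ν.restrict U) := by
    refine ⟨AEStronglyMeasurable.tsum fun k => (hgm k).norm, ?_⟩
    refine lt_of_le_of_lt (lintegral_mono_ae ?_) s1'.lt_top
    filter_upwards [hsum] with y hy
    rw [Real.enorm_eq_ofReal (tsum_nonneg fun k => norm_nonneg _),
      ENNReal.ofReal_tsum_of_nonneg (fun k => norm_nonneg _) hy]
    exact (tsum_congr fun k => ofReal_norm (g k y)).le
  have hgint : Integrable (fun y => ∑' k, g k y) (ν.restrict U) := by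
    refine hBint.mono (AEStronglyMeasurable.tsum hgm) ?_
    filter_upwards [hsum] with y hy
    rw [Real.norm_of_nonneg (tsum_nonneg fun k => norm_nonneg (g k y))]
    exact norm_tsum_le_tsum_norm hy
  have hvloc : LocallyIntegrableOn v U ν := by
    refine LocallyIntegrableOn.add ((hd 0).locallyIntegrableOn hU.measurableSet) ?_
    exact IntegrableOn.locallyIntegrableOn hgint
  -- Integration by parts against a test function `φ`: the integrals of `φ * fderiv (u k)` tend to
  -- that of `φ * v`, those of `fderiv φ * u k` to zero.
  have hv0 : ∀ᵐ y ∂ν, y ∈ U → v y = 0 := by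
    refine hU.ae_eq_zero_of_integral_contDiff_smul_eq_zero hvloc fun φ hφ hφc hφU => ?_
    obtain ⟨C, hC⟩ := hφc.exists_bound_of_continuous hφ.continuous
    have hφ0 : ∀ y, y ∉ U → φ y = 0 := fun y hy =>
      image_eq_zero_of_notMem_tsupport fun h => hy (hφU h)
    have hφ'0 : ∀ y, y ∉ U → fderiv ℝ φ y = 0 := fun y hy =>
      image_eq_zero_of_notMem_tsupport fun h => hy (hφU (tsupport_fderiv_subset ℝ h))
    have hφ'c : Continuous fun y => fderiv ℝ φ y w :=
      (hφ.continuous_fderiv (by simp)).clm_apply continuous_const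
    have hcont : ∀ {f : E → ℝ}, ContinuousOn f U → ∀ {ψ : E → ℝ}, Continuous ψ →
        tsupport ψ ⊆ tsupport φ → Integrable (fun y => ψ y * f y) ν := by
      intro f hf ψ hψ hψs
      have hψcs : HasCompactSupport ψ := hφc.mono' (subset_closure.trans hψs)
      refine Continuous.integrable_of_hasCompactSupport ?_ hψcs.mul_right
      refine continuous_iff_continuousAt.2 fun y => ?_
      by_cases hy : y ∈ tsupport ψ
      · exact hψ.continuousAt.mul (hf.continuousAt (hU.mem_nhds (hφU (hψs hy))))
      · have : (fun y => ψ y * f y) =ᶠ[𝓝 y] fun _ => 0 := by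
          filter_upwards [(isClosed_tsupport ψ).isOpen_compl.mem_nhds hy] with z hz
          rw [image_eq_zero_of_notMem_tsupport hz, zero_mul]
        exact (continuousAt_congr this).2 continuousAt_const
    have htsφ' : tsupport (fun y => fderiv ℝ φ y w) ⊆ tsupport φ :=
      tsupport_fderiv_apply_subset ℝ w
    have hibp : ∀ k, ∫ y, φ y * fderiv ℝ (u k) y w ∂ν = - ∫ y, fderiv ℝ φ y w * u k y ∂ν := by
      intro k
      refine integral_mul_fderiv_eq_neg_fderiv_mul_of_integrable ?_ ?_ ?_ ?_ ?_
      · exact hcont (hu k).continuousOn hφ'c htsφ'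
      · exact hcont (hd k) hφ.continuous le_rfl
      · exact hcont (hu k).continuousOn hφ.continuous le_rfl
      · exact fun y _ => hφ.differentiable (by simp) y
      · exact fun y hy => ((hu k).differentiableOn (by simp)).differentiableAt
          (hU.mem_nhds (hφU hy))
    have hset : ∀ {f : E → ℝ}, (∀ y, y ∉ U → f y = 0) → ∫ y, f y ∂ν = ∫ y in U, f y ∂ν :=
      fun hf => (setIntegral_eq_integral_of_forall_compl_eq_zero hf).symm
    have lim1 : Tendsto (fun k => ∫ y, φ y * fderiv ℝ (u k) y w ∂ν) atTop
        (𝓝 (∫ y, φ y • v y ∂ν)) := by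
      rw [hset (f := fun y => φ y • v y) fun y hy => by simp [hφ0 y hy]]
      simp_rw [fun k => hset (f := fun y => φ y * fderiv ℝ (u k) y w) fun y hy => by
        simp [hφ0 y hy]]
      refine tendsto_integral_of_dominated_convergence
        (fun y => ‖φ y * fderiv ℝ (u 0) y w‖ + C * ∑' k, ‖g k y‖) ?_ ?_ ?_ ?_
      · exact fun k => hφ.continuous.aestronglyMeasurable.mul (hdm k)
      · exact ((hcont (hd 0) hφ.continuous le_rfl).norm.integrableOn).add (hBint.const_mul C)
      · intro n
        filter_upwards [hsum] with y hy
        rw [hpart y n, mul_add]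
        refine (norm_add_le _ _).trans ?_
        gcongr
        rw [norm_mul]
        have hC0 : 0 ≤ C := (norm_nonneg _).trans (hC y)
        gcongr
        · exact hC y
        · exact (norm_sum_le _ _).trans (hy.sum_le_tsum _ fun k _ => norm_nonneg _)
      · filter_upwards [hlim] with y hy
        exact hy.const_mul _
    have lim2 : Tendsto (fun k => ∫ y, fderiv ℝ φ y w * u k y ∂ν) atTop (𝓝 0) := by
      obtain ⟨C', hC'⟩ := (hφc.mono' (subset_closure.trans htsφ')).exists_bound_of_continuous hφ'c
      have hz : Tendsto (fun k => ENNReal.ofReal C' * ∫⁻ y in U, ‖u k y‖ₑ ∂ν) atTop (𝓝 0) := by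
        have := ENNReal.Tendsto.const_mul (a := ENNReal.ofReal C')
          (ENNReal.tendsto_atTop_zero_of_tsum_ne_top s0) (Or.inr ENNReal.ofReal_ne_top)
        simpa using this
      refine tendsto_zero_iff_enorm_tendsto_zero.2 (tendsto_of_tendsto_of_tendsto_of_le_of_le
        tendsto_const_nhds hz (fun _ => zero_le) fun k => ?_)
      rw [hset (f := fun y => fderiv ℝ φ y w * u k y) fun y hy => by simp [hφ'0 y hy]]
      refine (enorm_integral_le_lintegral_enorm _).trans ?_
      rw [← lintegral_const_mul' _ _ ENNReal.ofReal_ne_top]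
      refine lintegral_mono fun y => ?_
      rw [enorm_mul]
      gcongr
      rw [← ofReal_norm]
      exact ENNReal.ofReal_le_ofReal (hC' y)
    simp_rw [hibp] at lim1
    simpa using tendsto_nhds_unique lim1 lim2.neg
  have := (ae_restrict_iff' hU.measurableSet).1 hlim
  filter_upwards [this, hv0] with y hy hy0 hyU
  rw [← hy0 hyU]
  exact hy hyU

/-! ### Closability of the gradient with respect to a density -/

/-- Pointwise closability of the gradient on `L²(X; ρ₁ m)`: if smooth functions `u k` tend to zero
and their gradients are Cauchy, both geometrically fast in `L²(K; ρ₁ m)` for every compact `K`,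
then the gradients tend to zero almost everywhere with respect to `ρ₁ m`. -/
def GradClosable (d : ℕ) {X : Type*} [TopologicalSpace X] [ChartedSpace (Euc d) X]
    [RiemannianBundle (fun x : X => TangentSpace (𝓡 d) x)] [MeasurableSpace X]
    (ρ₁ : X → ℝ≥0∞) : Prop :=
  ∀ u : ℕ → X → ℝ, (∀ k, ContMDiff (𝓡 d) 𝓘(ℝ, ℝ) ∞ (u k)) →
    (∀ K : Set X, IsCompact K →
      ∑' k : ℕ, 2 ^ k * ∫⁻ x in K, ‖u k x‖ₑ ^ 2 * ρ₁ x ∂(riemannianVolume d X) ≠ ⊤) →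
    (∀ K : Set X, IsCompact K →
      ∑' k : ℕ, 2 ^ k * ∫⁻ x in K, ‖riemGrad d (u (k + 1)) x - riemGrad d (u k) x‖ₑ ^ 2 * ρ₁ x
        ∂(riemannianVolume d X) ≠ ⊤) →
    ∀ᵐ x ∂(riemannianVolume d X), ρ₁ x ≠ 0 →
      Tendsto (fun k => ‖riemGrad d (u k) x‖) atTop (𝓝 0)

/-- In finite dimension, vectors whose inner products with a spanning family tend to zero tend to
zero. -/
theorem tendsto_norm_zero_of_inner {V : Type*} [NormedAddCommGroup V] [InnerProductSpace ℝ V]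
    [FiniteDimensional ℝ V] {ι : Type*} [Fintype ι] {b : ι → V}
    (hb : Submodule.span ℝ (range b) = ⊤) {g : ℕ → V}
    (h : ∀ i, Tendsto (fun k => inner ℝ (g k) (b i)) atTop (𝓝 0)) :
    Tendsto (fun k => ‖g k‖) atTop (𝓝 0) := by
  let φ : V →ₗ[ℝ] (ι → ℝ) := LinearMap.pi fun i => (innerₗ V).flip (b i)
  have hφ : ∀ v i, φ v i = inner ℝ v (b i) := fun v i => rfl
  have hker : φ.ker = ⊥ := by
    refine LinearMap.ker_eq_bot'.2 fun v hv => ?_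
    have : ∀ w ∈ Submodule.span ℝ (range b), inner ℝ v w = 0 := by
      intro w hw
      induction hw using Submodule.span_induction with
      | mem x hx =>
        obtain ⟨i, rfl⟩ := hx
        rw [← hφ, hv]; rfl
      | zero => simp
      | add x y _ _ hx hy => rw [inner_add_right, hx, hy, add_zero]
      | smul a x _ hx => rw [inner_smul_right, hx, mul_zero]
    exact inner_self_eq_zero.1 (this v (hb ▸ Submodule.mem_top))
  obtain ⟨K, -, hK⟩ := φ.exists_antilipschitzWith hker
  have h1 : Tendsto (fun k => φ (g k)) atTop (𝓝 0) := tendsto_pi_nhds.2 h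
  have h2 : Tendsto (fun k => (K : ℝ) * ‖φ (g k)‖) atTop (𝓝 0) := by
    simpa using h1.norm.const_mul (K : ℝ)
  refine squeeze_zero (fun _ => norm_nonneg _) (fun k => ?_) h2
  simpa using hK.le_mul_dist (g k) 0

theorem enorm_inner_riemGrad_sub_le {d : ℕ} {X : Type*} [TopologicalSpace X]
    [ChartedSpace (Euc d) X] [RiemannianBundle (fun x : X => TangentSpace (𝓡 d) x)]
    (f g : X → ℝ) (x : X) (v : TangentSpace (𝓡 d) x) :
    ‖inner ℝ (riemGrad d f x) v - inner ℝ (riemGrad d g x) v‖ₑ ≤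
      ‖riemGrad d f x - riemGrad d g x‖ₑ * ‖v‖ₑ := by
  rw [← inner_sub_left, ← ofReal_norm, ← ofReal_norm, ← ofReal_norm,
    ← ENNReal.ofReal_mul (norm_nonneg _)]
  exact ENNReal.ofReal_le_ofReal (norm_inner_le_norm _ _)

/-! ### The Euclidean case: Fubini along coordinate lines -/

section Euclidean

variable {n : ℕ}

theorem riemannianVolume_euc (d : ℕ) : riemannianVolume d (Euc d) = volume := by
  have h : ∀ x : Euc d, chartVolume d (chartAt (Euc d) x) = volume := by
    intro x
    have hg : ∀ y, chartGram d (OpenPartialHomeomorph.refl (Euc d)) y = 1 := by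
      intro y
      ext i j
      rw [chartGram, Matrix.gram_apply]
      have : mfderiv (𝓡 d) (𝓡 d) (OpenPartialHomeomorph.refl (Euc d)).symm y =
          ContinuousLinearMap.id ℝ (TangentSpace (𝓡 d) y) := mfderiv_id
      simp only [this]
      change inner ℝ (EuclideanSpace.single i (1 : ℝ)) (EuclideanSpace.single j (1 : ℝ)) = _
      rw [Matrix.one_apply, EuclideanSpace.inner_single_left]
      simp
    rw [chartAt_self_eq, chartVolume]
    simp only [hg]
    simp
  rw [riemannianVolume]
  simp [h]

/-- Points of `ℝ^{n+1}`, parametrized by the lines parallel to the `i`-th coordinate axis. -/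
def linePoint (i : Fin (n + 1)) (p : (Fin n → ℝ) × ℝ) : Euc (n + 1) :=
  WithLp.toLp 2 (i.insertNth (α := fun _ => ℝ) p.2 p.1)

theorem linePoint_eq_add (i : Fin (n + 1)) (y : Fin n → ℝ) (s : ℝ) :
    linePoint i (y, s) = linePoint i (y, 0) + s • EuclideanSpace.single i (1 : ℝ) := by
  ext j
  refine Fin.succAboveCases i ?_ (fun j => ?_) j
  · simp [linePoint]
  · simp [linePoint]

/-- The parametrization by coordinate lines, as a measurable equivalence. -/
def linePointEquiv (i : Fin (n + 1)) : (Fin n → ℝ) × ℝ ≃ᵐ Euc (n + 1) :=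
  (MeasurableEquiv.prodComm.trans (MeasurableEquiv.piFinSuccAbove (fun _ => ℝ) i).symm).trans
    (MeasurableEquiv.toLp 2 (Fin (n + 1) → ℝ))

theorem coe_linePointEquiv (i : Fin (n + 1)) : ⇑(linePointEquiv i) = linePoint i := rfl

theorem inner_riemGrad_euc {d : ℕ} (f : Euc d → ℝ) (x v : Euc d) :
    inner ℝ (riemGrad d f x) (v : TangentSpace (𝓡 d) x) = fderiv ℝ f x v := by
  refine (inner_riemGrad d f x v).trans ?_
  rw [mfderiv_eq_fderiv]
  rfl

theorem measurePreserving_linePoint (i : Fin (n + 1)) :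
    MeasurePreserving (linePoint i) (volume.prod volume) volume := by
  rw [← coe_linePointEquiv]
  refine (PiLp.volume_preserving_toLp (Fin (n + 1))).comp
    (MeasurePreserving.comp (μb := volume.prod volume)
      (g := (MeasurableEquiv.piFinSuccAbove (fun _ => ℝ) i).symm) ?_ Measure.measurePreserving_swap)
  exact (volume_preserving_piFinSuccAbove (fun _ => ℝ) i).symm

theorem measurable_linePoint (i : Fin (n + 1)) : Measurable (linePoint i) :=
  (measurePreserving_linePoint i).measurable

/-- Fubini for weighted sums of integrals over compact sets: they are finite along almost every
line parallel to the `i`-th axis. -/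
theorem ae_linePoint_sections {i : Fin (n + 1)} {G : ℕ → Euc (n + 1) → ℝ≥0∞}
    (hG : ∀ k, Measurable (G k))
    (h : ∀ K : Set (Euc (n + 1)), IsCompact K → ∑' k : ℕ, 2 ^ k * ∫⁻ x in K, G k x ≠ ⊤) :
    ∀ᵐ y : Fin n → ℝ, ∀ N : ℕ, ∑' k : ℕ, 2 ^ k *
      ∫⁻ s in {s | linePoint i (y, s) ∈ Metric.closedBall 0 N}, G k (linePoint i (y, s)) ≠ ⊤ := by
  refine ae_all_iff.2 fun N => ?_
  set K : Set (Euc (n + 1)) := Metric.closedBall 0 N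
  have hK : MeasurableSet K := Metric.isClosed_closedBall.measurableSet
  set G' : ℕ → (Fin n → ℝ) × ℝ → ℝ≥0∞ := fun k p => K.indicator (G k) (linePoint i p) with hG'
  have hG'm : ∀ k, Measurable (G' k) := fun k =>
    ((hG k).indicator hK).comp (measurable_linePoint i)
  have e1 : ∀ k, ∫⁻ x in K, G k x = ∫⁻ y, ∫⁻ s, G' k (y, s) := by
    intro k
    rw [← lintegral_indicator hK,
      ← (measurePreserving_linePoint i).lintegral_comp ((hG k).indicator hK),
      lintegral_prod _ (hG'm k).aemeasurable]
  have e2 : ∑' k : ℕ, 2 ^ k * ∫⁻ x in K, G k x =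
      ∫⁻ y, ∑' k : ℕ, 2 ^ k * ∫⁻ s, G' k (y, s) := by
    rw [lintegral_tsum fun k => ((hG'm k).lintegral_prod_right'.const_mul _).aemeasurable]
    refine tsum_congr fun k => ?_
    rw [lintegral_const_mul _ (hG'm k).lintegral_prod_right', e1]
  have h3 := h K (isCompact_closedBall 0 _)
  rw [e2] at h3
  have h4 : Measurable fun y => ∑' k : ℕ, 2 ^ k * ∫⁻ s, G' k (y, s) :=
    Measurable.tsum fun k => (hG'm k).lintegral_prod_right'.const_mul _
  filter_upwards [ae_lt_top h4 h3] with y hy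
  convert hy.ne using 4 with k
  have hm : MeasurableSet {s | linePoint i (y, s) ∈ K} :=
    ((measurable_linePoint i).comp measurable_prodMk_left) hK
  rw [← lintegral_indicator hm]
  rfl

/-- On `ℝ^{n+1}`, local integrability of `1 / ρ₁` along almost every coordinate line implies that
the gradient is closable. -/
theorem gradClosable_of_lineInvIntegrable {ρ₁ : Euc (n + 1) → ℝ≥0∞} (hρ : Measurable ρ₁)
    (hline : LineInvIntegrable ρ₁) : GradClosable (n + 1) ρ₁ := by
  intro u hu h0 h1
  rw [riemannianVolume_euc] at *
  have huc : ∀ k, ContDiff ℝ ∞ (u k) := fun k => (hu k).contDiff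
  have hud : ∀ k i, Continuous fun x => fderiv ℝ (u k) x (EuclideanSpace.single i (1 : ℝ)) :=
    fun k i => ((huc k).continuous_fderiv (by simp)).clm_apply continuous_const
  suffices H : ∀ i : Fin (n + 1), ∀ᵐ x : Euc (n + 1), ρ₁ x ≠ 0 → Tendsto
      (fun k => fderiv ℝ (u k) x (EuclideanSpace.single i (1 : ℝ))) atTop (𝓝 0) by
    filter_upwards [ae_all_iff.2 H] with x hx hx0
    refine tendsto_norm_zero_of_inner (V := TangentSpace (𝓡 (n + 1)) x)
      (b := fun i : Fin (n + 1) => (EuclideanSpace.single i (1 : ℝ) : Euc (n + 1))) ?_ fun i => ?_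
    · have := (EuclideanSpace.basisFun (Fin (n + 1)) ℝ).toBasis.span_eq
      have h2 : ⇑(EuclideanSpace.basisFun (Fin (n + 1)) ℝ).toBasis =
          fun i => EuclideanSpace.single i (1 : ℝ) := by ext; simp
      rwa [h2] at this
    · exact (hx i hx0).congr fun k => (inner_riemGrad_euc (u k) x _).symm
  intro i
  set e : Euc (n + 1) := EuclideanSpace.single i (1 : ℝ)
  have hmeas : MeasurableSet {x : Euc (n + 1) | ρ₁ x ≠ 0 →
      Tendsto (fun k => fderiv ℝ (u k) x e) atTop (𝓝 0)} := by
    have a1 : MeasurableSet {x : Euc (n + 1) | ρ₁ x ≠ 0} :=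
      (hρ (measurableSet_singleton 0)).compl
    have a2 : MeasurableSet {x : Euc (n + 1) |
        Tendsto (fun k => fderiv ℝ (u k) x e) atTop (𝓝 0)} :=
      measurableSet_tendsto _ fun k => (hud k i).measurable
    exact a1.imp a2
  rw [← (measurePreserving_linePoint i).map_eq,
    ae_map_iff (measurable_linePoint i).aemeasurable hmeas,
    Measure.ae_prod_iff_ae_ae (p := fun p => ρ₁ (linePoint i p) ≠ 0 → Tendsto
      (fun k => fderiv ℝ (u k) (linePoint i p) e) atTop (𝓝 0)) (measurable_linePoint i hmeas)]
  have hl0 := ae_linePoint_sections (i := i)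
    (G := fun k x => ‖u k x‖ₑ ^ 2 * ρ₁ x)
    (fun k => ((huc k).continuous.measurable.enorm.pow_const 2).mul hρ) h0
  have hl1 := ae_linePoint_sections (i := i)
    (G := fun k x => ‖fderiv ℝ (u (k + 1)) x e - fderiv ℝ (u k) x e‖ₑ ^ 2 * ρ₁ x)
    (fun k => (((hud _ i).sub (hud _ i)).measurable.enorm.pow_const 2).mul hρ) (by
      intro K hK
      refine ne_top_of_le_ne_top (h1 K hK) (ENNReal.tsum_le_tsum fun k => ?_)
      gcongr with x
      have := enorm_inner_riemGrad_sub_le (d := n + 1) (u (k + 1)) (u k) x e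
      rw [inner_riemGrad_euc, inner_riemGrad_euc] at this
      refine this.trans_eq ?_
      rw [enorm_tangentSpace_vectorSpace (v := e)]
      simp [e, ← ofReal_norm])
  filter_upwards [hline i, hl0, hl1] with y hy hy0 hy1
  set r : ℝ → ℝ≥0∞ := lineSection ρ₁ i y with hr
  have hrm : Measurable r := (hρ.comp (measurable_linePoint i)).comp measurable_prodMk_left
  change ∀ᵐ s : ℝ, r s ≠ 0 → Tendsto (fun k => fderiv ℝ (u k) (linePoint i (y, s)) e) atTop (𝓝 0)
  -- On lines where the density vanishes almost everywhere there is nothing to show.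
  rcases eq_or_ne (∫⁻ s, r s) 0 with hz | hz
  · filter_upwards [(lintegral_eq_zero_iff hrm).1 hz] with s hs hs'
    exact absurd hs hs'
  -- The regular set is covered by open intervals, to each of which the one-dimensional case of
  -- `ae_tendsto_fderiv_zero` applies.
  have hreg : ∀ᵐ s : ℝ, s ∈ regularSet r →
      Tendsto (fun k => fderiv ℝ (u k) (linePoint i (y, s)) e) atTop (𝓝 0) := by
    rw [ae_iff]
    refine measure_null_of_locally_null _ fun t ht => ?_
    obtain ⟨ε, hε, hint⟩ : t ∈ regularSet r := by
      by_contra h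
      exact ht fun h' => absurd h' h
    have hpt : ∀ s, HasDerivAt (fun s => linePoint i (y, s)) e s := by
      intro s
      rw [funext (linePoint_eq_add i y)]
      simpa using ((hasDerivAt_id s).smul_const e).const_add (linePoint i (y, 0))
    have hcont : ContDiff ℝ ∞ (fun s => linePoint i (y, s)) := by
      rw [funext (linePoint_eq_add i y)]
      exact contDiff_const.add (contDiff_id.smul contDiff_const)
    have hder : ∀ k s, fderiv ℝ (fun s => u k (linePoint i (y, s))) s 1 =
        fderiv ℝ (u k) (linePoint i (y, s)) e := by
      intro k s
      have := ((huc k).differentiable (by simp) (linePoint i (y, s))).hasFDerivAt.comp_hasDerivAt s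
        (hpt s)
      rw [fderiv_apply_one_eq_deriv]
      exact this.deriv
    obtain ⟨N, hN⟩ : ∃ N : ℕ, Ioo (t - ε) (t + ε) ⊆
        {s | linePoint i (y, s) ∈ Metric.closedBall 0 N} := by
      obtain ⟨C, hC⟩ := (isCompact_Icc (a := t - ε) (b := t + ε)).exists_bound_of_continuousOn
        hcont.continuous.continuousOn
      obtain ⟨N, hN⟩ := exists_nat_ge C
      exact ⟨N, fun s hs => by
        simpa using (hC s (Ioo_subset_Icc_self hs)).trans hN⟩
    have := ae_tendsto_fderiv_zero (ν := (volume : Measure ℝ)) (U := Ioo (t - ε) (t + ε)) isOpen_Ioo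
      hrm hint.ne (u := fun k s => u k (linePoint i (y, s)))
      (fun k => (((huc k).comp hcont).of_le (by simp)).contDiffOn) 1
      (ne_top_of_le_ne_top (hy0 N) (ENNReal.tsum_le_tsum fun k => by
        exact mul_le_mul_right (lintegral_mono_set hN) _))
      (ne_top_of_le_ne_top (hy1 N) (ENNReal.tsum_le_tsum fun k => by
        simp_rw [hder]
        exact mul_le_mul_right (lintegral_mono_set hN) _))
    simp_rw [hder] at this
    refine ⟨{s | s ∈ regularSet r →
      Tendsto (fun k => fderiv ℝ (u k) (linePoint i (y, s)) e) atTop (𝓝 0)}ᶜ ∩ Ioo (t - ε) (t + ε),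
      inter_mem_nhdsWithin _ (Ioo_mem_nhds (by linarith) (by linarith)), ?_⟩
    refine measure_mono_null ?_ (ae_iff.1 this)
    rintro s ⟨hs, hsI⟩ hs'
    exact hs fun _ => hs' hsI
  filter_upwards [hy (pos_iff_ne_zero.2 hz), hreg] with s hs hs' hs0
  by_cases h : s ∈ regularSet r
  · exact hs' h
  · exact absurd (hs h) hs0

end Euclidean

/-! ### The Riemannian metric and the gradient in a chart -/

section Chart

variable {d : ℕ} {X : Type*} [TopologicalSpace X] [ChartedSpace (Euc d) X]
  [IsManifold (𝓡 d) ∞ X] {e : OpenPartialHomeomorph X (Euc d)}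

/-- The `i`-th coordinate vector field of the chart `e`, at the point with coordinates `y`. -/
noncomputable def chartFrame (e : OpenPartialHomeomorph X (Euc d)) (i : Fin d) (y : Euc d) :
    TangentSpace (𝓡 d) (e.symm y) :=
  mfderiv (𝓡 d) (𝓡 d) e.symm y (EuclideanSpace.single i (1 : ℝ))

theorem contMDiffOn_chart_symm (he : e ∈ atlas (Euc d) X) :
    ContMDiffOn (𝓡 d) (𝓡 d) ∞ e.symm e.target :=
  contMDiffOn_symm_of_mem_maximalAtlas (IsManifold.subset_maximalAtlas (I := 𝓡 d) (n := ∞) he)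

theorem mdifferentiable_chart_of_mem_atlas (he : e ∈ atlas (Euc d) X) :
    e.MDifferentiable (𝓡 d) (𝓡 d) :=
  have : IsManifold (𝓡 d) 1 X := IsManifold.of_le (n := ∞) (by simp)
  mdifferentiable_of_mem_atlas he

theorem span_chartFrame (he : e ∈ atlas (Euc d) X) {y : Euc d} (hy : y ∈ e.target) :
    Submodule.span ℝ (range fun i => chartFrame e i y) = ⊤ := by
  have h1 : Submodule.span ℝ (range fun i : Fin d => EuclideanSpace.single i (1 : ℝ)) = ⊤ := by
    have := (EuclideanSpace.basisFun (Fin d) ℝ).toBasis.span_eq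
    have h2 : ⇑(EuclideanSpace.basisFun (Fin d) ℝ).toBasis =
        fun i => EuclideanSpace.single i (1 : ℝ) := by ext; simp
    rwa [h2] at this
  let L : Euc d →ₗ[ℝ] TangentSpace (𝓡 d) (e.symm y) :=
    (mfderiv (𝓡 d) (𝓡 d) e.symm y).toLinearMap
  have hL : Function.Surjective L :=
    (mdifferentiable_chart_of_mem_atlas he).symm.mfderiv_surjective hy
  have h3 : (range fun i => chartFrame e i y) =
      L '' (range fun i : Fin d => EuclideanSpace.single i (1 : ℝ)) := by
    rw [← range_comp]; rfl
  rw [h3, ← Submodule.map_span, h1, Submodule.map_top, LinearMap.range_eq_top.2 hL]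

theorem linearIndependent_chartFrame (he : e ∈ atlas (Euc d) X) {y : Euc d} (hy : y ∈ e.target) :
    LinearIndependent ℝ fun i => chartFrame e i y := by
  have h1 : LinearIndependent ℝ fun i : Fin d => EuclideanSpace.single i (1 : ℝ) := by
    have := (EuclideanSpace.basisFun (Fin d) ℝ).toBasis.linearIndependent
    have h2 : ⇑(EuclideanSpace.basisFun (Fin d) ℝ).toBasis =
        fun i => EuclideanSpace.single i (1 : ℝ) := by ext; simp
    rwa [h2] at this
  let L : Euc d →ₗ[ℝ] TangentSpace (𝓡 d) (e.symm y) :=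
    (mfderiv (𝓡 d) (𝓡 d) e.symm y).toLinearMap
  have hL : Function.Injective L :=
    (mdifferentiable_chart_of_mem_atlas he).symm.mfderiv_injective hy
  exact h1.map' L (LinearMap.ker_eq_bot.2 hL)

theorem continuousOn_chartFrame (he : e ∈ atlas (Euc d) X) (i : Fin d) :
    ContinuousOn (fun y => (⟨e.symm y, chartFrame e i y⟩ : TangentBundle (𝓡 d) X)) e.target := by
  have h1 := (contMDiffOn_chart_symm he).continuousOn_tangentMapWithin (by simp)
    e.open_target.uniqueMDiffOn
  have h2 : Continuous fun y : Euc d =>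
      (⟨y, EuclideanSpace.single i (1 : ℝ)⟩ : TangentBundle (𝓡 d) (Euc d)) :=
    ((tangentBundleModelSpaceHomeomorph (𝓡 d)).symm.continuous).comp
      (continuous_id.prodMk continuous_const)
  refine (h1.comp h2.continuousOn fun y hy => hy).congr fun y hy => ?_
  change _ = (⟨_, _⟩ : TangentBundle (𝓡 d) X)
  simp only [chartFrame, mfderivWithin_of_isOpen e.open_target hy]

theorem contDiffOn_comp_chart_symm (he : e ∈ atlas (Euc d) X) {f : X → ℝ}
    (hf : ContMDiff (𝓡 d) 𝓘(ℝ, ℝ) ∞ f) : ContDiffOn ℝ ∞ (f ∘ e.symm) e.target :=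
  (hf.comp_contMDiffOn (contMDiffOn_chart_symm he)).contDiffOn

variable [RiemannianBundle (fun x : X => TangentSpace (𝓡 d) x)]

theorem inner_riemGrad_chartFrame (he : e ∈ atlas (Euc d) X) {f : X → ℝ}
    (hf : ContMDiff (𝓡 d) 𝓘(ℝ, ℝ) ∞ f) {y : Euc d} (hy : y ∈ e.target) (i : Fin d) :
    inner ℝ (riemGrad d f (e.symm y)) (chartFrame e i y) =
      fderiv ℝ (f ∘ e.symm) y (EuclideanSpace.single i (1 : ℝ)) := by
  have h1 : MDifferentiableAt (𝓡 d) (𝓡 d) e.symm y :=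
    (mdifferentiable_chart_of_mem_atlas he).mdifferentiableAt_symm hy
  have h2 : MDifferentiableAt (𝓡 d) 𝓘(ℝ, ℝ) f (e.symm y) :=
    hf.contMDiffAt.mdifferentiableAt (by simp)
  refine (inner_riemGrad d f (e.symm y) (chartFrame e i y)).trans ?_
  rw [← mfderiv_eq_fderiv, mfderiv_comp y h2 h1]
  rfl

theorem det_chartGram_ne_zero (he : e ∈ atlas (Euc d) X) {y : Euc d} (hy : y ∈ e.target) :
    (chartGram d e y).det ≠ 0 :=
  Matrix.det_gram_ne_zero_iff_linearIndependent.2 (linearIndependent_chartFrame he hy)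

theorem det_chartGram_pos (he : e ∈ atlas (Euc d) X) {y : Euc d} (hy : y ∈ e.target) :
    0 < (chartGram d e y).det :=
  (Matrix.posDef_gram_of_linearIndependent (linearIndependent_chartFrame he hy)).det_pos

variable [IsContMDiffRiemannianBundle (𝓡 d) ∞ (Euc d) (fun x : X => TangentSpace (𝓡 d) x)]

theorem isContinuousRiemannianBundle_tangent :
    IsContinuousRiemannianBundle (Euc d) (fun x : X => TangentSpace (𝓡 d) x) := by
  obtain ⟨g, hg, hg'⟩ := IsContMDiffRiemannianBundle.exists_contMDiff (IB := 𝓡 d) (n := ∞)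
    (F := Euc d) (E := fun x : X => TangentSpace (𝓡 d) x)
  exact ⟨g, hg.continuous, hg'⟩

theorem continuousOn_chartGram (he : e ∈ atlas (Euc d) X) :
    ContinuousOn (chartGram d e) e.target := by
  have := isContinuousRiemannianBundle_tangent (d := d) (X := X)
  refine continuousOn_pi.2 fun i => continuousOn_pi.2 fun j => ?_
  exact ContinuousOn.inner_bundle (F := Euc d) (E := fun x : X => TangentSpace (𝓡 d) x)
    (b := e.symm) (v := chartFrame e i) (w := chartFrame e j)
    (continuousOn_chartFrame he i) (continuousOn_chartFrame he j)

/-- In a chart, the inner product of two gradients is given by the inverse of the Gram matrix; in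
particular it is continuous. -/
theorem continuous_inner_riemGrad {f h : X → ℝ} (hf : ContMDiff (𝓡 d) 𝓘(ℝ, ℝ) ∞ f)
    (hh : ContMDiff (𝓡 d) 𝓘(ℝ, ℝ) ∞ h) :
    Continuous fun x => inner ℝ (riemGrad d f x) (riemGrad d h x) := by
  refine continuous_iff_continuousAt.2 fun x₀ => ?_
  set e := chartAt (Euc d) x₀
  have he : e ∈ atlas (Euc d) X := chart_mem_atlas _ _
  set a : (X → ℝ) → Euc d → Fin d → ℝ := fun f y i =>
    fderiv ℝ (f ∘ e.symm) y (EuclideanSpace.single i (1 : ℝ)) with ha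
  have hac : ∀ {f : X → ℝ}, ContMDiff (𝓡 d) 𝓘(ℝ, ℝ) ∞ f → ContinuousOn (a f) e.target := by
    intro f hf
    exact continuousOn_pi.2 fun i =>
      ((contDiffOn_comp_chart_symm he hf).continuousOn_fderiv_of_isOpen e.open_target
        (by simp)).clm_apply continuousOn_const
  have key : ∀ y ∈ e.target, inner ℝ (riemGrad d f (e.symm y)) (riemGrad d h (e.symm y)) =
      a f y ⬝ᵥ ((chartGram d e y)⁻¹.mulVec (a h y)) := by
    intro y hy
    obtain ⟨c, hc⟩ := (Submodule.mem_span_range_iff_exists_fun ℝ).1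
      ((span_chartFrame he hy).symm ▸ Submodule.mem_top :
        riemGrad d h (e.symm y) ∈ Submodule.span ℝ (range fun i => chartFrame e i y))
    have h1 : a h y = (chartGram d e y).mulVec c := by
      ext i
      change fderiv ℝ (h ∘ e.symm) y (EuclideanSpace.single i (1 : ℝ)) = _
      rw [← inner_riemGrad_chartFrame he hh hy, ← hc, sum_inner]
      simp only [Matrix.mulVec, dotProduct]
      refine Finset.sum_congr rfl fun j _ => ?_
      rw [real_inner_smul_left, real_inner_comm, mul_comm]
      rfl
    rw [h1, Matrix.mulVec_mulVec, Matrix.nonsing_inv_mul _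
      (isUnit_iff_ne_zero.2 (det_chartGram_ne_zero he hy)), Matrix.one_mulVec, ← hc, inner_sum]
    refine Finset.sum_congr rfl fun j _ => ?_
    rw [real_inner_smul_right, inner_riemGrad_chartFrame he hf hy, mul_comm]
  have hcont : ContinuousOn (fun y => a f y ⬝ᵥ ((chartGram d e y)⁻¹.mulVec (a h y))) e.target := by
    have hinv : ContinuousOn (fun y => (chartGram d e y)⁻¹) e.target := by
      simp only [Matrix.inv_def, Ring.inverse_eq_inv']
      refine ContinuousOn.smul (ContinuousOn.inv₀ ?_ fun y hy => det_chartGram_ne_zero he hy) ?_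
      · exact (continuous_id.matrix_det).comp_continuousOn (continuousOn_chartGram he)
      · exact (continuous_id.matrix_adjugate).comp_continuousOn (continuousOn_chartGram he)
    have : Continuous fun p : (Fin d → ℝ) × Matrix (Fin d) (Fin d) ℝ × (Fin d → ℝ) =>
        p.1 ⬝ᵥ (p.2.1.mulVec p.2.2) :=
      continuous_fst.dotProduct ((continuous_fst.comp continuous_snd).matrix_mulVec
        (continuous_snd.comp continuous_snd))
    exact this.comp_continuousOn ((hac hf).prodMk (hinv.prodMk (hac hh)))
  have hx₀ : x₀ ∈ e.source := mem_chart_source _ _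
  have h2 : ContinuousAt ((fun y => a f y ⬝ᵥ ((chartGram d e y)⁻¹.mulVec (a h y))) ∘ e) x₀ :=
    (hcont.continuousAt (e.open_target.mem_nhds (e.map_source hx₀))).comp (e.continuousAt hx₀)
  refine h2.congr ?_
  filter_upwards [e.open_source.mem_nhds hx₀] with x hx
  rw [Function.comp_apply, ← key _ (e.map_source hx), e.left_inv hx]

theorem continuous_norm_riemGrad {f : X → ℝ} (hf : ContMDiff (𝓡 d) 𝓘(ℝ, ℝ) ∞ f) :
    Continuous fun x => ‖riemGrad d f x‖ := by
  simp_rw [norm_eq_sqrt_real_inner]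
  exact (continuous_inner_riemGrad hf hf).sqrt

end Chart

/-! ### The manifold case: localization in charts -/

section Manifold

variable {d : ℕ} {X : Type*} [TopologicalSpace X] [ChartedSpace (Euc d) X]
  [RiemannianBundle (fun x : X => TangentSpace (𝓡 d) x)]

theorem riemGrad_sub {f g : X → ℝ} {x : X} (hf : MDifferentiableAt (𝓡 d) 𝓘(ℝ, ℝ) f x)
    (hg : MDifferentiableAt (𝓡 d) 𝓘(ℝ, ℝ) g x) :
    riemGrad d (f - g) x = riemGrad d f x - riemGrad d g x := by
  refine ext_inner_right ℝ fun v => ?_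
  rw [inner_sub_left, inner_riemGrad, inner_riemGrad, inner_riemGrad,
    (hf.hasMFDerivAt.sub hg.hasMFDerivAt).mfderiv]
  rfl

/-- The density of the Riemannian volume in the chart `e`. -/
noncomputable def chartDensity (e : OpenPartialHomeomorph X (Euc d)) (y : Euc d) : ℝ≥0∞ :=
  ENNReal.ofReal (Real.sqrt (chartGram d e y).det)

variable [IsManifold (𝓡 d) ∞ X]

theorem chartDensity_pos {e : OpenPartialHomeomorph X (Euc d)}
    (he : e ∈ atlas (Euc d) X) {y : Euc d} (hy : y ∈ e.target) : 0 < chartDensity e y :=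
  ENNReal.ofReal_pos.2 (Real.sqrt_pos.2 (det_chartGram_pos he hy))

variable [IsContMDiffRiemannianBundle (𝓡 d) ∞ (Euc d) (fun x : X => TangentSpace (𝓡 d) x)]

theorem continuousOn_chartDensity {e : OpenPartialHomeomorph X (Euc d)}
    (he : e ∈ atlas (Euc d) X) : ContinuousOn (chartDensity e) e.target := by
  refine ENNReal.continuous_ofReal.comp_continuousOn (Real.continuous_sqrt.comp_continuousOn ?_)
  exact (continuous_id.matrix_det).comp_continuousOn (continuousOn_chartGram he)

variable [MeasurableSpace X] [BorelSpace X]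

theorem measurable_enorm_riemGrad_sub {f g : X → ℝ} (hf : ContMDiff (𝓡 d) 𝓘(ℝ, ℝ) ∞ f)
    (hg : ContMDiff (𝓡 d) 𝓘(ℝ, ℝ) ∞ g) :
    Measurable fun x => ‖riemGrad d f x - riemGrad d g x‖ₑ := by
  simp_rw [← ofReal_norm, ← riemGrad_sub (hf.contMDiffAt.mdifferentiableAt (by simp))
    (hg.contMDiffAt.mdifferentiableAt (by simp))]
  exact (continuous_norm_riemGrad (hf.sub hg)).measurable.ennreal_ofReal

variable [SecondCountableTopology X]

/-- Integrals over subsets of a chart domain, computed in coordinates. -/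
theorem setLIntegral_chart (x₀ : X) {S : Set (Euc d)} (hS : IsOpen S)
    (hSt : S ⊆ (chartAt (Euc d) x₀).target) {f : X → ℝ≥0∞} (hf : Measurable f) :
    ∫⁻ x in (chartAt (Euc d) x₀).source ∩ (chartAt (Euc d) x₀) ⁻¹' S, f x ∂(riemannianVolume d X) =
      ∫⁻ y in S, chartDensity (chartAt (Euc d) x₀) y * f ((chartAt (Euc d) x₀).symm y) := by
  set e := chartAt (Euc d) x₀ with hedef
  have he : e ∈ atlas (Euc d) X := chart_mem_atlas _ _
  have hW : MeasurableSet (e.source ∩ e ⁻¹' S) := (e.isOpen_inter_preimage hS).measurableSet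
  have h0 : AEMeasurable (chartDensity e) (volume.restrict e.target) :=
    (continuousOn_chartDensity he).aemeasurable e.open_target.measurableSet
  have h1 : AEMeasurable e.symm (volume.restrict e.target) :=
    e.continuousOn_symm.aemeasurable e.open_target.measurableSet
  have h2 : (riemannianVolume d X).restrict (e.source ∩ e ⁻¹' S) =
      (chartVolume d e).restrict (e.source ∩ e ⁻¹' S) := by
    rw [← riemannianVolume_restrict_chart_source x₀, Measure.restrict_restrict hW,
      inter_eq_left.2 inter_subset_left]
  have h3 : chartVolume d e =
      ((volume.restrict e.target).withDensity (chartDensity e)).map e.symm := rfl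
  have h4 : ∫⁻ y, (e.source ∩ e ⁻¹' S).indicator f (e.symm y)
      ∂((volume.restrict e.target).withDensity (chartDensity e)) =
      ∫⁻ y in e.target, chartDensity e y * (e.source ∩ e ⁻¹' S).indicator f (e.symm y) :=
    lintegral_withDensity_eq_lintegral_mul₀ h0 ((hf.indicator hW).comp_aemeasurable h1)
  rw [h2, ← lintegral_indicator hW, h3, lintegral_map' ((hf.indicator hW).aemeasurable)
    (h1.mono_ac (withDensity_absolutelyContinuous _ _)), h4,
    ← lintegral_indicator hS.measurableSet, ← lintegral_indicator e.open_target.measurableSet]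
  refine lintegral_congr fun y => ?_
  by_cases hy : y ∈ e.target
  · rw [indicator_of_mem hy]
    by_cases hyS : y ∈ S
    · have : e.symm y ∈ e.source ∩ e ⁻¹' S := ⟨e.map_target hy, by
        rw [mem_preimage, e.right_inv hy]; exact hyS⟩
      rw [indicator_of_mem hyS, indicator_of_mem this]
    · have : e.symm y ∉ e.source ∩ e ⁻¹' S := fun h => hyS (by
        have := h.2; rwa [mem_preimage, e.right_inv hy] at this)
      rw [indicator_of_notMem hyS, indicator_of_notMem this, mul_zero]
  · rw [indicator_of_notMem hy, indicator_of_notMem fun h => hy (hSt h)]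

/-- Local integrability of `1 / ρ₁` on a Riemannian manifold implies that the gradient is
closable. -/
theorem gradClosable_of_localInvIntegrable {ρ₁ : X → ℝ≥0∞} (hρ : Measurable ρ₁)
    (hloc : LocalInvIntegrable (riemannianVolume d X) ρ₁) : GradClosable d ρ₁ := by
  intro u hu h0 h1
  set m := riemannianVolume d X with hm
  set R : Set X := {x | ∃ U : Set X, IsOpen U ∧ x ∈ U ∧ ∫⁻ y in U, (ρ₁ y)⁻¹ ∂m < ⊤} with hR
  have hbad : MeasurableSet {x | Tendsto (fun k => ‖riemGrad d (u k) x‖) atTop (𝓝 0)} :=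
    measurableSet_tendsto _ fun k => (continuous_norm_riemGrad (hu k)).measurable
  suffices H : ∀ᵐ x ∂m, x ∈ R → Tendsto (fun k => ‖riemGrad d (u k) x‖) atTop (𝓝 0) by
    filter_upwards [H, hloc] with x hx hx' hx0
    by_cases h : x ∈ R
    · exact hx h
    · exact absurd (hx' h) hx0
  rw [ae_iff]
  refine measure_null_of_locally_null _ fun x₀ hx₀ => ?_
  obtain ⟨U, hUo, hxU, hUint⟩ : x₀ ∈ R := by
    by_contra h
    exact hx₀ fun h' => absurd h' h
  set e := chartAt (Euc d) x₀ with hedef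
  have he : e ∈ atlas (Euc d) X := chart_mem_atlas _ _
  have hxs : x₀ ∈ e.source := mem_chart_source _ _
  -- A closed ball in the coordinate domain on which `1 / ρ₁` is integrable.
  obtain ⟨δ, hδ, hball⟩ : ∃ δ > 0, Metric.closedBall (e x₀) δ ⊆ e.target ∩ e.symm ⁻¹' U := by
    refine Metric.nhds_basis_closedBall.mem_iff.1 ?_
    refine (e.isOpen_inter_preimage_symm hUo).mem_nhds ⟨e.map_source hxs, ?_⟩
    rwa [mem_preimage, e.left_inv hxs]
  set B := Metric.ball (e x₀) δ
  have hBB : B ⊆ Metric.closedBall (e x₀) δ := Metric.ball_subset_closedBall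
  have hBt : B ⊆ e.target := fun y hy => (hball (hBB hy)).1
  have hcpt : IsCompact (Metric.closedBall (e x₀) δ) := isCompact_closedBall _ _
  set W : Set X := e.source ∩ e ⁻¹' B with hW
  have hWo : IsOpen W := e.isOpen_inter_preimage Metric.isOpen_ball
  set K : Set X := e.symm '' Metric.closedBall (e x₀) δ
  have hK : IsCompact K :=
    hcpt.image_of_continuousOn (e.continuousOn_symm.mono fun y hy => (hball hy).1)
  have hWK : W ⊆ K := fun x hx => ⟨e x, hBB hx.2, e.left_inv hx.1⟩
  have hWU : W ⊆ U := fun x hx => by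
    have := (hball (hBB hx.2)).2
    rwa [mem_preimage, e.left_inv hx.1] at this
  -- The density of the volume is bounded below on the ball.
  obtain ⟨c, hc0, hc⟩ : ∃ c : ℝ≥0∞, 0 < c ∧ ∀ y ∈ B, c ≤ chartDensity e y := by
    obtain ⟨y₀, hy₀, hmin⟩ := hcpt.exists_isMinOn ⟨e x₀, Metric.mem_closedBall_self hδ.le⟩
      ((continuousOn_chartDensity he).mono fun y hy => (hball hy).1)
    exact ⟨_, chartDensity_pos he (hball hy₀).1, fun y hy => hmin (hBB hy)⟩
  have hc' : c ≠ 0 := hc0.ne'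
  have hctop : c ≠ ⊤ := ne_top_of_le_ne_top ENNReal.ofReal_ne_top
    (hc _ (Metric.mem_ball_self hδ))
  -- The coordinate fields are bounded on the ball.
  obtain ⟨C, hC⟩ : ∃ C : ℝ, ∀ i, ∀ y ∈ B, ‖chartFrame e i y‖ ≤ C := by
    have : ∀ i, ∃ C : ℝ, ∀ y ∈ B, ‖chartFrame e i y‖ ≤ C := by
      intro i
      have hcont : ContinuousOn (fun y => chartGram d e y i i) (Metric.closedBall (e x₀) δ) :=
        (continuousOn_pi.1 (continuousOn_pi.1 (continuousOn_chartGram he) i) i).mono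
          fun y hy => (hball hy).1
      obtain ⟨C, hC⟩ := hcpt.exists_bound_of_continuousOn hcont
      refine ⟨Real.sqrt C, fun y hy => ?_⟩
      rw [norm_eq_sqrt_real_inner]
      exact Real.sqrt_le_sqrt ((le_abs_self _).trans (hC y (hBB hy)))
    choose C hC using this
    refine ⟨∑ i, |C i|, fun i y hy => (hC i y hy).trans ((le_abs_self _).trans ?_)⟩
    exact Finset.single_le_sum (f := fun i => |C i|) (fun _ _ => abs_nonneg _) (Finset.mem_univ i)
  have hpull : ∀ {f : X → ℝ≥0∞}, Measurable f →
      c * ∫⁻ y in B, f (e.symm y) ≤ ∫⁻ x in W, f x ∂m := by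
    intro f hf
    rw [hm, setLIntegral_chart x₀ Metric.isOpen_ball hBt hf, ← lintegral_const_mul' _ _ hctop]
    refine setLIntegral_mono' Metric.isOpen_ball.measurableSet fun y hy => ?_
    gcongr
    exact hc y hy
  have hpull' : ∀ {f : X → ℝ≥0∞}, Measurable f →
      ∫⁻ y in B, f (e.symm y) ≤ c⁻¹ * ∫⁻ x in W, f x ∂m := by
    intro f hf
    rw [← ENNReal.div_eq_inv_mul, ENNReal.le_div_iff_mul_le (Or.inl hc') (Or.inl hctop), mul_comm]
    exact hpull hf
  have hpulltsum : ∀ {f : ℕ → X → ℝ≥0∞}, (∀ k, Measurable (f k)) →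
      ∑' k : ℕ, 2 ^ k * ∫⁻ x in K, f k x ∂m ≠ ⊤ →
      ∑' k : ℕ, 2 ^ k * ∫⁻ y in B, f k (e.symm y) ≠ ⊤ := by
    intro f hf hfK
    refine ne_top_of_le_ne_top (ENNReal.mul_ne_top (ENNReal.inv_ne_top.2 hc') hfK) ?_
    rw [← ENNReal.tsum_mul_left]
    refine ENNReal.tsum_le_tsum fun k => ?_
    calc 2 ^ k * ∫⁻ y in B, f k (e.symm y)
        ≤ 2 ^ k * (c⁻¹ * ∫⁻ x in W, f k x ∂m) := by gcongr; exact hpull' (hf k)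
      _ ≤ 2 ^ k * (c⁻¹ * ∫⁻ x in K, f k x ∂m) := by
          gcongr
      _ = _ := by ring
  -- A globally measurable extension of `e.symm`.
  classical
  set s : Euc d → X := e.target.piecewise e.symm fun _ => x₀
  have hsm : Measurable s :=
    e.continuousOn_symm.measurable_piecewise continuousOn_const e.open_target.measurableSet
  have hs : ∀ y ∈ B, s y = e.symm y := fun y hy => piecewise_eq_of_mem _ _ _ (hBt hy)
  have hinv : ∫⁻ y in B, (ρ₁ (s y))⁻¹ ≠ ⊤ := by
    have e1 : ∫⁻ y in B, (ρ₁ (s y))⁻¹ = ∫⁻ y in B, (ρ₁ (e.symm y))⁻¹ :=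
      setLIntegral_congr_fun Metric.isOpen_ball.measurableSet fun y hy => by simp only [hs y hy]
    rw [e1]
    refine ne_top_of_le_ne_top (ENNReal.mul_ne_top (ENNReal.inv_ne_top.2 hc') ?_)
      (hpull' hρ.inv)
    exact ((lintegral_mono_set hWU).trans_lt hUint).ne
  have hgm : ∀ k, Measurable fun x =>
      ‖riemGrad d (u (k + 1)) x - riemGrad d (u k) x‖ₑ ^ 2 * ρ₁ x := fun k =>
    ((measurable_enorm_riemGrad_sub (hu _) (hu _)).pow_const 2).mul hρ
  have hdir : ∀ i : Fin d, ∀ᵐ y : Euc d, y ∈ B → Tendsto (fun k =>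
      fderiv ℝ (u k ∘ e.symm) y (EuclideanSpace.single i (1 : ℝ))) atTop (𝓝 0) := by
    intro i
    refine ae_tendsto_fderiv_zero Metric.isOpen_ball (hρ.comp hsm) hinv
      (fun k => ((contDiffOn_comp_chart_symm he (hu k)).of_le (by simp)).mono hBt) _ ?_ ?_
    · refine ne_top_of_le_ne_top (hpulltsum (f := fun k x => ‖u k x‖ₑ ^ 2 * ρ₁ x)
        (fun k => ((hu k).continuous.measurable.enorm.pow_const 2).mul hρ) (h0 K hK)) ?_
      refine ENNReal.tsum_le_tsum fun k => mul_le_mul_right ?_ _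
      refine setLIntegral_mono' Metric.isOpen_ball.measurableSet fun y hy => ?_
      rw [Function.comp_apply, Function.comp_apply, hs y hy]
    · refine ne_top_of_le_ne_top (ENNReal.mul_ne_top (b := ENNReal.ofReal C ^ 2)
        (hpulltsum hgm (h1 K hK)) (by simp)) ?_
      rw [← ENNReal.tsum_mul_right]
      refine ENNReal.tsum_le_tsum fun k => ?_
      rw [mul_assoc]
      refine mul_le_mul_right ?_ _
      rw [← lintegral_mul_const' _ _ (by simp)]
      refine setLIntegral_mono' Metric.isOpen_ball.measurableSet fun y hy => ?_
      rw [mul_right_comm, ← mul_pow, Function.comp_apply, hs y hy]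
      refine mul_le_mul_left (pow_le_pow_left' ?_ 2) _
      have := enorm_inner_riemGrad_sub_le (u (k + 1)) (u k) (e.symm y) (chartFrame e i y)
      rw [inner_riemGrad_chartFrame he (hu _) (hBt hy),
        inner_riemGrad_chartFrame he (hu _) (hBt hy)] at this
      refine this.trans ?_
      gcongr
      rw [← ofReal_norm]
      exact ENNReal.ofReal_le_ofReal (hC i y hy)
  refine ⟨_, inter_mem_nhdsWithin _ (hWo.mem_nhds ⟨hxs, Metric.mem_ball_self hδ⟩), ?_⟩
  have hnull : m ({x | Tendsto (fun k => ‖riemGrad d (u k) x‖) atTop (𝓝 0)}ᶜ ∩ W) = 0 := by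
    rw [← Measure.restrict_apply hbad.compl, ← lintegral_indicator_one hbad.compl, hm,
      setLIntegral_chart x₀ Metric.isOpen_ball hBt (measurable_one.indicator hbad.compl),
      ← nonpos_iff_eq_zero, ← lintegral_zero]
    refine lintegral_mono_ae ((ae_restrict_iff' Metric.isOpen_ball.measurableSet).2 ?_)
    filter_upwards [ae_all_iff.2 hdir] with y hy hyB
    rw [indicator_of_notMem, mul_zero]
    refine fun h => h ?_
    refine tendsto_norm_zero_of_inner (span_chartFrame he (hBt hyB)) fun i => ?_
    exact (hy i hyB).congr fun k => (inner_riemGrad_chartFrame he (hu k) (hBt hyB) i).symm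
  refine measure_mono_null (inter_subset_inter_left _ fun x hx => ?_) hnull
  exact fun hx' => hx fun _ => hx'

end Manifold

/-! ### Measurability on the configuration space -/

/-- In a finite set `S`, there is an element with exactly `k` predecessors if and only if `S` has
more than `k` elements. -/
theorem exists_encard_lt_eq_iff {α : Type*} {φ : α → ℝ} (hφ : Function.Injective φ) {S : Set α}
    (hS : S.Finite) (k : ℕ) :
    (∃ x ∈ S, (S ∩ {y | φ y < φ x}).encard = k) ↔ ((k + 1 : ℕ) : ℕ∞) ≤ S.encard := by
  constructor
  · rintro ⟨x, hx, hk⟩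
    have hx' : x ∉ S ∩ {y | φ y < φ x} := fun h => lt_irrefl (φ x) h.2
    have := encard_insert_of_notMem hx'
    rw [hk] at this
    rw [Nat.cast_add, Nat.cast_one, ← this]
    exact encard_le_encard (insert_subset hx inter_subset_left)
  · intro h
    lift S to Finset α using hS
    rw [encard_coe_eq_coe_finsetCard, Nat.cast_le] at h
    have hlt : k < (S.map ⟨φ, hφ⟩).card := by rw [Finset.card_map]; omega
    set T := S.map ⟨φ, hφ⟩
    set f := T.orderEmbOfFin rfl
    obtain ⟨x, hx, hxk⟩ := Finset.mem_map.1 (T.orderEmbOfFin_mem rfl ⟨k, hlt⟩)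
    refine ⟨x, hx, ?_⟩
    have e1 : φ '' (↑S ∩ {y | φ y < φ x}) = f '' Iio ⟨k, hlt⟩ := by
      change φ x = f ⟨k, hlt⟩ at hxk
      ext t
      constructor
      · rintro ⟨y, ⟨hy, hyx⟩, rfl⟩
        have : φ y ∈ range f := by
          rw [Finset.range_orderEmbOfFin]
          exact Finset.mem_coe.2 (Finset.mem_map.2 ⟨y, hy, rfl⟩)
        obtain ⟨j, hj⟩ := this
        refine ⟨j, ?_, hj⟩
        rw [mem_Iio, ← f.lt_iff_lt, hj, ← hxk]
        exact hyx
      · rintro ⟨j, hj, rfl⟩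
        obtain ⟨y, hy, hyj⟩ := Finset.mem_map.1 (T.orderEmbOfFin_mem rfl j)
        refine ⟨y, ⟨hy, ?_⟩, hyj⟩
        change φ y = f j at hyj
        rw [mem_ofPred_eq, hyj, hxk]
        exact f.lt_iff_lt.2 hj
    rw [← hφ.encard_image, e1, f.injective.encard_image, ← Finset.coe_Iio,
      encard_coe_eq_coe_finsetCard, Fin.card_Iio]

theorem eq_of_encard_lt_eq {α : Type*} {φ : α → ℝ} (hφ : Function.Injective φ) {S : Set α}
    (hS : S.Finite) {x y : α} (hx : x ∈ S) (hy : y ∈ S)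
    (h : (S ∩ {z | φ z < φ x}).encard = (S ∩ {z | φ z < φ y}).encard) : x = y := by
  have key : ∀ {x y : α}, x ∈ S → φ x < φ y →
      (S ∩ {z | φ z < φ x}).encard < (S ∩ {z | φ z < φ y}).encard := by
    intro x y hx hxy
    refine (hS.inter_of_left _).encard_lt_encard ⟨?_, fun h' => ?_⟩
    · exact fun z hz => ⟨hz.1, lt_trans hz.2 hxy⟩
    · exact lt_irrefl (φ x) (h' ⟨hx, hxy⟩).2
  rcases lt_trichotomy (φ x) (φ y) with h' | h' | h'
  · exact absurd h (key hx h').ne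
  · exact hφ h'
  · exact absurd h (key hy h').ne'

section Measurability

variable {X : Type*} [TopologicalSpace X]

theorem measurable_count_of_isOpen {U : Set X} (hU : IsOpen U) (hUc : IsCompact (closure U)) :
    Measurable fun γ : Config X => γ.count U := by
  rw [measurable_iff_comap_le]
  exact le_iSup₂_of_le (f := fun (Λ : Set X) (_ : IsOpen Λ ∧ IsCompact (closure Λ)) =>
    MeasurableSpace.comap (fun γ : Config X => γ.count Λ) inferInstance) U ⟨hU, hUc⟩ le_rfl

theorem measurable_of_measurable_count {α : Type*} [MeasurableSpace α] {G : α → Config X}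
    (h : ∀ U : Set X, IsOpen U → IsCompact (closure U) → Measurable fun a => (G a).count U) :
    Measurable G := by
  rw [measurable_iff_comap_le, Config.instMeasurableSpace]
  simp only [MeasurableSpace.comap_iSup, iSup_le_iff, MeasurableSpace.comap_comp]
  exact fun U hU => (h U hU.1 hU.2).comap_le

/-- Relatively compact open sets that exhaust the space. -/
theorem exists_open_exhaustion [T2Space X] [LocallyCompactSpace X] [SecondCountableTopology X] :
    ∃ Λ : ℕ → Set X, (∀ n, IsOpen (Λ n)) ∧ (∀ n, IsCompact (closure (Λ n))) ∧ Monotone Λ ∧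
      ⋃ n, Λ n = univ ∧ ∀ K : Set X, IsCompact K → ∃ n, K ⊆ Λ n := by
  let K : CompactExhaustion X := default
  refine ⟨fun n => interior (K n), fun n => isOpen_interior, fun n => ?_, fun m n h => ?_, ?_, ?_⟩
  · exact (K.isCompact n).closure_of_subset interior_subset
  · exact interior_mono (K.subset h)
  · refine eq_univ_of_forall fun x => ?_
    obtain ⟨n, hn⟩ := K.exists_mem_nhds x
    exact mem_iUnion.2 ⟨n, mem_interior_iff_mem_nhds.2 hn⟩
  · intro L hL
    obtain ⟨n, hn⟩ := K.exists_superset_of_isCompact hL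
    exact ⟨n + 1, hn.trans (K.subset_interior_succ n)⟩

theorem Config.count_ne_top (γ : Config X) {B : Set X} (hB : IsCompact (closure B)) :
    γ.count B ≠ ⊤ := by
  have : (γ.carrier ∩ B).Finite :=
    (γ.locallyFinite _ hB).subset (inter_subset_inter_right _ subset_closure)
  exact encard_ne_top_iff.2 this

variable [MeasurableSpace X]

/-- A configuration, viewed as the measure `∑_{x ∈ γ} ε_x`. -/
noncomputable def pointMeasure (γ : Config X) : Measure X :=
  Measure.sum fun x : γ.carrier => Measure.dirac (x : X)

theorem lintegral_pointMeasure [MeasurableSingletonClass X] (γ : Config X) (h : X → ℝ≥0∞) :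
    ∫⁻ x, h x ∂(pointMeasure γ) = ∑' x : γ.carrier, h x := by
  simp [pointMeasure, lintegral_sum_measure]

theorem pointMeasure_apply [MeasurableSingletonClass X] (γ : Config X) {B : Set X}
    (hB : MeasurableSet B) : pointMeasure γ B = (γ.count B : ℝ≥0∞) := by
  rw [← lintegral_indicator_one hB, lintegral_pointMeasure, Config.count,
    ← ENNReal.tsum_set_one, inter_comm, tsum_subtype (B ∩ γ.carrier) (fun _ => (1 : ℝ≥0∞)),
    tsum_subtype γ.carrier (B.indicator (1 : X → ℝ≥0∞)), inter_comm, ← indicator_indicator]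
  rfl

variable [T2Space X] [SecondCountableTopology X] [BorelSpace X]

theorem measurable_pointMeasure_restrict {Λ : Set X} (hΛ : IsOpen Λ)
    (hΛc : IsCompact (closure Λ)) :
    Measurable fun γ : Config X => (pointMeasure γ).restrict Λ := by
  have hsub : ∀ {s : Set X}, IsOpen s → IsOpen (s ∩ Λ) ∧ IsCompact (closure (s ∩ Λ)) := fun hs =>
    ⟨hs.inter hΛ, hΛc.of_isClosed_subset isClosed_closure (closure_mono inter_subset_right)⟩
  have hap : ∀ {s : Set X}, IsOpen s → Measurable fun γ : Config X =>
      (pointMeasure γ).restrict Λ s := by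
    intro s hs
    simp_rw [Measure.restrict_apply hs.measurableSet,
      fun γ : Config X => pointMeasure_apply γ (hs.inter hΛ).measurableSet]
    exact (Measurable.of_discrete (f := fun n : ℕ∞ => (n : ℝ≥0∞))).comp
      (measurable_count_of_isOpen (hsub hs).1 (hsub hs).2)
  have : ∀ γ : Config X, IsFiniteMeasure ((pointMeasure γ).restrict Λ) := fun γ => ⟨by
    rw [Measure.restrict_apply_univ, pointMeasure_apply γ hΛ.measurableSet, lt_top_iff_ne_top]
    simpa using γ.count_ne_top hΛc⟩
  exact Measurable.measure_of_isPiSystem (S := {s : Set X | IsOpen s})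
    BorelSpace.measurable_eq isPiSystem_isOpen (fun s hs => hap hs) (hap isOpen_univ)

/-- An injective coding of the points of `X` by real numbers that generates the Borel sets. -/
theorem exists_real_coding : ∃ φ : X → ℝ, Function.Injective φ ∧ Measurable φ ∧
    ∀ {α : Type _} [MeasurableSpace α] (p : α → X), Measurable (φ ∘ p) → Measurable p := by
  obtain ⟨s, ⟨e⟩⟩ := MeasurableSpace.measurableEquiv_nat_bool_of_countablyGenerated X
  have h := measurableEmbedding_embeddingReal (ℕ → Bool)
  refine ⟨embeddingReal (ℕ → Bool) ∘ Subtype.val ∘ e, ?_, ?_, ?_⟩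
  · exact h.injective.comp (Subtype.val_injective.comp e.injective)
  · exact h.measurable.comp (measurable_subtype_coe.comp e.measurable)
  · intro α _ p hp
    have h1 : Measurable (Subtype.val ∘ e ∘ p) := h.measurable_comp_iff.1 hp
    have h2 : Measurable (e ∘ p) := h1.subtype_mk (h := fun a => (e (p a)).2)
    have h3 := e.symm.measurable.comp h2
    rwa [← Function.comp_assoc, e.symm_comp_self, Function.id_comp] at h3

variable [LocallyCompactSpace X]

theorem measurable_pointMeasure : Measurable (pointMeasure : Config X → Measure X) := by
  refine Measure.measurable_of_measurable_coe _ fun B hB => ?_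
  obtain ⟨Λ, hΛo, hΛc, hmono, hU, -⟩ := exists_open_exhaustion (X := X)
  have : ∀ γ : Config X, pointMeasure γ B = ⨆ n, (pointMeasure γ).restrict (Λ n) B := by
    intro γ
    simp_rw [Measure.restrict_apply hB]
    rw [← (monotone_const.inter hmono).measure_iUnion (μ := pointMeasure γ) (s := fun n => B ∩ Λ n),
      ← inter_iUnion, hU, inter_univ]
  simp_rw [this]
  exact Measurable.iSup fun n =>
    (Measure.measurable_coe hB).comp (measurable_pointMeasure_restrict (hΛo n) (hΛc n))

theorem measurable_count {B : Set X} (hB : MeasurableSet B) :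
    Measurable fun γ : Config X => γ.count B := by
  have h1 : Measurable fun γ : Config X => ((γ.count B : ℕ∞) : ℝ≥0∞) := by
    simp_rw [← fun γ : Config X => pointMeasure_apply γ hB]
    exact (Measure.measurable_coe hB).comp measurable_pointMeasure
  refine ENat.measurable_iff.2 fun n => ?_
  have : (fun γ : Config X => γ.count B) ⁻¹' {(n : ℕ∞)} =
      (fun γ : Config X => ((γ.count B : ℕ∞) : ℝ≥0∞)) ⁻¹' {(n : ℝ≥0∞)} := by
    ext γ
    simp only [mem_preimage, mem_singleton_iff]
    rw [← ENat.toENNReal_coe, ENat.toENNReal_inj]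
  rw [this]
  exact h1 (measurableSet_singleton _)

end Measurability

/-! ### A measurable enumeration of the points of a configuration -/

section Enumeration

variable {X : Type*} [TopologicalSpace X] [MeasurableSpace X]

/-- A measurable enumeration of the points of the configurations: those `point j γ` for which
`γ ∈ active j` are the points of `γ`, each listed once. -/
structure PointEnumeration (X : Type*) [TopologicalSpace X] [MeasurableSpace X] where
  /-- The event that the `j`-th place of the list is taken. -/
  active : ℕ × ℕ → Set (Config X)
  /-- The point in the `j`-th place of the list. -/
  point : ℕ × ℕ → Config X → X
  measurableSet_active : ∀ j, MeasurableSet (active j)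
  measurable_point : ∀ j, Measurable (point j)
  bijOn : ∀ γ, BijOn (fun j => point j γ) {j | γ ∈ active j} γ.carrier

variable [T2Space X] [SecondCountableTopology X] [BorelSpace X] [LocallyCompactSpace X]

/-- The space is cut into countably many relatively compact Borel pieces; the points in one piece
are listed in the order of a real coding of the space. -/
theorem nonempty_pointEnumeration [Nonempty X] : Nonempty (PointEnumeration X) := by
  classical
  obtain ⟨Λ, hΛo, hΛc, -, hΛU, -⟩ := exists_open_exhaustion (X := X)
  obtain ⟨φ, hφ, hφm, hφp⟩ := exists_real_coding (X := X)
  set B : ℕ → Set X := disjointed Λ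
  have hBm : ∀ n, MeasurableSet (B n) :=
    fun n => MeasurableSet.disjointed (fun i => (hΛo i).measurableSet) n
  have hBfin : ∀ n (γ : Config X), (γ.carrier ∩ B n).Finite := fun n γ =>
    (γ.locallyFinite _ (hΛc n)).subset
      (inter_subset_inter_right _ ((disjointed_subset Λ n).trans subset_closure))
  have hBU : ⋃ n, B n = univ := by rw [iUnion_disjointed, hΛU]
  have hBd : Pairwise (Function.onFun Disjoint B) := disjoint_disjointed Λ
  -- `P (n, k) γ x`: the point `x` is the `k`-th point of `γ` in the `n`-th piece, counted from `0`.
  let P : ℕ × ℕ → Config X → X → Prop := fun j γ x => x ∈ γ.carrier ∩ B j.1 ∧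
    ((γ.carrier ∩ B j.1) ∩ {y | φ y < φ x}).encard = j.2
  let A : ℕ × ℕ → Set (Config X) := fun j => {γ | ∃ x, P j γ x}
  let x₀ : X := Classical.arbitrary X
  let p : ℕ × ℕ → Config X → X := fun j γ => if h : ∃ x, P j γ x then h.choose else x₀
  have hp : ∀ {j γ}, γ ∈ A j → P j γ (p j γ) := by
    intro j γ h
    have h' : ∃ x, P j γ x := h
    simp only [p, dif_pos h']
    exact h'.choose_spec
  have hp0 : ∀ {j γ}, γ ∉ A j → p j γ = x₀ := fun {j γ} h => dif_neg h
  have huniq : ∀ {j γ x y}, P j γ x → P j γ y → x = y := fun hx hy =>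
    eq_of_encard_lt_eq hφ (hBfin _ _) hx.1 hy.1 (hx.2.trans hy.2.symm)
  have hAm : ∀ j, MeasurableSet (A j) := by
    intro j
    have : A j = (fun γ : Config X => γ.count (B j.1)) ⁻¹' Ici ((j.2 + 1 : ℕ) : ℕ∞) := by
      ext γ
      rw [mem_preimage, mem_Ici, Config.count, ← exists_encard_lt_eq_iff hφ (hBfin _ _)]
      rfl
    rw [this]
    exact measurable_count (hBm _) (MeasurableSet.of_discrete)
  have hpm : ∀ j, Measurable (p j) := by
    intro j
    refine hφp _ (measurable_of_Iic fun t => ?_)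
    have hD : MeasurableSet {y : X | φ y ≤ t} := hφm measurableSet_Iic
    -- The `k`-th point has a code `≤ t` if and only if at least `k + 1` points do.
    have key : ∀ γ : Config X, γ ∈ A j ∧ φ (p j γ) ≤ t ↔
        ((j.2 + 1 : ℕ) : ℕ∞) ≤ γ.count (B j.1 ∩ {y | φ y ≤ t}) := by
      intro γ
      have hSfin : (γ.carrier ∩ (B j.1 ∩ {y | φ y ≤ t})).Finite :=
        (hBfin j.1 γ).subset (inter_subset_inter_right _ inter_subset_left)
      rw [Config.count, ← exists_encard_lt_eq_iff hφ hSfin]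
      have hrank : ∀ x, φ x ≤ t → (γ.carrier ∩ (B j.1 ∩ {y | φ y ≤ t})) ∩ {y | φ y < φ x} =
          (γ.carrier ∩ B j.1) ∩ {y | φ y < φ x} := by
        intro x hx
        ext y
        constructor
        · rintro ⟨⟨h1, h2, h3⟩, h4⟩
          exact ⟨⟨h1, h2⟩, h4⟩
        · rintro ⟨⟨h1, h2⟩, h4⟩
          exact ⟨⟨h1, h2, (le_of_lt h4).trans hx⟩, h4⟩
      constructor
      · rintro ⟨h1, h2⟩
        have := hp h1
        exact ⟨p j γ, ⟨this.1.1, this.1.2, h2⟩, by rw [hrank _ h2, this.2]⟩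
      · rintro ⟨x, ⟨h1, h2, h3⟩, h4⟩
        rw [hrank x h3] at h4
        have hx : P j γ x := ⟨⟨h1, h2⟩, h4⟩
        have hA : γ ∈ A j := ⟨x, hx⟩
        exact ⟨hA, by rwa [huniq (hp hA) hx]⟩
    have hset : (φ ∘ p j) ⁻¹' Iic t =
        {γ | ((j.2 + 1 : ℕ) : ℕ∞) ≤ γ.count (B j.1 ∩ {y | φ y ≤ t})} ∪
          ((A j)ᶜ ∩ {_γ | φ x₀ ≤ t}) := by
      ext γ
      by_cases h : γ ∈ A j
      · have := key γ
        simp only [h, true_and] at this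
        simp only [mem_preimage, Function.comp_apply, mem_Iic, this, mem_union, mem_inter_iff,
          mem_compl_iff, h, not_true, false_and, or_false]
        rfl
      · have h1 : ¬ ((j.2 + 1 : ℕ) : ℕ∞) ≤ γ.count (B j.1 ∩ {y | φ y ≤ t}) := fun h' =>
          h ((key γ).2 h').1
        simp only [mem_preimage, Function.comp_apply, mem_Iic, hp0 h, mem_union, mem_inter_iff,
          mem_compl_iff, h, not_false_eq_true, true_and]
        constructor
        · exact fun h' => Or.inr h'
        · rintro (h' | h')
          · exact absurd h' h1
          · exact h'
    rw [hset]
    refine MeasurableSet.union ?_ ((hAm j).compl.inter (MeasurableSet.const _))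
    exact measurable_count ((hBm _).inter hD) (MeasurableSet.of_discrete (s := Ici _))
  refine ⟨⟨A, p, hAm, hpm, fun γ => ⟨?_, ?_, ?_⟩⟩⟩
  · intro j hj
    exact (hp hj).1.1
  · rintro ⟨n, k⟩ hj ⟨n', k'⟩ hj' heq
    have h1 := hp (j := (n, k)) hj
    have h2 := hp (j := (n', k')) hj'
    have heq' : p (n, k) γ = p (n', k') γ := heq
    rw [← heq'] at h2
    have hn : n = n' := by
      by_contra hne
      exact disjoint_left.1 (hBd hne) h1.1.2 h2.1.2
    subst hn
    have := h1.2.symm.trans h2.2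
    rw [Nat.cast_inj] at this
    rw [Prod.mk.injEq]
    exact ⟨rfl, this⟩
  · intro x hx
    obtain ⟨n, hn⟩ := mem_iUnion.1 (hBU ▸ mem_univ x : x ∈ ⋃ n, B n)
    have hfin : ((γ.carrier ∩ B n) ∩ {y | φ y < φ x}).Finite :=
      (hBfin n γ).subset inter_subset_left
    obtain ⟨k, hk⟩ := ENat.ne_top_iff_exists.1 (encard_ne_top_iff.2 hfin)
    have hP : P (n, k) γ x := ⟨⟨hx, hn⟩, hk.symm⟩
    have hA : γ ∈ A (n, k) := ⟨x, hP⟩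
    exact ⟨(n, k), hA, huniq (hp hA) hP⟩

end Enumeration

/-! ### Energies: additivity and measurability -/

section Energy

variable {X : Type*} [TopologicalSpace X]

/-- The finite subconfigurations over which the conditional energy in `Λ` sums. -/
def energyIndex (Λ : Set X) (γ : Config X) : Set (Config X) :=
  {γ' | γ'.carrier ⊆ γ.carrier ∧ (γ'.carrier ∩ Λ).Nonempty}

theorem boltzmann_of_lt_top {Φ : Config X → EReal} {Λ : Set X} {γ : Config X}
    (h : ∑' γ' : energyIndex Λ γ, (Φ γ').abs < ⊤) :
    boltzmann Φ Λ γ =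
      EReal.exp (-((∑' γ' : energyIndex Λ γ, (Φ γ').toReal : ℝ) : EReal)) := by
  have h' : ∑' γ' : {γ' : Config X // γ'.carrier ⊆ γ.carrier ∧ (γ'.carrier ∩ Λ).Nonempty},
      (Φ γ').abs < ⊤ := h
  rw [boltzmann, condEnergy, if_pos h']
  rfl

theorem boltzmann_of_eq_top {Φ : Config X → EReal} {Λ : Set X} {γ : Config X}
    (h : ∑' γ' : energyIndex Λ γ, (Φ γ').abs = ⊤) : boltzmann Φ Λ γ = 0 := by
  rw [boltzmann, condEnergy, if_neg]
  · simp
  · exact fun h' => h'.ne h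

theorem ofReal_abs_toReal_le (x : EReal) : ENNReal.ofReal |x.toReal| ≤ x.abs := by
  induction x with
  | bot => simp
  | top => simp
  | coe x => rw [EReal.toReal_coe, EReal.abs_def]

theorem summable_toReal_of_tsum_abs {ι : Type*} {f : ι → EReal} (h : ∑' i, (f i).abs ≠ ⊤) :
    Summable fun i => (f i).toReal := by
  have h1 : ∑' i, ENNReal.ofReal |(f i).toReal| ≠ ⊤ :=
    ne_top_of_le_ne_top h (ENNReal.tsum_le_tsum fun i => ofReal_abs_toReal_le _)
  have := ENNReal.summable_toReal h1
  simp only [ENNReal.toReal_ofReal (abs_nonneg _)] at this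
  exact this.of_abs

/-- The energy gained by adding the point `x` does not depend on the window containing `x`. -/
theorem boltzmann_addPoint {Φ : Config X → EReal} {Λ : Set X} {γ : Config X} {x : X}
    (hx : x ∈ Λ) (hxγ : x ∉ γ.carrier) :
    boltzmann Φ Λ (γ.addPoint x) = boltzmann Φ Λ γ * boltzmann Φ {x} (γ.addPoint x) := by
  have hcar : (γ.addPoint x).carrier = γ.carrier ∪ {x} := rfl
  have hU : energyIndex Λ (γ.addPoint x) = energyIndex Λ γ ∪ energyIndex {x} (γ.addPoint x) := by
    ext γ'
    simp only [energyIndex, hcar, mem_union, mem_ofPred_eq]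
    constructor
    · rintro ⟨h1, h2⟩
      by_cases h : x ∈ γ'.carrier
      · exact Or.inr ⟨h1, x, h, rfl⟩
      · refine Or.inl ⟨fun y hy => (h1 hy).resolve_right ?_, h2⟩
        rintro rfl
        exact h hy
    · rintro (⟨h1, h2⟩ | ⟨h1, y, hy, rfl⟩)
      · exact ⟨h1.trans subset_union_left, h2⟩
      · exact ⟨h1, y, hy, hx⟩
  have hd : Disjoint (energyIndex Λ γ) (energyIndex {x} (γ.addPoint x)) := by
    refine disjoint_left.2 fun γ' h1 h2 => ?_
    obtain ⟨y, hy, rfl⟩ := h2.2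
    exact hxγ (h1.1 hy)
  have hsum : ∑' γ' : energyIndex Λ (γ.addPoint x), (Φ γ').abs =
      ∑' γ' : energyIndex Λ γ, (Φ γ').abs +
        ∑' γ' : energyIndex {x} (γ.addPoint x), (Φ γ').abs := by
    rw [hU]
    exact Summable.tsum_union_disjoint (f := fun γ' => (Φ γ').abs) hd ENNReal.summable
      ENNReal.summable
  rcases eq_or_ne (∑' γ' : energyIndex Λ γ, (Φ γ').abs) ⊤ with h1 | h1
  · rw [boltzmann_of_eq_top h1, boltzmann_of_eq_top (by rw [hsum, h1, top_add]), zero_mul]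
  rcases eq_or_ne (∑' γ' : energyIndex {x} (γ.addPoint x), (Φ γ').abs) ⊤ with h2 | h2
  · rw [boltzmann_of_eq_top h2, boltzmann_of_eq_top (by rw [hsum, h2, add_top]), mul_zero]
  have h3 : ∑' γ' : energyIndex Λ (γ.addPoint x), (Φ γ').abs < ⊤ := by
    rw [hsum]
    exact ENNReal.add_lt_top.2 ⟨h1.lt_top, h2.lt_top⟩
  rw [boltzmann_of_lt_top h1.lt_top, boltzmann_of_lt_top h2.lt_top, boltzmann_of_lt_top h3,
    ← EReal.exp_add, hU, Summable.tsum_union_disjoint (f := fun γ' => (Φ γ').toReal) hd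
      (summable_toReal_of_tsum_abs h1) (summable_toReal_of_tsum_abs h2)]
  congr 1
  norm_cast
  ring

theorem measurable_ereal_abs : Measurable EReal.abs :=
  EReal.measurable_of_measurable_real (by
    simp only [EReal.abs_def]
    exact (measurable_id.abs).ennreal_ofReal)

variable [MeasurableSpace X]

namespace PointEnumeration

/-- The subconfiguration of `γ` formed by the points at the places in `I`. -/
noncomputable def sub (en : PointEnumeration X) (I : Finset (ℕ × ℕ)) (γ : Config X) : Config X :=
  Config.ofFinite ((fun j => en.point j γ) '' {j | j ∈ I ∧ γ ∈ en.active j})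
    ((I.finite_toSet.subset fun _ hj => hj.1).image _)

variable (en : PointEnumeration X)

/-- Integrals over a configuration as series over the enumeration. -/
theorem lintegral_eq_tsum [MeasurableSingletonClass X] (γ : Config X) (h : X → ℝ≥0∞) :
    ∫⁻ x, h x ∂(pointMeasure γ) = ∑' j, (en.active j).indicator (fun γ => h (en.point j γ)) γ := by
  rw [lintegral_pointMeasure]
  have h1 := (en.bijOn γ).equiv.tsum_eq (fun x : γ.carrier => h x)
  rw [← h1]
  have h2 := tsum_subtype {j | γ ∈ en.active j} fun j => h (en.point j γ)
  exact h2

/-- A sum over finite subconfigurations as a sum over the finite sets of places of the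
enumeration. -/
theorem tsum_energyIndex {M : Type*} [AddCommMonoid M] [TopologicalSpace M] [T2Space M]
    (Ψ : Config X → M) (hΨ : ∀ γ : Config X, γ.carrier.Infinite → Ψ γ = 0) (Λ : Set X)
    (γ : Config X) :
    ∑' γ' : energyIndex Λ γ, Ψ γ' = ∑' I : Finset (ℕ × ℕ),
      {I : Finset (ℕ × ℕ) | (∀ j ∈ I, γ ∈ en.active j) ∧ ∃ j ∈ I, en.point j γ ∈ Λ}.indicator
        (fun I => Ψ (en.sub I γ)) I := by
  rw [← tsum_subtype {I : Finset (ℕ × ℕ) | (∀ j ∈ I, γ ∈ en.active j) ∧ ∃ j ∈ I, en.point j γ ∈ Λ}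
    (fun I => Ψ (en.sub I γ))]
  have hcar : ∀ I : Finset (ℕ × ℕ), (∀ j ∈ I, γ ∈ en.active j) →
      (en.sub I γ).carrier = (fun j => en.point j γ) '' ↑I := by
    intro I hI
    change _ '' _ = _
    congr 1
    ext j
    exact ⟨fun h => h.1, fun h => ⟨h, hI j h⟩⟩
  let g : {I : Finset (ℕ × ℕ) | (∀ j ∈ I, γ ∈ en.active j) ∧ ∃ j ∈ I, en.point j γ ∈ Λ} →
      energyIndex Λ γ := fun I => ⟨en.sub I γ, by
    rw [energyIndex, mem_ofPred_eq, hcar I I.2.1]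
    obtain ⟨j, hj, hjΛ⟩ := I.2.2
    refine ⟨?_, _, ⟨j, hj, rfl⟩, hjΛ⟩
    rintro x ⟨i, hi, rfl⟩
    exact (en.bijOn γ).mapsTo (I.2.1 i hi)⟩
  have hg : Function.Injective g := by
    intro I J hIJ
    have h1 : (en.sub I γ).carrier = (en.sub J γ).carrier := by
      have := congrArg (fun γ' : energyIndex Λ γ => (γ' : Config X).carrier) hIJ
      exact this
    rw [hcar I I.2.1, hcar J J.2.1] at h1
    have h2 := ((en.bijOn γ).injOn.image_eq_image_iff (s₁ := ((I : Finset (ℕ × ℕ)) : Set (ℕ × ℕ)))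
      (s₂ := ((J : Finset (ℕ × ℕ)) : Set (ℕ × ℕ))) (fun j hj => I.2.1 j hj)
      (fun j hj => J.2.1 j hj)).1 h1
    exact Subtype.ext (Finset.coe_injective h2)
  refine (hg.tsum_eq (f := fun γ' : energyIndex Λ γ => Ψ γ') ?_).symm
  rintro ⟨γ', h1, h2⟩ h3
  have hfin : γ'.carrier.Finite := by
    by_contra h
    exact h3 (hΨ γ' h)
  set T : Set (ℕ × ℕ) := {j | γ ∈ en.active j} ∩ (fun j => en.point j γ) ⁻¹' γ'.carrier with hT
  have hTimg : (fun j => en.point j γ) '' T = γ'.carrier := by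
    rw [hT, image_inter_preimage, (en.bijOn γ).image_eq, inter_eq_right.2 h1]
  have hTfin : T.Finite :=
    Finite.of_finite_image (hTimg ▸ hfin) ((en.bijOn γ).injOn.mono inter_subset_left)
  have hT' : ∀ j ∈ hTfin.toFinset, γ ∈ en.active j := fun j hj => (hTfin.mem_toFinset.1 hj).1
  have hc : (en.sub hTfin.toFinset γ).carrier = γ'.carrier := by
    rw [hcar _ hT', Finite.coe_toFinset, hTimg]
  refine ⟨⟨hTfin.toFinset, hT', ?_⟩, Subtype.ext (Config.ext hc)⟩
  obtain ⟨x, hx, hxΛ⟩ := h2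
  rw [← hTimg] at hx
  obtain ⟨j, hj, rfl⟩ := hx
  exact ⟨j, hTfin.mem_toFinset.2 hj, hxΛ⟩

theorem measurable_sub [BorelSpace X] (I : Finset (ℕ × ℕ)) : Measurable (en.sub I) := by
  refine measurable_of_measurable_count fun U hU _ => ?_
  have : ∀ γ : Config X, (en.sub I γ).count U =
      {j | (j ∈ I ∧ γ ∈ en.active j) ∧ en.point j γ ∈ U}.encard := by
    intro γ
    have h : (en.sub I γ).carrier ∩ U =
        (fun j => en.point j γ) '' {j | (j ∈ I ∧ γ ∈ en.active j) ∧ en.point j γ ∈ U} := by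
      ext x
      constructor
      · rintro ⟨⟨j, hj, rfl⟩, hU⟩
        exact ⟨j, ⟨hj, hU⟩, rfl⟩
      · rintro ⟨j, ⟨hj, hU⟩, rfl⟩
        exact ⟨⟨j, hj, rfl⟩, hU⟩
    rw [Config.count, h, ((en.bijOn γ).injOn.mono _).encard_image]
    exact fun j hj => hj.1.2
  simp_rw [this]
  refine measurable_encard.comp (measurable_set_iff.2 fun j => ?_)
  refine measurable_to_prop ?_
  have h : (fun γ : Config X => j ∈ {j | (j ∈ I ∧ γ ∈ en.active j) ∧ en.point j γ ∈ U}) ⁻¹' {True} =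
      ({_γ | j ∈ I} ∩ en.active j) ∩ en.point j ⁻¹' U := by
    ext γ
    simp
  rw [h]
  exact ((MeasurableSet.const _).inter (en.measurableSet_active j)).inter
    (en.measurable_point j hU.measurableSet)

end PointEnumeration

variable [T2Space X] [SecondCountableTopology X] [BorelSpace X] [LocallyCompactSpace X]

theorem measurableSet_mem_carrier [Nonempty X] :
    MeasurableSet {p : Config X × X | p.2 ∈ p.1.carrier} := by
  obtain ⟨en⟩ := nonempty_pointEnumeration (X := X)
  have : {p : Config X × X | p.2 ∈ p.1.carrier} =
      ⋃ j, (Prod.fst ⁻¹' en.active j) ∩ {p | en.point j p.1 = p.2} := by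
    ext ⟨γ, x⟩
    simp only [mem_iUnion]
    constructor
    · intro h
      obtain ⟨j, hj, hjx⟩ := (en.bijOn γ).surjOn h
      exact ⟨j, hj, hjx⟩
    · rintro ⟨j, hj, hjx⟩
      have hjx' : en.point j γ = x := hjx
      change x ∈ γ.carrier
      rw [← hjx']
      exact (en.bijOn γ).mapsTo hj
  rw [this]
  exact MeasurableSet.iUnion fun j => (measurable_fst (en.measurableSet_active j)).inter
    (measurableSet_eq_fun ((en.measurable_point j).comp measurable_fst) measurable_snd)

theorem measurable_addPoint [Nonempty X] :
    Measurable fun p : Config X × X => p.1.addPoint p.2 := by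
  classical
  refine measurable_of_measurable_count fun U hU _ => ?_
  have : ∀ p : Config X × X, (p.1.addPoint p.2).count U =
      if p.2 ∈ p.1.carrier then p.1.count U else
        if p.2 ∈ U then p.1.count U + 1 else p.1.count U := by
    rintro ⟨γ, x⟩
    have hc : (γ.addPoint x).carrier = γ.carrier ∪ {x} := rfl
    rw [Config.count, hc]
    split_ifs with h1 h2
    · rw [union_eq_left.2 (singleton_subset_iff.2 h1)]
      rfl
    · have : (γ.carrier ∪ {x}) ∩ U = insert x (γ.carrier ∩ U) := by
        rw [union_inter_distrib_right, union_comm, inter_eq_left.2 (singleton_subset_iff.2 h2)]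
        rfl
      rw [this, encard_insert_of_notMem fun h => h1 h.1]
      rfl
    · have : (γ.carrier ∪ {x}) ∩ U = γ.carrier ∩ U := by
        rw [union_inter_distrib_right, singleton_inter_eq_empty.2 h2, union_empty]
      rw [this]
      rfl
  simp_rw [this]
  have hcount := (measurable_count hU.measurableSet).comp
    (measurable_fst : Measurable (Prod.fst : Config X × X → Config X))
  refine Measurable.ite measurableSet_mem_carrier hcount (Measurable.ite ?_ ?_ hcount)
  · exact measurable_snd hU.measurableSet
  · exact (Measurable.of_discrete (f := fun n : ℕ∞ => n + 1)).comp hcount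

theorem measurable_restr {B : Set X} (hB : MeasurableSet B) :
    Measurable fun γ : Config X => γ.restr B := by
  refine measurable_of_measurable_count fun U hU _ => ?_
  have : ∀ γ : Config X, (γ.restr B).count U = γ.count (B ∩ U) := fun γ => by
    rw [Config.count, Config.count, ← inter_assoc]
    rfl
  simp_rw [this]
  exact measurable_count (hB.inter hU.measurableSet)

/-- The configuration that agrees with `γ` outside `Λ` and with `η` inside `Λ`. -/
def glue (Λ : Set X) (γ η : Config X) : Config X := (γ.restr Λᶜ).union (η.restr Λ)

theorem measurable_glue {Λ : Set X} (hΛ : MeasurableSet Λ) :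
    Measurable fun p : Config X × Config X => glue Λ p.1 p.2 := by
  refine measurable_of_measurable_count fun U hU _ => ?_
  have : ∀ p : Config X × Config X, (glue Λ p.1 p.2).count U =
      p.1.count (Λᶜ ∩ U) + p.2.count (Λ ∩ U) := by
    rintro ⟨γ, η⟩
    have hc : (glue Λ γ η).carrier ∩ U = γ.carrier ∩ (Λᶜ ∩ U) ∪ η.carrier ∩ (Λ ∩ U) := by
      change (γ.carrier ∩ Λᶜ ∪ η.carrier ∩ Λ) ∩ U = _
      rw [union_inter_distrib_right, inter_assoc, inter_assoc]
    rw [Config.count, hc, encard_union_eq]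
    · rfl
    · exact disjoint_left.2 fun x hx hx' => hx.2.1 hx'.2.1
  simp_rw [this]
  exact (Measurable.of_discrete (f := fun n : ℕ∞ × ℕ∞ => n.1 + n.2)).comp
    (((measurable_count (hΛ.compl.inter hU.measurableSet)).comp measurable_fst).prodMk
      ((measurable_count (hΛ.inter hU.measurableSet)).comp measurable_snd))

/-- A potential is measurable on finite configurations: it is evaluated in a large window. -/
theorem IsPotential.measurable_comp_of_finite {Φ : Config X → EReal} (hΦ : IsPotential Φ)
    {α : Type*} [MeasurableSpace α] {G : α → Config X} (hG : Measurable G)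
    (hfin : ∀ a, (G a).carrier.Finite) : Measurable fun a => Φ (G a) := by
  obtain ⟨Λ, hΛo, hΛc, hmono, hU, hK⟩ := exists_open_exhaustion (X := X)
  have hle : ∀ n, Config.localMeasurableSpace (Λ n) ≤ Config.instMeasurableSpace := fun n =>
    iSup₂_le fun B hB => (measurable_count hB.1).comap_le
  have h1 : ∀ n, Measurable fun a => Φ ((G a).restr (Λ n)) := fun n =>
    ((hΦ.measurable (Λ n) (hΛo n).measurableSet (hΛc n)).mono (hle n) le_rfl).comp hG
  refine measurable_of_tendsto_metrizable h1 (tendsto_pi_nhds.2 fun a => ?_)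
  obtain ⟨N, hN⟩ := hK _ (hfin a).isCompact
  refine tendsto_const_nhds.congr' ?_
  filter_upwards [eventually_ge_atTop N] with n hn
  have : (G a).restr (Λ n) = G a := Config.ext (inter_eq_left.2 (hN.trans (hmono hn)))
  rw [this]

/-- Joint measurability of the Boltzmann factor in the configuration and the window. -/
theorem IsPotential.measurable_boltzmann [Nonempty X] {Φ : Config X → EReal} (hΦ : IsPotential Φ)
    {α : Type*} [MeasurableSpace α] {G : α → Config X} (hG : Measurable G) {D : α → Set X}
    (hD : MeasurableSet {p : α × X | p.2 ∈ D p.1}) :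
    Measurable fun a => boltzmann Φ (D a) (G a) := by
  classical
  obtain ⟨en⟩ := nonempty_pointEnumeration (X := X)
  have hsub : ∀ I, Measurable fun a => Φ (en.sub I (G a)) := fun I =>
    hΦ.measurable_comp_of_finite ((en.measurable_sub I).comp hG)
      fun a => (I.finite_toSet.subset fun _ hj => hj.1).image _
  have hcond : ∀ I : Finset (ℕ × ℕ), MeasurableSet {a |
      (∀ j ∈ I, G a ∈ en.active j) ∧ ∃ j ∈ I, en.point j (G a) ∈ D a} := by
    intro I
    have h1 : {a | (∀ j ∈ I, G a ∈ en.active j) ∧ ∃ j ∈ I, en.point j (G a) ∈ D a} =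
        (⋂ j ∈ I, G ⁻¹' en.active j) ∩
          ⋃ j ∈ I, (fun a => (a, en.point j (G a))) ⁻¹' {p : α × X | p.2 ∈ D p.1} := by
      ext a; simp
    rw [h1]
    exact (Finset.measurableSet_biInter I fun j _ => hG (en.measurableSet_active j)).inter
      (Finset.measurableSet_biUnion I fun j _ =>
        (measurable_id.prodMk ((en.measurable_point j).comp hG)) hD)
  have hS : Measurable fun a => ∑' γ' : energyIndex (D a) (G a), (Φ γ').abs := by
    simp_rw [fun a => en.tsum_energyIndex (fun γ => (Φ γ).abs)
      (fun γ h => by rw [hΦ.eq_zero_of_infinite γ h, EReal.abs_zero]) (D a) (G a)]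
    refine Measurable.tsum fun I => ?_
    have := (measurable_ereal_abs.comp (hsub I)).indicator (hcond I)
    exact this
  have hT : Measurable fun a => ∑' γ' : energyIndex (D a) (G a), (Φ γ').toReal := by
    simp_rw [fun a => en.tsum_energyIndex (fun γ => (Φ γ).toReal)
      (fun γ h => by rw [hΦ.eq_zero_of_infinite γ h, EReal.toReal_zero]) (D a) (G a)]
    refine Measurable.tsum fun I => ?_
    have := (measurable_ereal_toReal.comp (hsub I)).indicator (hcond I)
    exact this
  have h : ∀ a, boltzmann Φ (D a) (G a) =
      if ∑' γ' : energyIndex (D a) (G a), (Φ γ').abs < ⊤ then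
        EReal.exp (-((∑' γ' : energyIndex (D a) (G a), (Φ γ').toReal : ℝ) : EReal)) else 0 := by
    intro a
    split_ifs with h
    · exact boltzmann_of_lt_top h
    · exact boltzmann_of_eq_top (not_lt_top_iff.1 h)
  simp_rw [h]
  refine Measurable.ite (hS measurableSet_Iio) ?_ measurable_const
  exact EReal.measurable_exp.comp (hT.coe_real_ereal.neg)

end Energy

/-! ### The Mecke identity for the Poisson measure -/

section Mecke

theorem injective_insertNth_iff {X : Type*} {n : ℕ} (j : Fin (n + 1)) {a : X} {y : Fin n → X}
    (ha : a ∉ range y) :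
    Function.Injective (j.insertNth (α := fun _ => X) a y) ↔ Function.Injective y := by
  constructor
  · intro h i i' hii'
    have := @h (j.succAbove i) (j.succAbove i') (by simpa using hii')
    exact Fin.succAbove_right_injective this
  · intro h i i'
    refine Fin.succAboveCases j ?_ (fun i => ?_) i <;>
      refine Fin.succAboveCases j ?_ (fun i' => ?_) i'
    · simp
    · simp only [Fin.insertNth_apply_same, Fin.insertNth_apply_succAbove]
      exact fun h' => absurd ⟨i', h'.symm⟩ ha
    · simp only [Fin.insertNth_apply_same, Fin.insertNth_apply_succAbove]
      exact fun h' => absurd ⟨i, h'⟩ ha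
    · simp only [Fin.insertNth_apply_succAbove]
      exact fun h' => congrArg _ (h h')

variable {X : Type*} [TopologicalSpace X]

/-- The configuration formed by the entries of a finite list of points. -/
def rangeConfig {n : ℕ} (x : Fin n → X) : Config X :=
  Config.ofFinite (range x) (finite_range x)

theorem rangeConfig_insertNth {n : ℕ} (j : Fin (n + 1)) (a : X) (y : Fin n → X) :
    rangeConfig (j.insertNth (α := fun _ => X) a y) = (rangeConfig y).addPoint a := by
  refine Config.ext ?_
  change range _ = range y ∪ {a}
  ext z
  constructor
  · rintro ⟨i, rfl⟩
    refine Fin.succAboveCases j ?_ (fun i => ?_) i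
    · simp
    · simp
  · rintro (⟨i, rfl⟩ | rfl)
    · exact ⟨j.succAbove i, by simp⟩
    · exact ⟨j, by simp⟩

theorem Config.countable_carrier [T2Space X] [LocallyCompactSpace X]
    [SecondCountableTopology X] (γ : Config X) : γ.carrier.Countable := by
  obtain ⟨Λ, -, hΛc, -, hU, -⟩ := exists_open_exhaustion (X := X)
  have : γ.carrier = ⋃ n, γ.carrier ∩ Λ n := by rw [← inter_iUnion, hU, inter_univ]
  rw [this]
  exact countable_iUnion fun n => ((γ.locallyFinite _ (hΛc n)).subset
    (inter_subset_inter_right _ subset_closure)).countable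

variable [MeasurableSpace X]

theorem ae_notMem_carrier [T2Space X] [LocallyCompactSpace X] [SecondCountableTopology X]
    (σ : Measure X) [NullSingletonClass σ] (γ : Config X) :
    ∀ᵐ x ∂σ, x ∉ γ.carrier := by
  rw [ae_iff]
  simp only [not_not]
  exact γ.countable_carrier.measure_zero σ

theorem lintegral_pointMeasure_rangeConfig [MeasurableSingletonClass X] {n : ℕ} {x : Fin n → X}
    (hx : Function.Injective x) (h : X → ℝ≥0∞) :
    ∫⁻ a, h a ∂(pointMeasure (rangeConfig x)) = ∑ j, h (x j) := by
  rw [lintegral_pointMeasure]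
  have := (Equiv.ofInjective x hx).tsum_eq fun a : range x => h a
  rw [tsum_fintype] at this
  exact this.symm

variable [T2Space X] [SecondCountableTopology X] [BorelSpace X]

theorem measurableSet_injective (n : ℕ) : MeasurableSet {x : Fin n → X | Function.Injective x} := by
  have : {x : Fin n → X | Function.Injective x} = ⋂ i, ⋂ j, {x | x i = x j → i = j} := by
    ext x
    simp [Function.Injective]
  rw [this]
  refine MeasurableSet.iInter fun i => MeasurableSet.iInter fun j => ?_
  exact (measurableSet_eq_fun (measurable_pi_apply i) (measurable_pi_apply j)).imp
    (MeasurableSet.const _)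

variable [LocallyCompactSpace X]

variable [Nonempty X]

theorem measurable_rangeConfig (n : ℕ) : Measurable (rangeConfig : (Fin n → X) → Config X) := by
  induction n with
  | zero => exact measurable_const' fun x y => by rw [Subsingleton.elim x y]
  | succ n ih =>
    have : (rangeConfig : (Fin (n + 1) → X) → Config X) =
        fun x => (rangeConfig fun i => x (Fin.succAbove 0 i)).addPoint (x 0) := by
      ext1 x
      rw [← rangeConfig_insertNth 0]
      congr 1
      exact (Fin.insertNth_self_removeNth 0 x).symm
    rw [this]
    exact measurable_addPoint.comp ((ih.comp (measurable_pi_iff.2 fun i =>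
      measurable_pi_apply _)).prodMk (measurable_pi_apply _))

theorem measurable_lintegral_pointMeasure {α : Type*} [MeasurableSpace α] {G : α → Config X}
    (hG : Measurable G) {h : α × X → ℝ≥0∞} (hh : Measurable h) :
    Measurable fun a => ∫⁻ x, h (a, x) ∂(pointMeasure (G a)) := by
  obtain ⟨en⟩ := nonempty_pointEnumeration (X := X)
  have : ∀ a, ∫⁻ x, h (a, x) ∂(pointMeasure (G a)) =
      ∑' j, (G ⁻¹' en.active j).indicator (fun a => h (a, en.point j (G a))) a := fun a =>
    en.lintegral_eq_tsum (G a) fun x => h (a, x)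
  simp_rw [this]
  exact Measurable.tsum fun j => (hh.comp (measurable_id.prodMk
    ((en.measurable_point j).comp hG))).indicator (hG (en.measurableSet_active j))

variable {σ : Measure X} {Λ : Set X}

theorem lintegral_nPointMeasure [IsFiniteMeasure (σ.restrict Λ)] (n : ℕ) {F : Config X → ℝ≥0∞}
    (hF : Measurable F) : ∫⁻ ζ, F ζ ∂(nPointMeasure σ Λ n) =
      ∫⁻ x in {x : Fin n → X | Function.Injective x}, F (rangeConfig x)
        ∂(Measure.pi fun _ => σ.restrict Λ) :=
  lintegral_map hF (measurable_rangeConfig n)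

/-- The one-step identity behind Mecke's formula: marking one of `n + 1` independent points amounts
to adding a point to `n` independent points. -/
theorem lintegral_nPointMeasure_succ [NullSingletonClass σ] [IsFiniteMeasure (σ.restrict Λ)] (n : ℕ)
    {H : Config X × X → ℝ≥0∞} (hH : Measurable H) :
    ∫⁻ ζ, ∫⁻ x, H (ζ, x) ∂(pointMeasure ζ) ∂(nPointMeasure σ Λ (n + 1)) =
      (n + 1 : ℕ) * ∫⁻ ζ, ∫⁻ x in Λ, H (ζ.addPoint x, x) ∂σ ∂(nPointMeasure σ Λ n) := by
  have hH' : Measurable fun p : Config X × X => H (p.1.addPoint p.2, p.2) :=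
    hH.comp (measurable_addPoint.prodMk measurable_snd)
  have hF₁ : Measurable fun ζ : Config X => ∫⁻ x, H (ζ, x) ∂(pointMeasure ζ) :=
    measurable_lintegral_pointMeasure measurable_id hH
  rw [lintegral_nPointMeasure _ hF₁,
    lintegral_nPointMeasure _ hH'.lintegral_prod_right']
  set ν : Measure X := σ.restrict Λ with hν
  have h1 : ∫⁻ x in {x : Fin (n + 1) → X | Function.Injective x},
      ∫⁻ a, H (rangeConfig x, a) ∂(pointMeasure (rangeConfig x)) ∂(Measure.pi fun _ => ν) =
      ∫⁻ x in {x : Fin (n + 1) → X | Function.Injective x},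
        ∑ j, H (rangeConfig x, x j) ∂(Measure.pi fun _ => ν) :=
    setLIntegral_congr_fun (measurableSet_injective _) fun x hx =>
      lintegral_pointMeasure_rangeConfig hx _
  have hm : ∀ j : Fin (n + 1), Measurable fun x : Fin (n + 1) → X => H (rangeConfig x, x j) :=
    fun j => hH.comp ((measurable_rangeConfig _).prodMk (measurable_pi_apply j))
  rw [h1, lintegral_finsetSum _ fun j _ => hm j]
  have h2 : ∀ j : Fin (n + 1), ∫⁻ x in {x : Fin (n + 1) → X | Function.Injective x},
      H (rangeConfig x, x j) ∂(Measure.pi fun _ => ν) =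
      ∫⁻ y in {y : Fin n → X | Function.Injective y},
        ∫⁻ a, H ((rangeConfig y).addPoint a, a) ∂ν ∂(Measure.pi fun _ => ν) := by
    intro j
    set G : (Fin (n + 1) → X) → ℝ≥0∞ := {x : Fin (n + 1) → X | Function.Injective x}.indicator
      fun x => H (rangeConfig x, x j) with hG
    have hGm : Measurable G := (hm j).indicator (measurableSet_injective _)
    have hmp := (measurePreserving_piFinSuccAbove (fun _ : Fin (n + 1) => ν) j).symm
    rw [← lintegral_indicator (measurableSet_injective _),
      ← lintegral_indicator (measurableSet_injective _), ← hG, ← hmp.lintegral_comp hGm,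
      lintegral_prod_symm' (fun p => G ((MeasurableEquiv.piFinSuccAbove (fun _ => X) j).symm p))
        (hGm.comp (MeasurableEquiv.measurable _))]
    refine lintegral_congr fun y => ?_
    have h3 : ∀ᵐ a ∂ν, G ((MeasurableEquiv.piFinSuccAbove (fun _ => X) j).symm (a, y)) =
        {y : Fin n → X | Function.Injective y}.indicator
          (fun y => H ((rangeConfig y).addPoint a, a)) y := by
      filter_upwards [ae_notMem_carrier ν (rangeConfig y)] with a ha
      change G (j.insertNth (α := fun _ => X) a y) = _
      by_cases hy : Function.Injective y
      · rw [hG, indicator_of_mem ((injective_insertNth_iff j ha).2 hy), indicator_of_mem hy,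
          rangeConfig_insertNth, Fin.insertNth_apply_same]
      · rw [hG, indicator_of_notMem (fun h => hy ((injective_insertNth_iff j ha).1 h)),
          indicator_of_notMem hy]
    rw [lintegral_congr_ae h3]
    by_cases hy : Function.Injective y
    · have hy' : y ∈ {y : Fin n → X | Function.Injective y} := hy
      simp only [indicator_of_mem hy']
    · have hy' : y ∉ {y : Fin n → X | Function.Injective y} := hy
      simp only [indicator_of_notMem hy', lintegral_zero]
  simp_rw [h2]
  rw [Finset.sum_const, Finset.card_univ, Fintype.card_fin, nsmul_eq_mul]

/-- Mecke's identity for a Poisson measure, in a relatively compact open window. -/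
theorem IsPoissonMeasure.lintegral_mecke [NullSingletonClass σ] [IsFiniteMeasure (σ.restrict Λ)]
    {P : Measure (Config X)} (hP : IsPoissonMeasure σ P) (hΛ : IsOpen Λ)
    (hΛc : IsCompact (closure Λ)) {H : Config X × X → ℝ≥0∞} (hH : Measurable H) :
    ∫⁻ η, ∫⁻ x, H (η.restr Λ, x) ∂(pointMeasure (η.restr Λ)) ∂P =
      ∫⁻ η, ∫⁻ x in Λ, H ((η.restr Λ).addPoint x, x) ∂σ ∂P := by
  have hH' : Measurable fun p : Config X × X => H (p.1.addPoint p.2, p.2) :=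
    hH.comp (measurable_addPoint.prodMk measurable_snd)
  have hF₁ : Measurable fun ζ : Config X => ∫⁻ x, H (ζ, x) ∂(pointMeasure ζ) :=
    measurable_lintegral_pointMeasure measurable_id hH
  have hF₂ : Measurable fun ζ : Config X => ∫⁻ x in Λ, H (ζ.addPoint x, x) ∂σ :=
    hH'.lintegral_prod_right'
  have hr := measurable_restr hΛ.measurableSet
  rw [← lintegral_map hF₁ hr, ← lintegral_map hF₂ hr, hP.2 Λ hΛ hΛc, lintegral_smul_measure,
    lintegral_smul_measure, lintegral_sum_measure, lintegral_sum_measure]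
  congr 1
  simp_rw [lintegral_smul_measure]
  rw [tsum_eq_zero_add' ENNReal.summable]
  have h0 : ∫⁻ ζ, ∫⁻ x, H (ζ, x) ∂(pointMeasure ζ) ∂(nPointMeasure σ Λ 0) = 0 := by
    rw [lintegral_nPointMeasure _ hF₁]
    have : ∀ x : Fin 0 → X, ∫⁻ a, H (rangeConfig x, a) ∂(pointMeasure (rangeConfig x)) = 0 :=
      fun x => by
        rw [lintegral_pointMeasure_rangeConfig (Function.injective_of_subsingleton x)]
        simp
    simp only [this, lintegral_zero]
  rw [h0, smul_zero, zero_add]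
  refine tsum_congr fun n => ?_
  rw [lintegral_nPointMeasure_succ n hH, smul_eq_mul, smul_eq_mul, ← mul_assoc]
  congr 1
  rw [Nat.factorial_succ, Nat.cast_mul, ENNReal.mul_inv (by simp) (by simp), mul_right_comm,
    ENNReal.inv_mul_cancel (by simp) (by simp), one_mul]

end Mecke

/-! ### The Georgii-Nguyen-Zessin identity -/

section GNZ

theorem glue_restr {X : Type*} [TopologicalSpace X] (Λ : Set X) (γ η : Config X) :
    glue Λ γ (η.restr Λ) = glue Λ γ η := by
  refine Config.ext ?_
  change γ.carrier ∩ Λᶜ ∪ η.carrier ∩ Λ ∩ Λ = γ.carrier ∩ Λᶜ ∪ η.carrier ∩ Λ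
  rw [inter_assoc, inter_self]

theorem restr_glue {X : Type*} [TopologicalSpace X] (Λ : Set X) (γ η : Config X) :
    (glue Λ γ η).restr Λ = η.restr Λ := by
  refine Config.ext ?_
  change (γ.carrier ∩ Λᶜ ∪ η.carrier ∩ Λ) ∩ Λ = η.carrier ∩ Λ
  rw [union_inter_distrib_right, inter_assoc, inter_assoc, inter_self, compl_inter_self,
    inter_empty, empty_union]

theorem glue_addPoint {X : Type*} [TopologicalSpace X] {Λ : Set X} (γ η : Config X) {x : X}
    (hx : x ∈ Λ) : glue Λ γ (η.addPoint x) = (glue Λ γ η).addPoint x := by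
  refine Config.ext ?_
  change γ.carrier ∩ Λᶜ ∪ (η.carrier ∪ {x}) ∩ Λ = γ.carrier ∩ Λᶜ ∪ η.carrier ∩ Λ ∪ {x}
  rw [union_inter_distrib_right, inter_eq_left.2 (singleton_subset_iff.2 hx), union_assoc]

variable {X : Type*} [TopologicalSpace X] [MeasurableSpace X]

theorem pointMeasure_restrict [MeasurableSingletonClass X] {Λ : Set X} (hΛ : MeasurableSet Λ)
    (γ : Config X) : (pointMeasure γ).restrict Λ = pointMeasure (γ.restr Λ) := by
  ext B hB
  rw [Measure.restrict_apply hB, pointMeasure_apply γ (hB.inter hΛ), pointMeasure_apply _ hB,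
    Config.count, Config.count, inter_comm B, ← inter_assoc]
  rfl

variable {σ : Measure X} {Φ : Config X → EReal} {μ : Measure (Config X)}

/-- If no Poisson measure with intensity `σ` existed, the kernels would vanish; so a Gibbs measure
can only exist if a Poisson measure does. -/
theorem IsGrandCanonicalGibbs.isPoissonMeasure (hμ : IsGrandCanonicalGibbs σ Φ μ) :
    IsPoissonMeasure σ (poissonMeasure σ) := by
  by_cases h : ∃ P, IsPoissonMeasure σ P
  · rw [poissonMeasure, dif_pos h]
    exact h.choose_spec
  · have h0 : poissonMeasure σ = 0 := by rw [poissonMeasure, dif_neg h]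
    have h1 := hμ.dlr ∅ isOpen_empty (by simp) univ MeasurableSet.univ
    have := hμ.isProbabilityMeasure
    have h2 : ∀ γ, gibbsKernel σ Φ ∅ γ univ = 0 := fun γ => by
      rw [gibbsKernel, h0]
      simp
    simp only [h2, lintegral_zero, measure_univ] at h1
    exact absurd h1 (by simp)

variable [T2Space X] [SecondCountableTopology X] [BorelSpace X] [LocallyCompactSpace X]
  [Nonempty X]

theorem IsPotential.measurable_boltzmann_glue (hΦ : IsPotential Φ) {Λ : Set X}
    (hΛ : MeasurableSet Λ) :
    Measurable fun p : Config X × Config X => boltzmann Φ Λ (glue Λ p.1 p.2) :=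
  hΦ.measurable_boltzmann (measurable_glue hΛ) (measurable_snd hΛ)

theorem IsPotential.measurable_boltzmann_addPoint (hΦ : IsPotential Φ) :
    Measurable fun p : Config X × X => boltzmann Φ {p.2} (p.1.addPoint p.2) :=
  hΦ.measurable_boltzmann (D := fun p => {p.2}) measurable_addPoint
    (measurableSet_eq_fun measurable_snd (measurable_snd.comp measurable_fst))

open Classical in
/-- The Dobrushin-Lanford-Ruelle equations, tested with nonnegative functions. -/
theorem IsGrandCanonicalGibbs.lintegral_dlr (hμ : IsGrandCanonicalGibbs σ Φ μ)
    (hΦ : IsPotential Φ) {Λ : Set X} (hΛ : IsOpen Λ) (hΛc : IsCompact (closure Λ))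
    {f : Config X → ℝ≥0∞} (hf : Measurable f) :
    ∫⁻ γ, (if partitionFn σ Φ Λ γ < ⊤ then (partitionFn σ Φ Λ γ)⁻¹ else 0) *
      ∫⁻ η, f (glue Λ γ η) * boltzmann Φ Λ (glue Λ γ η) ∂(poissonMeasure σ) ∂μ = ∫⁻ γ, f γ ∂μ := by
  have := hμ.isProbabilityMeasure
  have := hμ.isPoissonMeasure.1
  set P := poissonMeasure σ
  set w : Config X → ℝ≥0∞ := fun γ =>
    if partitionFn σ Φ Λ γ < ⊤ then (partitionFn σ Φ Λ γ)⁻¹ else 0 with hw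
  have hb := hΦ.measurable_boltzmann_glue hΛ.measurableSet
  have hg := measurable_glue hΛ.measurableSet
  have hZ : Measurable (partitionFn σ Φ Λ) := hb.lintegral_prod_right'
  have hwm : Measurable w := Measurable.ite (hZ measurableSet_Iio) hZ.inv measurable_const
  have hD : Measurable fun p : Config X × Config X => w p.1 * boltzmann Φ Λ (glue Λ p.1 p.2) :=
    (hwm.comp measurable_fst).mul hb
  set ν : Measure (Config X) := ((μ.prod P).withDensity fun p =>
    w p.1 * boltzmann Φ Λ (glue Λ p.1 p.2)).map fun p => glue Λ p.1 p.2 with hν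
  have key : ∀ {f : Config X → ℝ≥0∞}, Measurable f → ∫⁻ γ, f γ ∂ν =
      ∫⁻ γ, w γ * ∫⁻ η, f (glue Λ γ η) * boltzmann Φ Λ (glue Λ γ η) ∂P ∂μ := by
    intro f hf
    have hfg : Measurable fun p : Config X × Config X => f (glue Λ p.1 p.2) := hf.comp hg
    rw [hν, lintegral_map hf hg, lintegral_withDensity_eq_lintegral_mul _ hD hfg,
      lintegral_prod _ (hD.mul hfg).aemeasurable]
    refine lintegral_congr fun γ => ?_
    have hm : Measurable fun η => f (glue Λ γ η) * boltzmann Φ Λ (glue Λ γ η) :=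
      (hfg.mul hb).comp measurable_prodMk_left
    rw [← lintegral_const_mul _ hm]
    refine lintegral_congr fun η => ?_
    simp only [Pi.mul_apply]
    ring
  have hνμ : ν = μ := by
    ext Δ hΔ
    rw [← hμ.dlr Λ hΛ hΛc Δ hΔ, ← lintegral_indicator_one hΔ, key (measurable_one.indicator hΔ)]
    refine lintegral_congr fun γ => ?_
    change (if partitionFn σ Φ Λ γ < ⊤ then (partitionFn σ Φ Λ γ)⁻¹ else 0) * _ = _
    rw [gibbsKernel]
    split_ifs with h
    · rfl
    · rw [zero_mul]
  rw [← key hf, hνμ]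

/-- The Georgii-Nguyen-Zessin identity for a fixed boundary condition `γ` outside of `Λ`. -/
theorem IsGrandCanonicalGibbs.lintegral_gnz_glue [NullSingletonClass σ]
    (hμ : IsGrandCanonicalGibbs σ Φ μ) (hΦ : IsPotential Φ) {Λ : Set X} (hΛ : IsOpen Λ)
    (hΛc : IsCompact (closure Λ)) [IsFiniteMeasure (σ.restrict Λ)] {h : Config X × X → ℝ≥0∞}
    (hh : Measurable h) (γ : Config X) :
    ∫⁻ η, (∫⁻ x in Λ, h (glue Λ γ η, x) ∂(pointMeasure (glue Λ γ η))) *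
        boltzmann Φ Λ (glue Λ γ η) ∂(poissonMeasure σ) =
      ∫⁻ η, (∫⁻ x in Λ, h ((glue Λ γ η).addPoint x, x) *
        boltzmann Φ {x} ((glue Λ γ η).addPoint x) ∂σ) *
          boltzmann Φ Λ (glue Λ γ η) ∂(poissonMeasure σ) := by
  have hg := measurable_glue hΛ.measurableSet
  have hadd : Measurable fun p : Config X × X => (p.1.addPoint p.2, p.2) :=
    measurable_addPoint.prodMk measurable_snd
  have hk : Measurable fun p : Config X × X =>
      h (p.1.addPoint p.2, p.2) * boltzmann Φ {p.2} (p.1.addPoint p.2) :=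
    (hh.comp hadd).mul hΦ.measurable_boltzmann_addPoint
  have hgγ : Measurable fun p : Config X × X => glue Λ γ p.1 :=
    hg.comp ((measurable_const (a := γ)).prodMk measurable_fst)
  have hHm : Measurable fun p : Config X × X =>
      h (glue Λ γ p.1, p.2) * boltzmann Φ Λ (glue Λ γ p.1) :=
    (hh.comp (hgγ.prodMk measurable_snd)).mul
      (hΦ.measurable_boltzmann (D := fun _ => Λ) hgγ (measurable_snd hΛ.measurableSet))
  have e := hμ.isPoissonMeasure.lintegral_mecke hΛ hΛc hHm
  have e1 : ∀ η : Config X, ∫⁻ x, h (glue Λ γ (η.restr Λ), x) *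
      boltzmann Φ Λ (glue Λ γ (η.restr Λ)) ∂(pointMeasure (η.restr Λ)) =
      (∫⁻ x in Λ, h (glue Λ γ η, x) ∂(pointMeasure (glue Λ γ η))) *
        boltzmann Φ Λ (glue Λ γ η) := by
    intro η
    have hm : Measurable fun x => h (glue Λ γ η, x) := hh.comp measurable_prodMk_left
    rw [pointMeasure_restrict hΛ.measurableSet, restr_glue, ← lintegral_mul_const _ hm]
    refine lintegral_congr fun x => ?_
    rw [glue_restr]
  have e2 : ∀ η : Config X, ∫⁻ x in Λ, h (glue Λ γ ((η.restr Λ).addPoint x), x) *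
      boltzmann Φ Λ (glue Λ γ ((η.restr Λ).addPoint x)) ∂σ =
      (∫⁻ x in Λ, h ((glue Λ γ η).addPoint x, x) *
        boltzmann Φ {x} ((glue Λ γ η).addPoint x) ∂σ) * boltzmann Φ Λ (glue Λ γ η) := by
    intro η
    have hm : Measurable fun x => h ((glue Λ γ η).addPoint x, x) *
        boltzmann Φ {x} ((glue Λ γ η).addPoint x) :=
      hk.comp (measurable_prodMk_left (x := glue Λ γ η))
    rw [← lintegral_mul_const _ hm]
    refine lintegral_congr_ae ?_
    filter_upwards [ae_restrict_mem hΛ.measurableSet,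
      ae_restrict_of_ae (ae_notMem_carrier σ (glue Λ γ η))] with x hx hxη
    rw [glue_addPoint _ _ hx, glue_restr, boltzmann_addPoint hx hxη, mul_assoc]
    congr 1
    exact mul_comm _ _
  simp_rw [e1, e2] at e
  exact e

/-- The Georgii-Nguyen-Zessin identity in a relatively compact open window `Λ`. It follows from
Mecke's identity for the Poisson measure in the kernel of `Λ`, as adding a point `x ∈ Λ` to the
configuration multiplies the Boltzmann factor of `Λ` by that of `{x}`. -/
theorem IsGrandCanonicalGibbs.lintegral_gnz [NullSingletonClass σ]
    (hμ : IsGrandCanonicalGibbs σ Φ μ) (hΦ : IsPotential Φ) {Λ : Set X} (hΛ : IsOpen Λ)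
    (hΛc : IsCompact (closure Λ)) [IsFiniteMeasure (σ.restrict Λ)] {h : Config X × X → ℝ≥0∞}
    (hh : Measurable h) :
    ∫⁻ γ, ∫⁻ x in Λ, h (γ, x) ∂(pointMeasure γ) ∂μ =
      ∫⁻ γ, ∫⁻ x in Λ, h (γ.addPoint x, x) * boltzmann Φ {x} (γ.addPoint x) ∂σ ∂μ := by
  have hadd : Measurable fun p : Config X × X => (p.1.addPoint p.2, p.2) :=
    measurable_addPoint.prodMk measurable_snd
  have hk : Measurable fun p : Config X × X =>
      h (p.1.addPoint p.2, p.2) * boltzmann Φ {p.2} (p.1.addPoint p.2) :=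
    (hh.comp hadd).mul hΦ.measurable_boltzmann_addPoint
  have hF₁ : Measurable fun γ : Config X => ∫⁻ x in Λ, h (γ, x) ∂(pointMeasure γ) := by
    simp_rw [pointMeasure_restrict hΛ.measurableSet]
    exact measurable_lintegral_pointMeasure (measurable_restr hΛ.measurableSet) hh
  have hF₂ : Measurable fun γ : Config X =>
      ∫⁻ x in Λ, h (γ.addPoint x, x) * boltzmann Φ {x} (γ.addPoint x) ∂σ :=
    hk.lintegral_prod_right'
  rw [← hμ.lintegral_dlr hΦ hΛ hΛc hF₁, ← hμ.lintegral_dlr hΦ hΛ hΛc hF₂]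
  exact lintegral_congr fun γ => congrArg _ (hμ.lintegral_gnz_glue hΦ hΛ hΛc hh γ)

end GNZ

/-! ### Cylinder functions -/

section Cylinder

variable {d : ℕ} {X : Type*} [TopologicalSpace X] [ChartedSpace (Euc d) X]

/-- The function `x ↦ F(γ ∪ {x})` of one additional point `x ∉ γ`, extended smoothly to all of
`X`. -/
noncomputable def CylinderRep.shift (c : CylinderRep d X) (γ : Config X) (x : X) : ℝ :=
  c.g fun i => Config.pairing (c.f i) γ + c.f i x

theorem CylinderRep.contMDiff_shift (c : CylinderRep d X) (γ : Config X) :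
    ContMDiff (𝓡 d) 𝓘(ℝ, ℝ) ∞ (c.shift γ) := by
  refine (c.contDiff_g.contMDiff (n := ∞)).comp (I' := 𝓘(ℝ, Fin c.N → ℝ)) ?_
  exact contMDiff_pi_space.2 fun i => contMDiff_const.add (c.contMDiff_f i)

theorem pairing_addPoint {f : X → ℝ} (hf : HasCompactSupport f) (γ : Config X) {x : X}
    (hx : x ∉ γ.carrier) :
    Config.pairing f (γ.addPoint x) = Config.pairing f γ + f x := by
  have h : (γ.addPoint x).carrier = insert x γ.carrier := union_singleton
  rw [Config.pairing, h, finsum_mem_insert' f hx, add_comm]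
  · rfl
  · exact (γ.locallyFinite _ hf).subset (inter_subset_inter_right _ (subset_tsupport f))

theorem CylinderRep.toFun_addPoint (c : CylinderRep d X) (γ : Config X) {x : X}
    (hx : x ∉ γ.carrier) : c.toFun (γ.addPoint x) = c.shift γ x :=
  congrArg c.g (funext fun i => pairing_addPoint (c.hasCompactSupport_f i) γ hx)

theorem restr_compl_addPoint {γ : Config X} {x : X} (hx : x ∈ γ.carrier) :
    (γ.restr {x}ᶜ).addPoint x = γ := by
  refine Config.ext ?_
  change γ.carrier ∩ {x}ᶜ ∪ {x} = γ.carrier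
  rw [← sdiff_eq, sdiff_union_self, union_eq_left.2 (singleton_subset_iff.2 hx)]

theorem addPoint_restr_compl {γ : Config X} {x : X} (hx : x ∉ γ.carrier) :
    (γ.addPoint x).restr {x}ᶜ = γ := by
  refine Config.ext ?_
  change (γ.carrier ∪ {x}) ∩ {x}ᶜ = γ.carrier
  rw [union_inter_distrib_right, inter_compl_self, union_empty, inter_eq_left]
  exact fun y hy hyx => hx (hyx ▸ hy)

theorem Config.eventually_notMem [T2Space X] [LocallyCompactSpace X] (γ : Config X) {x : X}
    (hx : x ∉ γ.carrier) : ∀ᶠ y in 𝓝 x, y ∉ γ.carrier := by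
  obtain ⟨K, hK, hKx⟩ := exists_compact_mem_nhds x
  have hT : (γ.carrier ∩ K)ᶜ ∈ 𝓝 x :=
    (γ.locallyFinite K hK).isClosed.isOpen_compl.mem_nhds fun h => hx h.1
  filter_upwards [hKx, hT] with y hyK hyT hy
  exact hyT ⟨hy, hyK⟩

section Sub

/-- The representation of the difference of two cylinder functions. -/
def CylinderRep.sub (c c' : CylinderRep d X) : CylinderRep d X where
  N := c.N + c'.N
  g := fun v => c.g (fun i => v (Fin.castAdd c'.N i)) - c'.g fun i => v (Fin.natAdd c.N i)
  f := Fin.append c.f c'.f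
  contDiff_g := by
    refine (c.contDiff_g.comp ?_).sub (c'.contDiff_g.comp ?_) <;>
      exact contDiff_pi.2 fun i => contDiff_apply _ _ _
  bounded_g := by
    intro k
    have key : ∀ {N M : ℕ} (φ : Fin N → Fin M) (g : (Fin N → ℝ) → ℝ), ContDiff ℝ ∞ g →
        (∃ C : ℝ, ∀ v, ‖iteratedFDeriv ℝ k g v‖ ≤ C) →
        ContDiff ℝ ∞ (fun v : Fin M → ℝ => g fun i => v (φ i)) ∧
        ∃ C : ℝ, ∀ v, ‖iteratedFDeriv ℝ k (fun v : Fin M → ℝ => g fun i => v (φ i)) v‖ ≤ C := by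
      intro N M φ g hg ⟨C, hC⟩
      let L : (Fin M → ℝ) →L[ℝ] (Fin N → ℝ) :=
        ContinuousLinearMap.pi fun i => ContinuousLinearMap.proj (φ i)
      refine ⟨hg.comp L.contDiff, C * ∏ _i : Fin k, ‖L‖, fun v => ?_⟩
      have h := L.iteratedFDeriv_comp_right hg v (i := k) (by exact_mod_cast le_top)
      change ‖iteratedFDeriv ℝ k (g ∘ L) v‖ ≤ _
      rw [h]
      refine (ContinuousMultilinearMap.norm_compContinuousLinearMap_le _ _).trans ?_
      gcongr
      exact hC _
    obtain ⟨h1, C₁, hC₁⟩ := key (Fin.castAdd c'.N) c.g c.contDiff_g (c.bounded_g k)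
    obtain ⟨h2, C₂, hC₂⟩ := key (Fin.natAdd c.N) c'.g c'.contDiff_g (c'.bounded_g k)
    refine ⟨C₁ + C₂, fun v => ?_⟩
    have hk : (k : WithTop ℕ∞) ≤ ((⊤ : ℕ∞) : WithTop ℕ∞) := by exact_mod_cast le_top
    rw [fun_iteratedFDeriv_sub_apply (h1.of_le hk).contDiffAt (h2.of_le hk).contDiffAt]
    exact (norm_sub_le _ _).trans (add_le_add (hC₁ v) (hC₂ v))
  contMDiff_f := Fin.addCases
    (fun i => by simpa only [Fin.append_left] using c.contMDiff_f i)
    (fun i => by simpa only [Fin.append_right] using c'.contMDiff_f i)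
  hasCompactSupport_f := Fin.addCases
    (fun i => by simpa only [Fin.append_left] using c.hasCompactSupport_f i)
    (fun i => by simpa only [Fin.append_right] using c'.hasCompactSupport_f i)

theorem CylinderRep.toFun_sub (c c' : CylinderRep d X) :
    (c.sub c').toFun = c.toFun - c'.toFun := by
  ext γ
  simp only [CylinderRep.toFun, CylinderRep.sub, Fin.append_left, Fin.append_right, Pi.sub_apply]

theorem CylinderRep.shift_sub (c c' : CylinderRep d X) (γ : Config X) :
    (c.sub c').shift γ = c.shift γ - c'.shift γ := by
  ext x
  simp only [CylinderRep.shift, CylinderRep.sub, Fin.append_left, Fin.append_right, Pi.sub_apply]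

end Sub

variable [T2Space X] [RiemannianBundle (fun x : X => TangentSpace (𝓡 d) x)]

theorem CylinderRep.grad_addPoint (c : CylinderRep d X) (γ : Config X) {x : X}
    (hx : x ∉ γ.carrier) : c.grad (γ.addPoint x) x = riemGrad d (c.shift γ) x := by
  have : LocallyCompactSpace X := ChartedSpace.locallyCompactSpace (Euc d) X
  rw [c.grad_eq_riemGrad (γ.addPoint x) (mem_union_right _ rfl), addPoint_restr_compl hx, riemGrad,
    riemGrad]
  have h : (fun y => c.toFun (γ.addPoint y)) =ᶠ[𝓝 x] c.shift γ := by
    filter_upwards [γ.eventually_notMem hx] with y hy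
    exact c.toFun_addPoint γ hy
  rw [h.mfderiv_eq]

theorem CylinderRep.grad_sub (c c' : CylinderRep d X) (γ : Config X) {x : X}
    (hx : x ∈ γ.carrier) : (c.sub c').grad γ x = c.grad γ x - c'.grad γ x := by
  have hx' : x ∉ (γ.restr {x}ᶜ).carrier := fun h => h.2 rfl
  rw [← restr_compl_addPoint hx, CylinderRep.grad_addPoint _ _ hx',
    CylinderRep.grad_addPoint _ _ hx', CylinderRep.grad_addPoint _ _ hx', c.shift_sub c']
  exact riemGrad_sub ((c.contMDiff_shift _).contMDiffAt.mdifferentiableAt (by simp))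
    ((c'.contMDiff_shift _).contMDiffAt.mdifferentiableAt (by simp))

end Cylinder

/-! ### Gradients of cylinder functions: measurability and integrability -/

section CarrierSums

variable {X : Type*} [TopologicalSpace X]

theorem finsum_carrier_eq_sum (γ : Config X) {K : Set X} (hK : IsCompact K) {h : X → ℝ}
    (hh : ∀ x ∉ K, h x = 0) :
    ∑ᶠ x ∈ γ.carrier, h x = ∑ x ∈ (γ.locallyFinite K hK).toFinset, h x := by
  refine finsum_mem_eq_sum_of_inter_support_eq _ ?_
  ext x
  simp only [Finite.coe_toFinset, mem_inter_iff, Function.mem_support]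
  exact ⟨fun hx => ⟨⟨hx.1, by_contra fun h => hx.2 (hh x h)⟩, hx.2⟩, fun hx => ⟨hx.1.1, hx.2⟩⟩

variable [MeasurableSpace X]

theorem lintegral_pointMeasure_eq_sum [MeasurableSingletonClass X] (γ : Config X) {K : Set X}
    (hK : IsCompact K) {h : X → ℝ≥0∞} (hh : ∀ x ∉ K, h x = 0) :
    ∫⁻ x, h x ∂(pointMeasure γ) = ∑ x ∈ (γ.locallyFinite K hK).toFinset, h x := by
  rw [lintegral_pointMeasure, tsum_subtype γ.carrier h,
    tsum_eq_sum (s := (γ.locallyFinite K hK).toFinset)]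
  · refine Finset.sum_congr rfl fun x hx => indicator_of_mem ?_ _
    exact ((Finite.mem_toFinset _).1 hx).1
  · intro x hx
    by_cases h1 : x ∈ γ.carrier
    · rw [indicator_of_mem h1]
      exact hh x fun h2 => hx ((Finite.mem_toFinset _).2 ⟨h1, h2⟩)
    · exact indicator_of_notMem h1 _

variable [T2Space X] [SecondCountableTopology X] [BorelSpace X] [LocallyCompactSpace X]
  [Nonempty X]

theorem measurable_finsum_carrier {k : Config X × X → ℝ} (hk : Measurable k) {K : Set X}
    (hK : IsCompact K) (hh : ∀ γ, ∀ x ∉ K, k (γ, x) = 0) :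
    Measurable fun γ : Config X => ∑ᶠ x ∈ γ.carrier, k (γ, x) := by
  have h : ∀ γ : Config X, ∑ᶠ x ∈ γ.carrier, k (γ, x) =
      (∫⁻ x, ENNReal.ofReal (k (γ, x)) ∂(pointMeasure γ)).toReal -
        (∫⁻ x, ENNReal.ofReal (-k (γ, x)) ∂(pointMeasure γ)).toReal := by
    intro γ
    rw [finsum_carrier_eq_sum γ hK (hh γ), lintegral_pointMeasure_eq_sum γ hK fun x hx => by
      rw [hh γ x hx, ENNReal.ofReal_zero], lintegral_pointMeasure_eq_sum γ hK fun x hx => by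
      rw [hh γ x hx, neg_zero, ENNReal.ofReal_zero], ENNReal.toReal_sum (by simp),
      ENNReal.toReal_sum (by simp), ← Finset.sum_sub_distrib]
    refine Finset.sum_congr rfl fun x _ => ?_
    rw [ENNReal.toReal_ofReal', ENNReal.toReal_ofReal', max_zero_sub_max_neg_zero_eq_self]
  simp_rw [h]
  have h1 : Measurable fun γ : Config X => ∫⁻ x, ENNReal.ofReal (k (γ, x)) ∂(pointMeasure γ) :=
    measurable_lintegral_pointMeasure measurable_id hk.ennreal_ofReal
  have h2 : Measurable fun γ : Config X => ∫⁻ x, ENNReal.ofReal (-k (γ, x)) ∂(pointMeasure γ) :=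
    measurable_lintegral_pointMeasure measurable_id hk.neg.ennreal_ofReal
  exact h1.ennreal_toReal.sub h2.ennreal_toReal

theorem measurable_pairing {f : X → ℝ} (hf : Measurable f) (hfc : HasCompactSupport f) :
    Measurable (Config.pairing f) :=
  measurable_finsum_carrier (k := fun p => f p.2) (hf.comp measurable_snd) hfc
    fun _ _ hx => image_eq_zero_of_notMem_tsupport hx

end CarrierSums

section Gradient

variable {d : ℕ} {X : Type*} [TopologicalSpace X] [ChartedSpace (Euc d) X]

/-- A compact set outside of which the gradient of the cylinder function vanishes. -/
def CylinderRep.supp (c : CylinderRep d X) : Set X := ⋃ i, tsupport (c.f i)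

theorem CylinderRep.isCompact_supp (c : CylinderRep d X) : IsCompact c.supp :=
  isCompact_iUnion fun i => c.hasCompactSupport_f i

theorem CylinderRep.measurable_pairing [T2Space X] [SecondCountableTopology X]
    [MeasurableSpace X] [BorelSpace X] [Nonempty X] (c : CylinderRep d X) :
    Measurable fun γ i => Config.pairing (c.f i) γ := by
  have : LocallyCompactSpace X := ChartedSpace.locallyCompactSpace (Euc d) X
  exact measurable_pi_iff.2 fun i =>
    ConfigSpace.measurable_pairing (c.contMDiff_f i).continuous.measurable (c.hasCompactSupport_f i)

theorem CylinderRep.measurable_toFun [T2Space X] [SecondCountableTopology X]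
    [MeasurableSpace X] [BorelSpace X] [Nonempty X] (c : CylinderRep d X) : Measurable c.toFun :=
  c.contDiff_g.continuous.measurable.comp c.measurable_pairing

variable [RiemannianBundle (fun x : X => TangentSpace (𝓡 d) x)]

theorem riemGrad_of_notMem_tsupport {f : X → ℝ} {x : X} (hx : x ∉ tsupport f) :
    riemGrad d f x = 0 := by
  refine ext_inner_right ℝ fun v => ?_
  have h : f =ᶠ[𝓝 x] fun _ => 0 := notMem_tsupport_iff_eventuallyEq.1 hx
  rw [inner_riemGrad, h.mfderiv_eq, mfderiv_const, inner_zero_left]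
  rfl

theorem CylinderRep.grad_of_notMem_supp (c : CylinderRep d X) (γ : Config X) {x : X}
    (hx : x ∉ c.supp) : c.grad γ x = 0 := by
  rw [CylinderRep.grad]
  refine Finset.sum_eq_zero fun i _ => ?_
  rw [riemGrad_of_notMem_tsupport fun h => hx (mem_iUnion.2 ⟨i, h⟩), smul_zero]

theorem CylinderRep.tangentInner_gradGamma [T2Space X] (c c' : CylinderRep d X) (γ : Config X) :
    tangentInner d γ (gradGamma d c.toFun γ) (gradGamma d c'.toFun γ) =
      ∑ᶠ x ∈ γ.carrier, inner ℝ (c.grad γ x) (c'.grad γ x) :=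
  finsum_mem_congr rfl fun x hx => by rw [gradGamma_toFun c γ hx, gradGamma_toFun c' γ hx]

variable [IsManifold (𝓡 d) ∞ X]
  [IsContMDiffRiemannianBundle (𝓡 d) ∞ (Euc d) (fun x : X => TangentSpace (𝓡 d) x)]

theorem CylinderRep.exists_norm_grad_le [T2Space X] (c : CylinderRep d X) :
    ∃ C : ℝ, 0 ≤ C ∧ ∀ γ x, ‖c.grad γ x‖ ≤ C := by
  obtain ⟨C₁, hC₁⟩ := c.bounded_g 1
  have h1 : ∀ i, ∃ C, ∀ x, ‖riemGrad d (c.f i) x‖ ≤ C := by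
    intro i
    have hc : HasCompactSupport fun x => ‖riemGrad d (c.f i) x‖ :=
      HasCompactSupport.intro (c.hasCompactSupport_f i) fun x hx => by
        rw [riemGrad_of_notMem_tsupport hx, norm_zero]
    obtain ⟨C, hC⟩ := hc.exists_bound_of_continuous (continuous_norm_riemGrad (c.contMDiff_f i))
    exact ⟨C, fun x => by simpa using hC x⟩
  choose C₂ hC₂ using h1
  have hC₁0 : 0 ≤ C₁ := (norm_nonneg _).trans (hC₁ 0)
  have hle : ∀ γ x, ‖c.grad γ x‖ ≤ ∑ i, C₁ * ‖(Pi.single i 1 : Fin c.N → ℝ)‖ * C₂ i := by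
    intro γ x
    refine (norm_sum_le _ _).trans (Finset.sum_le_sum fun i _ => ?_)
    rw [norm_smul]
    refine mul_le_mul ?_ (hC₂ i x) (norm_nonneg _) (by positivity)
    refine (ContinuousLinearMap.le_opNorm _ _).trans ?_
    gcongr
    rw [← norm_iteratedFDeriv_one]
    exact hC₁ _
  exact ⟨max 0 _, le_max_left _ _, fun γ x => (hle γ x).trans (le_max_right _ _)⟩

variable [T2Space X] [SecondCountableTopology X] [MeasurableSpace X] [BorelSpace X] [Nonempty X]

theorem CylinderRep.measurable_inner_grad (c c' : CylinderRep d X) :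
    Measurable fun p : Config X × X => inner ℝ (c.grad p.1 p.2) (c'.grad p.1 p.2) := by
  have h : ∀ p : Config X × X, inner ℝ (c.grad p.1 p.2) (c'.grad p.1 p.2) =
      ∑ i, ∑ j, fderiv ℝ c.g (fun l => Config.pairing (c.f l) p.1) (Pi.single i 1) *
        (fderiv ℝ c'.g (fun l => Config.pairing (c'.f l) p.1) (Pi.single j 1) *
          inner ℝ (riemGrad d (c.f i) p.2) (riemGrad d (c'.f j) p.2)) := by
    intro p
    rw [CylinderRep.grad, CylinderRep.grad, sum_inner]
    refine Finset.sum_congr rfl fun i _ => ?_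
    rw [inner_sum]
    refine Finset.sum_congr rfl fun j _ => ?_
    rw [inner_smul_left, inner_smul_right]
    rfl
  simp_rw [h]
  have hd : ∀ (c : CylinderRep d X) i, Measurable fun p : Config X × X =>
      fderiv ℝ c.g (fun l => Config.pairing (c.f l) p.1) (Pi.single i 1) := fun c i =>
    ((c.contDiff_g.continuous_fderiv (by simp)).clm_apply continuous_const).measurable.comp
      (c.measurable_pairing.comp measurable_fst)
  refine Finset.measurable_fun_sum _ fun i _ => Finset.measurable_fun_sum _ fun j _ => ?_
  exact (hd c i).mul ((hd c' j).mul
    ((continuous_inner_riemGrad (c.contMDiff_f i) (c'.contMDiff_f j)).measurable.comp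
      measurable_snd))

theorem CylinderRep.measurable_norm_grad (c : CylinderRep d X) :
    Measurable fun p : Config X × X => ‖c.grad p.1 p.2‖ := by
  simp_rw [norm_eq_sqrt_real_inner]
  exact (c.measurable_inner_grad c).sqrt

theorem CylinderRep.measurable_norm_grad_sub (c c' : CylinderRep d X) :
    Measurable fun p : Config X × X => ‖c.grad p.1 p.2 - c'.grad p.1 p.2‖ := by
  simp_rw [norm_eq_sqrt_real_inner, inner_sub_sub_self]
  exact ((((c.measurable_inner_grad c).sub (c.measurable_inner_grad c')).sub
    (c'.measurable_inner_grad c)).add (c'.measurable_inner_grad c')).sqrt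

theorem CylinderRep.measurable_enorm_grad_sub (c c' : CylinderRep d X) :
    Measurable (Function.uncurry fun γ x => ‖c.grad γ x - c'.grad γ x‖ₑ ^ 2) := by
  have h : ∀ p : Config X × X, Function.uncurry (fun γ x => ‖c.grad γ x - c'.grad γ x‖ₑ ^ 2) p =
      ENNReal.ofReal ‖c.grad p.1 p.2 - c'.grad p.1 p.2‖ ^ 2 := fun p => by
    rw [ofReal_norm]
    rfl
  rw [funext h]
  exact (c.measurable_norm_grad_sub c').ennreal_ofReal.pow_const 2

theorem CylinderRep.measurable_enorm_grad_sub_right (c c' : CylinderRep d X) (γ : Config X) :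
    Measurable fun x => ‖c.grad γ x - c'.grad γ x‖ₑ ^ 2 :=
  Measurable.of_uncurry_left (f := fun γ x => ‖c.grad γ x - c'.grad γ x‖ₑ ^ 2)
    (c.measurable_enorm_grad_sub c')

theorem CylinderRep.measurable_lintegral_enorm_grad_sub (c c' : CylinderRep d X) :
    Measurable fun γ : Config X => ∫⁻ x, ‖c.grad γ x - c'.grad γ x‖ₑ ^ 2 ∂(pointMeasure γ) :=
  have : LocallyCompactSpace X := ChartedSpace.locallyCompactSpace (Euc d) X
  measurable_lintegral_pointMeasure measurable_id (c.measurable_enorm_grad_sub c')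

theorem CylinderRep.integrable_tangentInner {μ : Measure (Config X)} (hμ : HasRadonMean μ)
    (c c' : CylinderRep d X) : Integrable (fun γ =>
      tangentInner d γ (gradGamma d c.toFun γ) (gradGamma d c'.toFun γ)) μ := by
  have : LocallyCompactSpace X := ChartedSpace.locallyCompactSpace (Euc d) X
  simp_rw [CylinderRep.tangentInner_gradGamma]
  have hz : ∀ γ : Config X, ∀ x ∉ c.supp, inner ℝ (c.grad γ x) (c'.grad γ x) = (0 : ℝ) :=
    fun γ x hx => by rw [c.grad_of_notMem_supp γ hx, inner_zero_left]
  have hm := measurable_finsum_carrier (c.measurable_inner_grad c') c.isCompact_supp hz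
  obtain ⟨C, hC0, hC⟩ := c.exists_norm_grad_le
  obtain ⟨C', -, hC'⟩ := c'.exists_norm_grad_le
  refine ⟨hm.aestronglyMeasurable, ?_⟩
  have hle : ∀ γ : Config X, ‖∑ᶠ x ∈ γ.carrier, inner ℝ (c.grad γ x) (c'.grad γ x)‖ₑ ≤
      ENNReal.ofReal (C * C') * (γ.count c.supp : ℝ≥0∞) := by
    intro γ
    rw [finsum_carrier_eq_sum γ c.isCompact_supp (hz γ)]
    refine (enorm_sum_le _ _).trans ?_
    refine (Finset.sum_le_card_nsmul _ _ (ENNReal.ofReal (C * C')) fun x _ => ?_).trans_eq ?_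
    · rw [← ofReal_norm]
      refine ENNReal.ofReal_le_ofReal ((norm_inner_le_norm _ _).trans ?_)
      exact mul_le_mul (hC γ x) (hC' γ x) (norm_nonneg _) hC0
    · rw [nsmul_eq_mul, mul_comm, Config.count,
        (γ.locallyFinite _ c.isCompact_supp).encard_eq_coe_toFinset_card]
      rfl
  refine (lintegral_mono hle).trans_lt ?_
  rw [lintegral_const_mul']
  · exact ENNReal.mul_lt_top ENNReal.ofReal_lt_top (hμ _ c.isCompact_supp)
  · exact ENNReal.ofReal_ne_top

/-- The value of the form as an integral of nonnegative functions. -/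
theorem CylinderRep.ofReal_dirichletForm {μ : Measure (Config X)} (hμ : HasRadonMean μ)
    (c : CylinderRep d X) : ENNReal.ofReal (dirichletForm d μ c.toFun c.toFun) =
      ∫⁻ γ, ∫⁻ x, ‖c.grad γ x‖ₑ ^ 2 ∂(pointMeasure γ) ∂μ := by
  have hs : ∀ γ : Config X, tangentInner d γ (gradGamma d c.toFun γ) (gradGamma d c.toFun γ) =
      ∑ x ∈ (γ.locallyFinite _ c.isCompact_supp).toFinset, ‖c.grad γ x‖ ^ 2 := by
    intro γ
    rw [c.tangentInner_gradGamma c, finsum_carrier_eq_sum γ c.isCompact_supp fun x hx => by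
      rw [c.grad_of_notMem_supp γ hx, inner_zero_left]]
    exact Finset.sum_congr rfl fun x _ => real_inner_self_eq_norm_sq _
  rw [dirichletForm, ofReal_integral_eq_lintegral_ofReal (c.integrable_tangentInner hμ c)]
  · refine lintegral_congr fun γ => ?_
    rw [hs, ENNReal.ofReal_sum_of_nonneg fun x _ => sq_nonneg _,
      lintegral_pointMeasure_eq_sum γ c.isCompact_supp fun x hx => by
        rw [c.grad_of_notMem_supp γ hx, enorm_zero, zero_pow two_ne_zero]]
    refine Finset.sum_congr rfl fun x _ => ?_
    rw [ENNReal.ofReal_pow (norm_nonneg _), ofReal_norm]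
  · refine ae_of_all _ fun γ => ?_
    exact (Finset.sum_nonneg fun x _ => sq_nonneg _).trans_eq (hs γ).symm

end Gradient

/-! ### The intensity measure -/

section Intensity

theorem isFiniteMeasure_withDensity_restrict {X : Type*} [TopologicalSpace X] [MeasurableSpace X]
    [BorelSpace X] {m : Measure X} {ρ : X → ℝ≥0}
    (hρ : LocallyIntegrable (fun x => (ρ x : ℝ)) m) {Λ : Set X} (hΛ : IsOpen Λ)
    (hΛc : IsCompact (closure Λ)) :
    IsFiniteMeasure ((m.withDensity fun x => (ρ x : ℝ≥0∞)).restrict Λ) := by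
  refine ⟨?_⟩
  rw [Measure.restrict_apply_univ, withDensity_apply _ hΛ.measurableSet]
  have h := ((hρ.integrableOn_isCompact hΛc).mono_set subset_closure).2
  refine (lintegral_mono fun x => ?_).trans_lt h
  simp

variable {d : ℕ} {X : Type*} [TopologicalSpace X] [ChartedSpace (Euc d) X]
  [RiemannianBundle (fun x : X => TangentSpace (𝓡 d) x)] [IsManifold (𝓡 d) ∞ X]
  [MeasurableSpace X] [BorelSpace X] [SecondCountableTopology X] [T2Space X]

theorem riemannianVolume_singleton (hd : 0 < d) (x : X) : riemannianVolume d X {x} = 0 := by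
  set e := chartAt (Euc d) x
  have hx : x ∈ e.source := mem_chart_source _ x
  have h1 : riemannianVolume d X {x} = chartVolume d e {x} := by
    rw [← riemannianVolume_restrict_chart_source x,
      Measure.restrict_apply (measurableSet_singleton x),
      inter_eq_left.2 (singleton_subset_iff.2 hx)]
  rw [h1, chartVolume_apply e (measurableSet_singleton x)]
  refine setLIntegral_measure_zero _ _ ?_
  have : Nonempty (Fin d) := ⟨⟨0, hd⟩⟩
  refine (Set.Subsingleton.measure_zero ?_ _)
  rintro y ⟨hy, hyt⟩ z ⟨hz, hzt⟩
  exact e.symm.injOn hyt hzt (hy.trans hz.symm)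

theorem nullSingletonClass_withDensity (hd : 0 < d) (ρ : X → ℝ≥0∞) :
    NullSingletonClass ((riemannianVolume d X).withDensity ρ) :=
  ⟨fun x => withDensity_absolutelyContinuous _ _ (riemannianVolume_singleton hd x)⟩

end Intensity

section Density

variable {X : Type*} [TopologicalSpace X] [MeasurableSpace X] [BorelSpace X]
  [SecondCountableTopology X] [T2Space X] [LocallyCompactSpace X] [Nonempty X] {ρ : X → ℝ≥0}
  {Φ : Config X → EReal}

theorem IsPotential.measurable_rhoGamma (hΦ : IsPotential Φ)
    (hρ : Measurable ρ) : Measurable fun p : Config X × X => rhoGamma Φ ρ p.1 p.2 :=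
  hΦ.measurable_boltzmann_addPoint.mul (hρ.coe_nnreal_ennreal.comp measurable_snd)

theorem IsPotential.measurable_rhoGamma_right (hΦ : IsPotential Φ) (hρ : Measurable ρ)
    (γ : Config X) : Measurable (rhoGamma Φ ρ γ) :=
  Measurable.of_uncurry_left (f := rhoGamma Φ ρ) (hΦ.measurable_rhoGamma hρ)

theorem IsPotential.setLIntegral_withDensity_boltzmann
    (hΦ : IsPotential Φ) (hρ : Measurable ρ) (m : Measure X) {Λ : Set X} (hΛ : MeasurableSet Λ)
    {h : Config X × X → ℝ≥0∞} (hh : Measurable h) (γ : Config X) :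
    ∫⁻ x in Λ, h (γ.addPoint x, x) * boltzmann Φ {x} (γ.addPoint x)
        ∂(m.withDensity fun x => (ρ x : ℝ≥0∞)) =
      ∫⁻ x in Λ, h (γ.addPoint x, x) * rhoGamma Φ ρ γ x ∂m := by
  have hm : Measurable fun x => h (γ.addPoint x, x) * boltzmann Φ {x} (γ.addPoint x) :=
    ((hh.comp (measurable_addPoint.prodMk measurable_snd)).mul
      hΦ.measurable_boltzmann_addPoint).comp measurable_prodMk_left
  rw [restrict_withDensity hΛ, lintegral_withDensity_eq_lintegral_mul _ hρ.coe_nnreal_ennreal hm]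
  refine lintegral_congr fun x => ?_
  rw [Pi.mul_apply, rhoGamma]
  ring

end Density

/-! ### Null sequences of cylinder functions -/

section NullSequences

variable {d : ℕ} {X : Type*} [TopologicalSpace X] [ChartedSpace (Euc d) X]
  [RiemannianBundle (fun x : X => TangentSpace (𝓡 d) x)] [IsManifold (𝓡 d) ∞ X]
  [MeasurableSpace X] [BorelSpace X] [SecondCountableTopology X] [T2Space X] [Nonempty X]
  {ρ : X → ℝ≥0} {Φ : Config X → EReal} {μ : Measure (Config X)}

/-- If the sums over `γ ∩ Λ` of a nonnegative function have finite expectation, then the function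
is integrable over `Λ` against the density `ρ_γ` of an additional point, for almost every `γ`. -/
theorem IsGrandCanonicalGibbs.ae_setLIntegral_ne_top (hd : 0 < d) (hρ : Measurable ρ)
    (hρi : LocallyIntegrable (fun x => (ρ x : ℝ)) (riemannianVolume d X)) (hΦ : IsPotential Φ)
    (hμ : IsGrandCanonicalGibbs ((riemannianVolume d X).withDensity fun x => (ρ x : ℝ≥0∞)) Φ μ)
    {Λ : Set X} (hΛ : IsOpen Λ) (hΛc : IsCompact (closure Λ)) {h : Config X × X → ℝ≥0∞}
    (hh : Measurable h) (hfin : ∫⁻ γ, ∫⁻ x in Λ, h (γ, x) ∂(pointMeasure γ) ∂μ ≠ ⊤) :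
    ∀ᵐ γ ∂μ, ∫⁻ x in Λ, h (γ.addPoint x, x) * rhoGamma Φ ρ γ x ∂(riemannianVolume d X) ≠ ⊤ := by
  have : LocallyCompactSpace X := ChartedSpace.locallyCompactSpace (Euc d) X
  have := isFiniteMeasure_withDensity_restrict hρi hΛ hΛc
  have := nullSingletonClass_withDensity (X := X) hd fun x => (ρ x : ℝ≥0∞)
  have hk : Measurable fun p : Config X × X =>
      h (p.1.addPoint p.2, p.2) * boltzmann Φ {p.2} (p.1.addPoint p.2) :=
    (hh.comp (measurable_addPoint.prodMk measurable_snd)).mul hΦ.measurable_boltzmann_addPoint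
  rw [hμ.lintegral_gnz hΦ hΛ hΛc hh] at hfin
  filter_upwards [ae_lt_top hk.lintegral_prod_right' hfin] with γ hγ
  rw [← hΦ.setLIntegral_withDensity_boltzmann hρ _ hΛ.measurableSet hh]
  exact hγ.ne

/-- An integrable function of the configuration remains integrable over `Λ` if a point is added.
This is the case `h (γ, x) = S γ / γ(Λ)` of the preceding lemma: dividing by the number of points
turns the expectation of `S` into that of a sum over the points in `Λ`. -/
theorem IsGrandCanonicalGibbs.ae_setLIntegral_addPoint_ne_top (hd : 0 < d) (hρ : Measurable ρ)
    (hρi : LocallyIntegrable (fun x => (ρ x : ℝ)) (riemannianVolume d X)) (hΦ : IsPotential Φ)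
    (hμ : IsGrandCanonicalGibbs ((riemannianVolume d X).withDensity fun x => (ρ x : ℝ≥0∞)) Φ μ)
    {Λ : Set X} (hΛ : IsOpen Λ) (hΛc : IsCompact (closure Λ)) {S : Config X → ℝ≥0∞}
    (hS : Measurable S) (hfin : ∫⁻ γ, S γ ∂μ ≠ ⊤) :
    ∀ᵐ γ ∂μ, ∫⁻ x in Λ, S (γ.addPoint x) * rhoGamma Φ ρ γ x ∂(riemannianVolume d X) ≠ ⊤ := by
  have : LocallyCompactSpace X := ChartedSpace.locallyCompactSpace (Euc d) X
  have hNm : Measurable fun γ : Config X => ((γ.count Λ : ℕ∞) : ℝ≥0∞) :=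
    (Measurable.of_discrete (f := fun n : ℕ∞ => (n : ℝ≥0∞))).comp
      (measurable_count hΛ.measurableSet)
  have hSN : Measurable fun γ : Config X => S γ * ((γ.count Λ : ℕ∞) : ℝ≥0∞)⁻¹ := hS.mul hNm.inv
  have hSN' : Measurable fun p : Config X × X => S p.1 * ((p.1.count Λ : ℕ∞) : ℝ≥0∞)⁻¹ :=
    hSN.comp measurable_fst
  have h1 : ∫⁻ γ, ∫⁻ _x in Λ, S γ * ((γ.count Λ : ℕ∞) : ℝ≥0∞)⁻¹ ∂(pointMeasure γ) ∂μ ≠ ⊤ := by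
    refine ne_top_of_le_ne_top hfin (lintegral_mono fun γ => ?_)
    rw [setLIntegral_const, pointMeasure_apply γ hΛ.measurableSet, mul_assoc]
    calc S γ * (((γ.count Λ : ℕ∞) : ℝ≥0∞)⁻¹ * ((γ.count Λ : ℕ∞) : ℝ≥0∞)) ≤ S γ * 1 := by
          gcongr
          exact ENNReal.inv_mul_le_one _
      _ = _ := mul_one _
  filter_upwards [hμ.ae_setLIntegral_ne_top hd hρ hρi hΦ hΛ hΛc hSN' h1] with γ hγ
  have hNγ : ((γ.count Λ : ℕ∞) : ℝ≥0∞) + 1 ≠ ⊤ :=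
    ENNReal.add_ne_top.2 ⟨by simpa using γ.count_ne_top hΛc, ENNReal.one_ne_top⟩
  refine ne_top_of_le_ne_top (ENNReal.mul_ne_top hNγ hγ) ?_
  rw [← lintegral_const_mul' _ _ hNγ]
  refine lintegral_mono fun x => ?_
  have e2 : (((γ.addPoint x).count Λ : ℕ∞) : ℝ≥0∞) ≤ ((γ.count Λ : ℕ∞) : ℝ≥0∞) + 1 := by
    have h := encard_union_le (γ.carrier ∩ Λ) ({x} ∩ Λ)
    rw [← union_inter_distrib_right] at h
    have h' : (γ.addPoint x).count Λ ≤ γ.count Λ + 1 :=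
      h.trans (add_le_add le_rfl ((encard_le_encard inter_subset_left).trans
        (encard_singleton x).le))
    exact_mod_cast h'
  have e3 : 1 ≤ (((γ.count Λ : ℕ∞) : ℝ≥0∞) + 1) *
      (((γ.addPoint x).count Λ : ℕ∞) : ℝ≥0∞)⁻¹ := by
    refine (ENNReal.mul_inv_cancel (a := ((γ.count Λ : ℕ∞) : ℝ≥0∞) + 1) (by simp) hNγ).ge.trans ?_
    gcongr
  calc S (γ.addPoint x) * rhoGamma Φ ρ γ x
      = 1 * (S (γ.addPoint x) * rhoGamma Φ ρ γ x) := (one_mul _).symm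
    _ ≤ (((γ.count Λ : ℕ∞) : ℝ≥0∞) + 1) * (((γ.addPoint x).count Λ : ℕ∞) : ℝ≥0∞)⁻¹ *
          (S (γ.addPoint x) * rhoGamma Φ ρ γ x) := by gcongr
    _ = _ := by ring

/-- A property of pairs `(γ, x)` that holds at almost every additional point `x`, with respect to
`ρ_γ`, holds at all points of almost every configuration. -/
theorem IsGrandCanonicalGibbs.ae_forall_mem_carrier (hd : 0 < d) (hρ : Measurable ρ)
    (hρi : LocallyIntegrable (fun x => (ρ x : ℝ)) (riemannianVolume d X)) (hΦ : IsPotential Φ)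
    (hμ : IsGrandCanonicalGibbs ((riemannianVolume d X).withDensity fun x => (ρ x : ℝ≥0∞)) Φ μ)
    {B : Set (Config X × X)} (hB : MeasurableSet B)
    (h : ∀ᵐ γ ∂μ, ∀ᵐ x ∂(riemannianVolume d X), rhoGamma Φ ρ γ x ≠ 0 → (γ.addPoint x, x) ∈ B) :
    ∀ᵐ γ ∂μ, ∀ x ∈ γ.carrier, (γ, x) ∈ B := by
  have : LocallyCompactSpace X := ChartedSpace.locallyCompactSpace (Euc d) X
  obtain ⟨Λ, hΛo, hΛc, -, hU, -⟩ := exists_open_exhaustion (X := X)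
  have hh : Measurable (Bᶜ.indicator (1 : Config X × X → ℝ≥0∞)) := measurable_one.indicator hB.compl
  have key : ∀ n, ∀ᵐ γ ∂μ,
      ∫⁻ x in Λ n, Bᶜ.indicator (1 : Config X × X → ℝ≥0∞) (γ, x) ∂(pointMeasure γ) = 0 := by
    intro n
    have := isFiniteMeasure_withDensity_restrict hρi (hΛo n) (hΛc n)
    have := nullSingletonClass_withDensity (X := X) hd fun x => (ρ x : ℝ≥0∞)
    have hm : Measurable fun γ : Config X =>
        ∫⁻ x in Λ n, Bᶜ.indicator (1 : Config X × X → ℝ≥0∞) (γ, x) ∂(pointMeasure γ) := by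
      simp_rw [pointMeasure_restrict (hΛo n).measurableSet]
      exact measurable_lintegral_pointMeasure (measurable_restr (hΛo n).measurableSet) hh
    refine (lintegral_eq_zero_iff hm).1 ?_
    rw [hμ.lintegral_gnz hΦ (hΛo n) (hΛc n) hh]
    refine (lintegral_congr_ae ?_).trans lintegral_zero
    filter_upwards [h] with γ hγ
    rw [hΦ.setLIntegral_withDensity_boltzmann hρ _ (hΛo n).measurableSet hh]
    refine (lintegral_congr_ae ?_).trans lintegral_zero
    filter_upwards [ae_restrict_of_ae hγ] with x hx
    by_cases h0 : rhoGamma Φ ρ γ x = 0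
    · rw [h0, mul_zero]
    · rw [indicator_of_notMem (notMem_compl_iff.2 (hx h0)), zero_mul]
  filter_upwards [ae_all_iff.2 key] with γ hγ x hx
  obtain ⟨n, hn⟩ := mem_iUnion.1 (hU ▸ mem_univ x : x ∈ ⋃ n, Λ n)
  have h1 := hγ n
  rw [pointMeasure_restrict (hΛo n).measurableSet, lintegral_pointMeasure,
    ENNReal.tsum_eq_zero] at h1
  by_contra hxB
  have h2 := h1 ⟨x, hx, hn⟩
  rw [indicator_of_mem hxB] at h2
  exact one_ne_zero h2

theorem tsum_two_pow_mul_lintegral {α : Type*} [MeasurableSpace α] {ν : Measure α}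
    {f : ℕ → α → ℝ≥0∞} (hf : ∀ k, Measurable (f k)) :
    ∑' k : ℕ, 2 ^ k * ∫⁻ a, f k a ∂ν = ∫⁻ a, ∑' k : ℕ, 2 ^ k * f k a ∂ν := by
  rw [lintegral_tsum fun k => ((hf k).const_mul _).aemeasurable]
  exact tsum_congr fun k => (lintegral_const_mul _ (hf k)).symm

variable [IsContMDiffRiemannianBundle (𝓡 d) ∞ (Euc d) (fun x : X => TangentSpace (𝓡 d) x)]

/-- The core of the closability argument: along a sequence of cylinder functions that tends to `0`
fast and whose gradients form a fast Cauchy sequence, the gradients tend to `0` almost everywhere.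
-/
theorem IsGrandCanonicalGibbs.ae_tendsto_norm_grad (hd : 0 < d) (hρ : Measurable ρ)
    (hρi : LocallyIntegrable (fun x => (ρ x : ℝ)) (riemannianVolume d X)) (hΦ : IsPotential Φ)
    (hμ : IsGrandCanonicalGibbs ((riemannianVolume d X).withDensity fun x => (ρ x : ℝ≥0∞)) Φ μ)
    (hcl : ∀ᵐ γ ∂μ, GradClosable d (rhoGamma Φ ρ γ)) (c : ℕ → CylinderRep d X)
    (h0 : ∑' k : ℕ, 2 ^ k * ∫⁻ γ, ‖(c k).toFun γ‖ₑ ^ 2 ∂μ ≠ ⊤)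
    (h1 : ∑' k : ℕ, 2 ^ k * ∫⁻ γ, ∫⁻ x, ‖(c (k + 1)).grad γ x - (c k).grad γ x‖ₑ ^ 2
      ∂(pointMeasure γ) ∂μ ≠ ⊤) :
    ∀ᵐ γ ∂μ, ∀ x ∈ γ.carrier, Tendsto (fun k => ‖(c k).grad γ x‖) atTop (𝓝 0) := by
  have : LocallyCompactSpace X := ChartedSpace.locallyCompactSpace (Euc d) X
  obtain ⟨Λ, hΛo, hΛc, -, -, hK⟩ := exists_open_exhaustion (X := X)
  have hB : MeasurableSet {p : Config X × X |
      Tendsto (fun k => ‖(c k).grad p.1 p.2‖) atTop (𝓝 0)} :=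
    measurableSet_tendsto _ fun k => (c k).measurable_norm_grad
  refine hμ.ae_forall_mem_carrier hd hρ hρi hΦ hB ?_
  have hFm : ∀ k, Measurable fun γ => ‖(c k).toFun γ‖ₑ ^ 2 := fun k =>
    (c k).measurable_toFun.enorm.pow_const 2
  set S : Config X → ℝ≥0∞ := fun γ => ∑' k : ℕ, 2 ^ k * ‖(c k).toFun γ‖ₑ ^ 2 with hS
  set T : Config X × X → ℝ≥0∞ := fun p => ∑' k : ℕ, 2 ^ k *
    Function.uncurry (fun γ x => ‖(c (k + 1)).grad γ x - (c k).grad γ x‖ₑ ^ 2) p with hT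
  have hSm : Measurable S := Measurable.tsum fun k => (hFm k).const_mul _
  have hTm : Measurable T := Measurable.tsum fun k =>
    ((c (k + 1)).measurable_enorm_grad_sub (c k)).const_mul _
  rw [tsum_two_pow_mul_lintegral hFm] at h0
  rw [tsum_two_pow_mul_lintegral fun k => (c (k + 1)).measurable_lintegral_enorm_grad_sub (c k)]
    at h1
  have hA : ∀ n, ∀ᵐ γ ∂μ, ∫⁻ x in Λ n, S (γ.addPoint x) * rhoGamma Φ ρ γ x
      ∂(riemannianVolume d X) ≠ ⊤ := fun n =>
    hμ.ae_setLIntegral_addPoint_ne_top hd hρ hρi hΦ (hΛo n) (hΛc n) hSm h0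
  have hT1 : ∀ n, ∫⁻ γ, ∫⁻ x in Λ n, T (γ, x) ∂(pointMeasure γ) ∂μ ≠ ⊤ := by
    intro n
    refine ne_top_of_le_ne_top h1 (lintegral_mono fun γ => ?_)
    rw [tsum_two_pow_mul_lintegral fun k =>
      (c (k + 1)).measurable_enorm_grad_sub_right (c k) γ]
    exact setLIntegral_le_lintegral _ _
  have hB : ∀ n, ∀ᵐ γ ∂μ, ∫⁻ x in Λ n, T (γ.addPoint x, x) * rhoGamma Φ ρ γ x
      ∂(riemannianVolume d X) ≠ ⊤ := fun n =>
    hμ.ae_setLIntegral_ne_top hd hρ hρi hΦ (hΛo n) (hΛc n) hTm (hT1 n)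
  filter_upwards [hcl, ae_all_iff.2 hA, ae_all_iff.2 hB] with γ hγ hAγ hBγ
  have : NullSingletonClass (riemannianVolume d X) := ⟨riemannianVolume_singleton hd⟩
  have hγm := ae_notMem_carrier (riemannianVolume d X) γ
  have hrm : Measurable (rhoGamma Φ ρ γ) :=
    hΦ.measurable_rhoGamma_right hρ γ
  have hsm : ∀ k, ContMDiff (𝓡 d) 𝓘(ℝ, ℝ) ∞ ((c k).shift γ) := fun k => (c k).contMDiff_shift γ
  have hum : ∀ k, Measurable fun x => ‖(c k).shift γ x‖ₑ ^ 2 * rhoGamma Φ ρ γ x := fun k =>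
    ((hsm k).continuous.measurable.enorm.pow_const 2).mul hrm
  have hdm : ∀ k, Measurable fun x =>
      ‖riemGrad d ((c (k + 1)).shift γ) x - riemGrad d ((c k).shift γ) x‖ₑ ^ 2 *
        rhoGamma Φ ρ γ x := fun k =>
    ((measurable_enorm_riemGrad_sub (hsm (k + 1)) (hsm k)).pow_const 2).mul hrm
  have hres := hγ (fun k => (c k).shift γ) hsm ?_ ?_
  · filter_upwards [hres, hγm] with x hx hxγ hx0
    refine (hx hx0).congr fun k => ?_
    rw [← (c k).grad_addPoint γ hxγ]
  · intro K hKc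
    obtain ⟨n, hn⟩ := hK K hKc
    rw [tsum_two_pow_mul_lintegral hum]
    refine ne_top_of_le_ne_top (hAγ n) ?_
    refine (lintegral_mono_set hn).trans (lintegral_mono_ae (ae_restrict_of_ae ?_))
    filter_upwards [hγm] with x hx
    simp only [hS, (c _).toFun_addPoint γ hx, ← ENNReal.tsum_mul_right, mul_assoc]
    exact le_rfl
  · intro K hKc
    obtain ⟨n, hn⟩ := hK K hKc
    rw [tsum_two_pow_mul_lintegral hdm]
    refine ne_top_of_le_ne_top (hBγ n) ?_
    refine (lintegral_mono_set hn).trans (lintegral_mono_ae (ae_restrict_of_ae ?_))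
    filter_upwards [hγm] with x hx
    simp only [hT, Function.uncurry, (c _).grad_addPoint γ hx, ← ENNReal.tsum_mul_right, mul_assoc]
    exact le_rfl

end NullSequences

/-! ### The form is well defined and closable -/

section Form

variable {d : ℕ} {X : Type*} [TopologicalSpace X] [ChartedSpace (Euc d) X]
  [RiemannianBundle (fun x : X => TangentSpace (𝓡 d) x)]

theorem dirichletForm_self_nonneg (μ : Measure (Config X)) (F : Config X → ℝ) :
    0 ≤ dirichletForm d μ F F :=
  integral_nonneg fun _ => finsum_nonneg fun _ => finsum_nonneg fun _ => real_inner_self_nonneg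

variable [MeasurableSpace X] [T2Space X] [IsManifold (𝓡 d) ∞ X] [BorelSpace X]
  [SecondCountableTopology X] [Nonempty X]
  [IsContMDiffRiemannianBundle (𝓡 d) ∞ (Euc d) (fun x : X => TangentSpace (𝓡 d) x)]
  {ρ : X → ℝ≥0} {Φ : Config X → EReal} {μ : Measure (Config X)}

theorem CylinderRep.ofReal_dirichletForm_sub (hμr : HasRadonMean μ) (c c' : CylinderRep d X) :
    ENNReal.ofReal (dirichletForm d μ (c.toFun - c'.toFun) (c.toFun - c'.toFun)) =
      ∫⁻ γ, ∫⁻ x, ‖c.grad γ x - c'.grad γ x‖ₑ ^ 2 ∂(pointMeasure γ) ∂μ := by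
  rw [← c.toFun_sub, CylinderRep.ofReal_dirichletForm hμr]
  refine lintegral_congr fun γ => ?_
  rw [lintegral_pointMeasure, lintegral_pointMeasure]
  exact tsum_congr fun x => by rw [c.grad_sub c' γ x.2]

/-- If `F = G` almost everywhere, then the gradients agree: the constant sequence `F - G` tends to
zero, and it is Cauchy. -/
theorem IsGrandCanonicalGibbs.isWellDefinedForm (hd : 0 < d) (hρ : Measurable ρ)
    (hρi : LocallyIntegrable (fun x => (ρ x : ℝ)) (riemannianVolume d X)) (hΦ : IsPotential Φ)
    (hμ : IsGrandCanonicalGibbs ((riemannianVolume d X).withDensity fun x => (ρ x : ℝ≥0∞)) Φ μ)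
    (hμr : HasRadonMean μ) (hcl : ∀ᵐ γ ∂μ, GradClosable d (rhoGamma Φ ρ γ)) :
    IsWellDefinedForm d μ := by
  constructor
  · rintro _ _ ⟨c, rfl⟩ ⟨c', rfl⟩
    exact c.integrable_tangentInner hμr c'
  · rintro _ _ ⟨c, rfl⟩ ⟨c', rfl⟩ hcc'
    have h0 : ∫⁻ γ, ‖(c.sub c').toFun γ‖ₑ ^ 2 ∂μ = 0 := by
      refine (lintegral_congr_ae ?_).trans lintegral_zero
      filter_upwards [hcc'] with γ hγ
      rw [c.toFun_sub, Pi.sub_apply, hγ, sub_self, enorm_zero, zero_pow two_ne_zero]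
    have h := hμ.ae_tendsto_norm_grad hd hρ hρi hΦ hcl (fun _ => c.sub c') (by simp [h0])
      (by simp)
    filter_upwards [h] with γ hγ x hx
    have h1 := tendsto_nhds_unique (hγ x hx) tendsto_const_nhds
    rw [eq_comm, norm_eq_zero, c.grad_sub c' γ hx, sub_eq_zero] at h1
    rw [gradGamma_toFun c γ hx, gradGamma_toFun c' γ hx, h1]

/-- Lower semicontinuity of the form along a sequence whose gradients vanish in the limit. -/
theorem CylinderRep.lintegral_grad_le_liminf (c : CylinderRep d X) (b : ℕ → CylinderRep d X)
    (h : ∀ᵐ γ ∂μ, ∀ x ∈ γ.carrier, Tendsto (fun k => ‖(b k).grad γ x‖) atTop (𝓝 0)) :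
    ∫⁻ γ, ∫⁻ x, ‖c.grad γ x‖ₑ ^ 2 ∂(pointMeasure γ) ∂μ ≤
      liminf (fun k => ∫⁻ γ, ∫⁻ x, ‖c.grad γ x - (b k).grad γ x‖ₑ ^ 2 ∂(pointMeasure γ) ∂μ)
        atTop := by
  refine le_trans (lintegral_mono_ae ?_)
    (lintegral_liminf_le fun k => c.measurable_lintegral_enorm_grad_sub (b k))
  filter_upwards [h] with γ hγ
  refine le_trans ?_ (lintegral_liminf_le fun k => c.measurable_enorm_grad_sub_right (b k) γ)
  rw [lintegral_pointMeasure, lintegral_pointMeasure]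
  refine ENNReal.tsum_le_tsum fun x => ?_
  have h1 : Tendsto (fun k => ‖c.grad γ x - (b k).grad γ x‖) atTop (𝓝 ‖c.grad γ x‖) := by
    rw [tendsto_iff_norm_sub_tendsto_zero]
    refine squeeze_zero (fun _ => norm_nonneg _) (fun k => ?_) (hγ x x.2)
    refine (abs_norm_sub_norm_le _ _).trans_eq ?_
    rw [sub_sub_cancel_left, norm_neg]
  have h2 : Tendsto (fun k => ‖c.grad γ x - (b k).grad γ x‖ₑ ^ 2) atTop
      (𝓝 (‖c.grad γ x‖ₑ ^ 2)) := by
    simp_rw [← ofReal_norm]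
    exact ((ENNReal.continuous_pow 2).tendsto _).comp (ENNReal.tendsto_ofReal h1)
  exact h2.liminf_eq.ge

/-- Closability: the gradients vanish along a fast subsequence, so `F n` has at most the energy
`liminf_k` of `F n - F (φ k)`, which is small for large `n`. -/
theorem IsGrandCanonicalGibbs.isClosableForm (hd : 0 < d) (hρ : Measurable ρ)
    (hρi : LocallyIntegrable (fun x => (ρ x : ℝ)) (riemannianVolume d X)) (hΦ : IsPotential Φ)
    (hμ : IsGrandCanonicalGibbs ((riemannianVolume d X).withDensity fun x => (ρ x : ℝ≥0∞)) Φ μ)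
    (hμr : HasRadonMean μ) (hcl : ∀ᵐ γ ∂μ, GradClosable d (rhoGamma Φ ρ γ)) :
    IsClosableForm d μ := by
  intro F hF hE hL
  choose c hc using hF
  obtain rfl : (fun n => (c n).toFun) = F := funext hc
  set E : ℕ → ℕ → ℝ≥0∞ := fun n m =>
    ∫⁻ γ, ∫⁻ x, ‖(c n).grad γ x - (c m).grad γ x‖ₑ ^ 2 ∂(pointMeasure γ) ∂μ with hEdef
  have hE' : ∀ ε : ℝ≥0∞, 0 < ε → ∃ N, ∀ n m, N ≤ n → N ≤ m → E n m ≤ ε := by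
    intro ε hε
    have h := ENNReal.tendsto_ofReal hE
    simp_rw [CylinderRep.ofReal_dirichletForm_sub hμr, ENNReal.ofReal_zero] at h
    exact eventually_atTop_prod_self.1 (h.eventually_le_const hε)
  have hL' : Tendsto (fun n => ∫⁻ γ, ‖(c n).toFun γ‖ₑ ^ 2 ∂μ) atTop (𝓝 0) := by
    have h := ((ENNReal.continuous_pow 2).tendsto _).comp hL
    rw [zero_pow two_ne_zero] at h
    refine h.congr fun n => ?_
    have := eLpNorm_nnreal_pow_eq_lintegral (μ := μ) (f := (c n).toFun) (p := 2) two_ne_zero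
    simpa using this
  set δ : ℕ → ℝ≥0∞ := fun k => 2⁻¹ ^ k * 2⁻¹ ^ k with hδ
  have hδ0 : ∀ k, 0 < δ k := fun k =>
    ENNReal.mul_pos (pow_ne_zero _ (by simp)) (pow_ne_zero _ (by simp))
  have hδs : ∑' k, 2 ^ k * δ k ≠ ⊤ := by
    have h : ∀ k, 2 ^ k * δ k = 2⁻¹ ^ k := fun k => by
      rw [hδ, ← mul_assoc, ← mul_pow, ENNReal.mul_inv_cancel (by simp) (by simp), one_pow, one_mul]
    simp_rw [h]
    simp [ENNReal.tsum_geometric]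
  obtain ⟨φ, hφ, hφP⟩ := extraction_forall_of_eventually
    (P := fun k N => (∀ n m, N ≤ n → N ≤ m → E n m ≤ δ k) ∧
      ∫⁻ γ, ‖(c N).toFun γ‖ₑ ^ 2 ∂μ ≤ δ k) (fun k => by
    obtain ⟨N, hN⟩ := hE' (δ k) (hδ0 k)
    filter_upwards [eventually_ge_atTop N, hL'.eventually_le_const (hδ0 k)] with M hM hM'
    exact ⟨fun n m hn hm => hN n m (hM.trans hn) (hM.trans hm), hM'⟩)
  have hlim := hμ.ae_tendsto_norm_grad hd hρ hρi hΦ hcl (fun k => c (φ k))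
    (ne_top_of_le_ne_top hδs (ENNReal.tsum_le_tsum fun k => by
      gcongr
      exact (hφP k).2))
    (ne_top_of_le_ne_top hδs (ENNReal.tsum_le_tsum fun k => by
      gcongr
      exact (hφP k).1 _ _ (hφ.monotone k.le_succ) le_rfl))
  have hfin : Tendsto (fun n => ENNReal.ofReal (dirichletForm d μ (c n).toFun (c n).toFun)) atTop
      (𝓝 0) := by
    refine ENNReal.tendsto_atTop_zero.2 fun ε hε => ?_
    obtain ⟨N, hN⟩ := hE' ε hε
    refine ⟨N, fun n hn => ?_⟩
    rw [CylinderRep.ofReal_dirichletForm hμr]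
    refine ((c n).lintegral_grad_le_liminf _ hlim).trans ?_
    refine (liminf_le_liminf (v := fun _ => ε) ?_).trans_eq (liminf_const ε)
    filter_upwards [hφ.tendsto_atTop.eventually_ge_atTop N] with k hk
    exact hN n (φ k) hn hk
  have h := (ENNReal.tendsto_toReal ENNReal.zero_ne_top).comp hfin
  rw [ENNReal.toReal_zero] at h
  exact h.congr fun n => ENNReal.toReal_ofReal (dirichletForm_self_nonneg μ _)

end Form

end ConfigSpace

theorem theorem6p13 :
    (∀ (d : ℕ) (_ : 0 < d) (X : Type*) [TopologicalSpace X] [T2Space X]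
      [SecondCountableTopology X] [ConnectedSpace X] [MeasurableSpace X] [BorelSpace X]
      [ChartedSpace (Euc d) X] [IsManifold (𝓡 d) ∞ X]
      [RiemannianBundle (fun x : X => TangentSpace (𝓡 d) x)]
      [IsContMDiffRiemannianBundle (𝓡 d) ∞ (Euc d) (fun x : X => TangentSpace (𝓡 d) x)]
      (ρ : X → ℝ≥0) (Φ : Config X → EReal) (μ : Measure (Config X)),
      Measurable ρ →
      LocallyIntegrable (fun x => (ρ x : ℝ)) (riemannianVolume d X) →
      IsPotential Φ →
      IsGrandCanonicalGibbs ((riemannianVolume d X).withDensity fun x => (ρ x : ℝ≥0∞)) Φ μ →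
      HasRadonMean μ →
      (∀ᵐ γ ∂μ, LocalInvIntegrable (riemannianVolume d X) (rhoGamma Φ ρ γ)) →
      IsWellDefinedForm d μ ∧ IsClosableForm d μ) ∧
    (∀ (n : ℕ) (ρ : Euc (n + 1) → ℝ≥0) (Φ : Config (Euc (n + 1)) → EReal)
      (μ : Measure (Config (Euc (n + 1)))),
      Measurable ρ →
      LocallyIntegrable (fun x => (ρ x : ℝ)) (riemannianVolume (n + 1) (Euc (n + 1))) →
      IsPotential Φ →
      IsGrandCanonicalGibbs
        ((riemannianVolume (n + 1) (Euc (n + 1))).withDensity fun x => (ρ x : ℝ≥0∞)) Φ μ →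
      HasRadonMean μ →
      (∀ᵐ γ ∂μ, LineInvIntegrable (rhoGamma Φ ρ γ)) →
      IsWellDefinedForm (n + 1) μ ∧ IsClosableForm (n + 1) μ) := by

  refine ⟨?_, ?_⟩
  · intro d hd X _ _ _ _ _ _ _ _ _ _ ρ Φ μ hρ hρi hΦ hμ hμr hloc
    have hcl : ∀ᵐ γ ∂μ, GradClosable d (rhoGamma Φ ρ γ) := by
      have : LocallyCompactSpace X := ChartedSpace.locallyCompactSpace (Euc d) X
      filter_upwards [hloc] with γ hγ
      exact gradClosable_of_localInvIntegrable (hΦ.measurable_rhoGamma_right hρ γ) hγ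
    exact ⟨hμ.isWellDefinedForm hd hρ hρi hΦ hμr hcl, hμ.isClosableForm hd hρ hρi hΦ hμr hcl⟩
  · intro n ρ Φ μ hρ hρi hΦ hμ hμr hline
    have hcl : ∀ᵐ γ ∂μ, GradClosable (n + 1) (rhoGamma Φ ρ γ) := by
      filter_upwards [hline] with γ hγ
      exact gradClosable_of_lineInvIntegrable (hΦ.measurable_rhoGamma_right hρ γ) hγ
    exact ⟨hμ.isWellDefinedForm n.succ_pos hρ hρi hΦ hμr hcl,
      hμ.isClosableForm n.succ_pos hρ hρi hΦ hμr hcl⟩
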